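/- Let $\mathcal O$ be a complete discrete valuation ring with algebraically closed residue field $k$ of characteristic $2$ and with quotient field $K$ of characteristic $0$. Let $\tilde A_4 = Q_8\rtimes C_3$ be the semidirect product of the quaternion group of order $8$ with a cyclic group of order $3$ acting nontrivially (equivalently, $\tilde A_4\cong SL_2(3)$, the double cover of $A_4$). For an $\mathcal O$-algebra $A$ such that $K\otimes_{\mathcal O}A$ is split semisimple (that is, isomorphic to a finite direct product of matrix algebras over $K$), let $\mathrm{Irr}_K(A)$ be the set of characters of the simple $K\otimes_{\mathcal O}A$-modules, let $\mathbb Z\mathrm{Irr}_K(A)$ be the group of generalised characters, with the scalar product for which $\mathrm{Irr}_K(A)$ is an orthonormal basis, let $\mathrm{Proj}(A)\subseteq \mathbb Z\mathrm{Irr}_K(A)$ be the subgroup generated by the characters of the projective indecomposable $A$-modules, and for $\chi\in\mathrm{Irr}_K(A)$ let $e(\chi)$ be the corresponding primitive idempotent of $Z(K\otimes_{\mathcal O}A)$; put $e(-\chi)=e(\chi)$. **Theorem B.** Let $A$ be an $\mathcal O$-free $\mathcal O$-algebra such that $K\otimes_{\mathcal O} A$ is split semisimple and such that the $k$-algebra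 $k\otimes_{\mathcal O} A$ is Morita equivalent to $k\tilde A_4$. Assume that there is an isometry $\Phi:\mathbb Z\mathrm{Irr}_K(A)\cong\mathbb Z\mathrm{Irr}_K(\mathcal O\tilde A_4)$ which maps $\mathrm{Proj}(A)$ to $\mathrm{Proj}(\mathcal O\tilde A_4)$ such that the map sending $e(\chi)$ to $e(\Phi(\chi))$ for every $\chi\in\mathrm{Irr}_K(A)$ induces an $\mathcal O$-algebra isomorphism of the centers $Z(A)\cong Z(\mathcal O\tilde A_4)$. (As $\Phi$ is an isometry, $\Phi(\chi)=\pm\psi$ with $\psi$ irreducible. "Induces" means that the $K$-linear map $Z(K\otimes_{\mathcal O} A)\to Z(K\otimes_{\mathcal O}\mathcal O\tilde A_4)$ sending each $e(\chi)$ to $e(\Phi(\chi))$ restricts to such an isomorphism.) Then the $\mathcal O$-algebra $A$ is Morita equivalent to $\mathcal O\tilde A_4$. -/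

import Mathlib

open scoped TensorProduct

universe u

/-! ### The group `Ã₄ = Q₈ ⋊ C₃` -/

/-- The automorphism of order three of the quaternion group of order eight.  In Hamilton's notation,
with `i = a 1`, `j = xa 0` and `k = i * j = xa 3`, it is `i ↦ j ↦ k ↦ i`. -/
def quaternionRotation : MulAut (QuaternionGroup 2) where
  toFun
    | .a n => ![.a 0, .xa 0, .a 2, .xa 2] (n : Fin 4)
    | .xa n => ![.xa 3, .a 3, .xa 1, .a 1] (n : Fin 4)
  invFun
    | .a n => ![.a 0, .xa 3, .a 2, .xa 1] (n : Fin 4)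
    | .xa n => ![.a 1, .xa 2, .a 3, .xa 0] (n : Fin 4)
  left_inv := by
    rintro (n | n) <;> change Fin 4 at n <;> fin_cases n <;> rfl
  right_inv := by
    rintro (n | n) <;> change Fin 4 at n <;> fin_cases n <;> rfl
  map_mul' := by
    rintro (n | n) (m | m) <;> change Fin 4 at n m <;> fin_cases n <;> fin_cases m <;> rfl

theorem quaternionRotation_pow_three : quaternionRotation ^ 3 = 1 := by
  ext x
  rcases x with n | n <;> change Fin 4 at n <;> fin_cases n <;> rfl

/-- The nontrivial action of the cyclic group of order three on `Q₈`; the generator acts through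
`quaternionRotation`. -/
def quaternionAction : Multiplicative (ZMod 3) →* MulAut (QuaternionGroup 2) where
  toFun n := quaternionRotation ^ (Multiplicative.toAdd n).val
  map_one' := by simp
  map_mul' n m := by
    rw [toAdd_mul, ZMod.val_add, ← pow_add]
    exact (pow_eq_pow_mod _ quaternionRotation_pow_three).symm

/-- The group `Ã₄ = Q₈ ⋊ C₃` (the double cover of the alternating group `A₄`, of order `24`). -/
abbrev TildeA4 : Type := QuaternionGroup 2 ⋊[quaternionAction] Multiplicative (ZMod 3)

/-! ### Characters -/

section Characters

/-- The character of a module `V` over an `R`-algebra `B`: the element `b` is sent to the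
trace over `R` of the action of `b` on `V`. -/
noncomputable def moduleCharacter (R B V : Type*) [CommRing R] [Ring B] [Algebra R B]
    [AddCommGroup V] [Module R V] [Module B V] [IsScalarTower R B V] : B →ₗ[R] R :=
  LinearMap.trace R V ∘ₗ (Algebra.lsmul R R V : B →ₐ[R] Module.End R V).toLinearMap

/-- A `K`-algebra is split semisimple if it is isomorphic to a finite direct product of full
matrix algebras over `K`. -/
def IsSplitSemisimple (K : Type*) (B : Type*) [Field K] [Ring B] [Algebra K B] : Prop :=
  ∃ (n : ℕ) (d : Fin n → ℕ), (∀ i, 0 < d i) ∧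
    Nonempty (B ≃ₐ[K] ((i : Fin n) → Matrix (Fin (d i)) (Fin (d i)) K))

/-- The set of characters of the simple modules of a `K`-algebra `B`.  For an `O`-algebra `A`, the
set `Irr_K(A)` is `IrrChar K (K ⊗[O] A)`; a character `χ` is viewed as a function on `A` through
`a ↦ χ (1 ⊗ₜ a)`. -/
def IrrChar (K B : Type u) [Field K] [Ring B] [Algebra K B] : Set (B →ₗ[K] K) :=
  {χ | ∃ (V : Type u) (_ : AddCommGroup V) (_ : Module K V) (_ : Module B V)
      (_ : IsScalarTower K B V), IsSimpleModule B V ∧ χ = moduleCharacter K B V}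

/-- The group `ℤ Irr` of generalised characters, as the free abelian group on the irreducible
characters. -/
abbrev ZIrr (K B : Type u) [Field K] [Ring B] [Algebra K B] : Type u := IrrChar K B →₀ ℤ

/-- The function `B → K` given by a generalised character. -/
noncomputable def ZIrr.toFunction {K B : Type u} [Field K] [Ring B] [Algebra K B] (f : ZIrr K B) :
    B →ₗ[K] K :=
  f.sum fun χ n => n • (χ : B →ₗ[K] K)

/-- The usual scalar product of generalised characters, for which the irreducible characters are
orthonormal. -/
noncomputable def ZIrr.scalarProduct {K B : Type u} [Field K] [Ring B] [Algebra K B]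
    (f g : ZIrr K B) : ℤ :=
  f.sum fun χ n => n * g χ

/-- A projective indecomposable module: finitely generated, projective, nonzero, and not the direct
sum of two nonzero submodules. -/
structure IsProjectiveIndecomposable (A P : Type*) [Ring A] [AddCommGroup P] [Module A P] :
    Prop where
  finite : Module.Finite A P
  projective : Module.Projective A P
  nontrivial : Nontrivial P
  indecomposable : ∀ U W : Submodule A P, IsCompl U W → U = ⊥ ∨ W = ⊥

/-- The subgroup `Proj(A)` of `ℤ Irr_K(A)` generated by the characters of the projective
indecomposable `A`-modules. -/
noncomputable def projSubgroup (O K A : Type u) [CommRing O] [Field K] [Algebra O K] [Ring A] [Algebra O A] :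
    AddSubgroup (ZIrr K (K ⊗[O] A)) :=
  AddSubgroup.closure
    {f | ∃ (P : Type u) (_ : AddCommGroup P) (_ : Module O P) (_ : Module A P)
      (_ : IsScalarTower O A P), IsProjectiveIndecomposable A P ∧
        ∀ a : A, f.toFunction (1 ⊗ₜ[O] a) = algebraMap O K (moduleCharacter O A P a)}

/-- `e = e(χ)`: `e` is the primitive idempotent of the center `Z(B)` that corresponds to the
irreducible character `χ`, that is, the one which acts as the identity on a simple module with
character `χ`. -/
structure IsCentralIdempotentOf {K B : Type u} [Field K] [Ring B] [Algebra K B]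
    (χ : IrrChar K B) (e : Subalgebra.center K B) : Prop where
  idempotent : IsIdempotentElem e
  ne_zero : e ≠ 0
  primitive : ∀ f : Subalgebra.center K B, IsIdempotentElem f → e * f = f → f = 0 ∨ f = e
  apply_mul : ∀ b : B, χ.1 ((e : B) * b) = χ.1 b

end Characters

/-! ### Isometries and centers -/

section Centers

variable (O K A : Type u) [CommRing O] [Field K] [Algebra O K] [Ring A] [Algebra O A]

/-- For `z` in `Z(A)`, the element `1 ⊗ z` is in `Z(K ⊗ A)`. -/
theorem one_tmul_mem_center (z : Subalgebra.center O A) :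
    (1 : K) ⊗ₜ[O] (z : A) ∈ Subalgebra.center K (K ⊗[O] A) := by
  rw [Subalgebra.mem_center_iff]
  intro b
  induction b using TensorProduct.induction_on with
  | zero => simp
  | tmul x a =>
    rw [Algebra.TensorProduct.tmul_mul_tmul, Algebra.TensorProduct.tmul_mul_tmul, mul_one, one_mul,
      (Subalgebra.mem_center_iff.mp z.2 a)]
  | add x y hx hy => rw [add_mul, mul_add, hx, hy]

/-- The canonical map `Z(A) → Z(K ⊗ A)`, `z ↦ 1 ⊗ z`. -/
def centerToBaseChange (z : Subalgebra.center O A) : Subalgebra.center K (K ⊗[O] A) :=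
  ⟨(1 : K) ⊗ₜ[O] (z : A), one_tmul_mem_center O K A z⟩

variable {O K A}
variable {A' : Type u} [Ring A'] [Algebra O A']

/-- `Φ` is an isometry for the usual scalar products. -/
def IsCharIsometry (Φ : ZIrr K (K ⊗[O] A) ≃+ ZIrr K (K ⊗[O] A')) : Prop :=
  ∀ f g, ZIrr.scalarProduct (Φ f) (Φ g) = ZIrr.scalarProduct f g

/-- The assignment `e(χ) ↦ e(Φ(χ))` induces an isomorphism of `O`-algebras `Z(A) ≅ Z(A')`.
Here `F` is the `K`-linear map `Z(K ⊗ A) → Z(K ⊗ A')` with `F(e(χ)) = e(Φ(χ))`, where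
`e(Φ(χ))` means `e(ψ)` if `Φ(χ) = ψ` or `Φ(χ) = -ψ` with `ψ` irreducible. -/
def InducesCenterIso (Φ : ZIrr K (K ⊗[O] A) ≃+ ZIrr K (K ⊗[O] A')) : Prop :=
  ∃ (F : Subalgebra.center K (K ⊗[O] A) →ₗ[K] Subalgebra.center K (K ⊗[O] A'))
    (θ : Subalgebra.center O A ≃ₐ[O] Subalgebra.center O A'),
    (∀ (χ : IrrChar K (K ⊗[O] A)) (ψ : IrrChar K (K ⊗[O] A')),
      (Φ (Finsupp.single χ 1) = Finsupp.single ψ 1 ∨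
        Φ (Finsupp.single χ 1) = -Finsupp.single ψ 1) →
      ∀ e f, IsCentralIdempotentOf χ e → IsCentralIdempotentOf ψ f → F e = f) ∧
    ∀ z, F (centerToBaseChange O K A z) = centerToBaseChange O K A' (θ z)

end Centers

/-!
# Lifting a Morita equivalence with the group algebra of `Ã₄`

Let `π` generate the maximal ideal of `O`, and let `k` be the residue field. Of the isometry, only
the isomorphism of centers `Z(A) ≅ Z(O Ã₄)` is needed: together with the Morita equivalence over
`k`, it already determines `A` up to Morita equivalence.

*Reduction to a corner.* The Morita equivalence over `k` exhibits `k Ã₄` as a full corner of a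
matrix algebra over `k ⊗ A` (`IsMoritaEquivalent.exists_isFullCorner`). Its idempotent lifts to the
matrix algebra over `A`, by a Newton iteration (`IsFullCorner.exists_lift`). The corner `C` so
obtained is Morita equivalent to `A` (`IsFullCorner.isMoritaEquivalent`), its reduction modulo `π`
is `k Ã₄`, and the center of `A` acts on it (`isCentralOrder_centerToCorner`). It remains to see
that `C` and `O Ã₄`, which are algebras over `Z(O Ã₄)` with the same reduction, are isomorphic.

*The center.* The values of the seven central characters identify `Z(O Ã₄)` with an explicit order
in `O ^ 7`, the order `centerOrder O` (`exists_center_algEquiv`). It has a group of symmetries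
isomorphic to the symmetric group of degree four, permuting the seven characters; not all of them
come from automorphisms of `O Ã₄`.

*The Peirce components.* The three primitive idempotents `f i` of `C` come from an element of order
three. The components of `k Ã₄` are cyclic over the center, of dimension four on the diagonal and
two off it (`isQuiverModel_groupAlgebra`). By Nakayama's lemma, every component of `C` is generated
over the order by one element `β i l`, a lift of an arrow of the quiver of `k Ã₄`. As a module over
the order, it is determined by the set of characters at which it is nonzero, its support.

*The supports.* The square of the closed path `β i l * β l i` does not vanish modulo `π`. Comparing
with squares in the order, which modulo `2` are governed by the Hamming code of length seven, one
finds that the support of `f i` is the complement of a line of a Fano plane on the seven characters,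
with one line excluded, and that the support of `β i l` contains a character from the excluded line
and one outside of it (`mem_goodSupports`, `isMixed_of_not_sqDvd`). Up to a symmetry of the order,
this leaves one configuration (`IsArrowLift.exists_support_eq`).

*The normal form.* Supports and squares determine the closed paths of length two up to units of the
order (`exists_unit_eq_zetaVec`), and the products `β i p * β p l` with distinct indices up to a
scalar. The arrows can be rescaled so that all products become standard (`IsFrame.exists_zeta`,
`IsFrame.exists_rho`). This normal form exists for `C` as well as for `O Ã₄`
(`exists_isNormalForm`), and it determines the algebra (`IsNormalForm.nonempty_algEquiv`).
-/

/-! ### The center of the group algebra as an order in `R ^ 7` -/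

section CenterOrder

variable {R : Type*} [CommRing R]

/-- The vector of values at the seven central characters of a central element of the group algebra
of `Ã₄`, in terms of seven free parameters. Coordinate `0` belongs to the character of degree three,
the coordinates `1`, `2`, `3` to the linear characters, and `4`, `5`, `6` to the characters of
degree two. -/
def centerVec (g : Fin 7 → R) : Fin 7 → R :=
  ![g 0, g 0 + 4 * (g 2 + g 3) + 8 * g 4, g 0 + 4 * (g 1 + g 3) + 8 * g 5,
    g 0 + 4 * (g 1 + g 2) + 8 * g 6, g 0 + 2 * g 1, g 0 + 2 * g 2, g 0 + 2 * g 3]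

theorem eq_centerVec {f g : Fin 7 → R} (h0 : f 0 = g 0)
    (h1 : f 1 = g 0 + 4 * (g 2 + g 3) + 8 * g 4) (h2 : f 2 = g 0 + 4 * (g 1 + g 3) + 8 * g 5)
    (h3 : f 3 = g 0 + 4 * (g 1 + g 2) + 8 * g 6) (h4 : f 4 = g 0 + 2 * g 1)
    (h5 : f 5 = g 0 + 2 * g 2) (h6 : f 6 = g 0 + 2 * g 3) : f = centerVec g := by
  funext t
  fin_cases t <;> assumption

theorem centerVec_mul (g h : Fin 7 → R) : centerVec g * centerVec h =
    centerVec ![g 0 * h 0, g 0 * h 1 + g 1 * h 0 + 2 * g 1 * h 1,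
      g 0 * h 2 + g 2 * h 0 + 2 * g 2 * h 2, g 0 * h 3 + g 3 * h 0 + 2 * g 3 * h 3,
      g 0 * h 4 + g 4 * h 0 + 8 * g 4 * h 4 + 4 * (g 2 + g 3) * h 4 + 4 * g 4 * (h 2 + h 3)
        + 2 * (g 2 + g 3) * (h 2 + h 3) - g 2 * h 2 - g 3 * h 3,
      g 0 * h 5 + g 5 * h 0 + 8 * g 5 * h 5 + 4 * (g 1 + g 3) * h 5 + 4 * g 5 * (h 1 + h 3)
        + 2 * (g 1 + g 3) * (h 1 + h 3) - g 1 * h 1 - g 3 * h 3,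
      g 0 * h 6 + g 6 * h 0 + 8 * g 6 * h 6 + 4 * (g 1 + g 2) * h 6 + 4 * g 6 * (h 1 + h 2)
        + 2 * (g 1 + g 2) * (h 1 + h 2) - g 1 * h 1 - g 2 * h 2] := by
  apply eq_centerVec <;> simp [centerVec] <;> ring

theorem centerVec_add (g h : Fin 7 → R) :
    centerVec g + centerVec h = centerVec (g + h) := by
  apply eq_centerVec <;> simp [centerVec] <;> ring

theorem centerVec_smul (r : R) (g : Fin 7 → R) :
    r • centerVec g = centerVec (r • g) := by
  apply eq_centerVec <;> simp [centerVec] <;> ring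

theorem algebraMap_eq_centerVec (r : R) :
    algebraMap R (Fin 7 → R) r = centerVec ![r, 0, 0, 0, 0, 0, 0] := by
  apply eq_centerVec <;> simp

variable (R) in
/-- The order in `R ^ 7` formed by all vectors `centerVec g`; it is isomorphic to the center of the
group algebra of `Ã₄`, by `exists_center_algEquiv`. -/
def centerOrder : Subalgebra R (Fin 7 → R) where
  carrier := Set.range centerVec
  mul_mem' := by
    rintro _ _ ⟨g, rfl⟩ ⟨h, rfl⟩
    exact ⟨_, (centerVec_mul g h).symm⟩
  add_mem' := by
    rintro _ _ ⟨g, rfl⟩ ⟨h, rfl⟩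
    exact ⟨_, (centerVec_add g h).symm⟩
  algebraMap_mem' r := ⟨_, (algebraMap_eq_centerVec r).symm⟩

theorem centerVec_mem (g : Fin 7 → R) : centerVec g ∈ centerOrder R := ⟨g, rfl⟩

theorem centerVec_injective [IsDomain R] [CharZero R] :
    Function.Injective (centerVec : (Fin 7 → R) → Fin 7 → R) := by
  intro g h e
  have e' : ∀ t, centerVec g t = centerVec h t := fun t => congrFun e t
  have e0 := e' 0
  have e1 := e' 1
  have e2 := e' 2
  have e3 := e' 3
  have e4 := e' 4
  have e5 := e' 5
  have e6 := e' 6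
  simp only [centerVec, Matrix.cons_val] at e0 e1 e2 e3 e4 e5 e6
  have two : (2 : R) ≠ 0 := two_ne_zero
  have eight : (8 : R) ≠ 0 := by norm_num
  have h1 : g 1 = h 1 := mul_left_cancel₀ two (by linear_combination e4 - e0)
  have h2 : g 2 = h 2 := mul_left_cancel₀ two (by linear_combination e5 - e0)
  have h3 : g 3 = h 3 := mul_left_cancel₀ two (by linear_combination e6 - e0)
  have h4 : g 4 = h 4 := mul_left_cancel₀ eight (by linear_combination e1 - e0 - 4 * h2 - 4 * h3)
  have h5 : g 5 = h 5 := mul_left_cancel₀ eight (by linear_combination e2 - e0 - 4 * h1 - 4 * h3)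
  have h6 : g 6 = h 6 := mul_left_cancel₀ eight (by linear_combination e3 - e0 - 4 * h1 - 4 * h2)
  funext t
  fin_cases t <;> assumption

/-! ### Symmetries of the order, and supports -/

/-- The permutation `σ` of the seven coordinates preserves the order. -/
def IsCenterSymmetry (R : Type*) [CommRing R] (σ : Equiv.Perm (Fin 7)) : Prop :=
  ∀ f ∈ centerOrder R, f ∘ σ ∈ centerOrder R

theorem IsCenterSymmetry.mul {σ τ : Equiv.Perm (Fin 7)} (hσ : IsCenterSymmetry R σ)
    (hτ : IsCenterSymmetry R τ) : IsCenterSymmetry R (σ * τ) := fun f hf => hτ _ (hσ f hf)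

/-- Generators of a group of symmetries of the order which is isomorphic to the symmetric group on
the coordinates `0`, `1`, `2`, `3`. The coordinates `4`, `5`, `6` correspond to the three partitions
of `{0, 1, 2, 3}` into pairs, permuted accordingly. -/
def centerSwap : Fin 3 → Equiv.Perm (Fin 7) :=
  ![Equiv.swap 1 2 * Equiv.swap 4 5, Equiv.swap 2 3 * Equiv.swap 5 6,
    Equiv.swap 0 1 * Equiv.swap 5 6]

theorem centerSwap_apply : (centerSwap 0 : Fin 7 → Fin 7) = ![0, 2, 1, 3, 5, 4, 6] ∧
    (centerSwap 1 : Fin 7 → Fin 7) = ![0, 1, 3, 2, 4, 6, 5] ∧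
    (centerSwap 2 : Fin 7 → Fin 7) = ![1, 0, 2, 3, 4, 6, 5] := by decide

theorem isCenterSymmetry_centerSwap (i : Fin 3) : IsCenterSymmetry R (centerSwap i) := by
  rintro _ ⟨g, rfl⟩
  fin_cases i
  · change centerVec g ∘ (centerSwap 0) ∈ _
    rw [centerSwap_apply.1]
    refine ⟨![g 0, g 2, g 1, g 3, g 5, g 4, g 6], (eq_centerVec ?_ ?_ ?_ ?_ ?_ ?_ ?_).symm⟩ <;>
      simp [centerVec] <;> ring
  · change centerVec g ∘ (centerSwap 1) ∈ _
    rw [centerSwap_apply.2.1]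
    refine ⟨![g 0, g 1, g 3, g 2, g 4, g 6, g 5], (eq_centerVec ?_ ?_ ?_ ?_ ?_ ?_ ?_).symm⟩ <;>
      simp [centerVec] <;> ring
  · change centerVec g ∘ (centerSwap 2) ∈ _
    rw [centerSwap_apply.2.2]
    refine ⟨![g 0 + 4 * (g 2 + g 3) + 8 * g 4, g 1 - 2 * (g 2 + g 3) - 4 * g 4,
      g 3 - 2 * (g 2 + g 3) - 4 * g 4, g 2 - 2 * (g 2 + g 3) - 4 * g 4,
      g 2 + g 3 + 3 * g 4, g 2 + 2 * g 3 + 3 * g 4 + g 5, 2 * g 2 + g 3 + 3 * g 4 + g 6],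
      (eq_centerVec ?_ ?_ ?_ ?_ ?_ ?_ ?_).symm⟩ <;>
      simp [centerVec] <;> ring

/-- The coordinates at which the Peirce component `f i * C * f l` is nonzero, for the three
primitive idempotents `f i` of the group algebra of `Ã₄`: the irreducible characters common to the
`i`-th and the `l`-th indecomposable projective module. -/
def stdSupport : Fin 3 → Fin 3 → Finset (Fin 7) :=
  ![![{0, 1, 5, 6}, {0, 6}, {0, 5}], ![{0, 6}, {0, 2, 4, 6}, {0, 4}],
    ![{0, 5}, {0, 4}, {0, 3, 4, 5}]]

/-- The candidates for the support of a primitive idempotent. In the Fano plane with lines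
`{0, 1, 4}`, `{2, 3, 4}`, `{0, 2, 5}`, `{1, 3, 5}`, `{0, 3, 6}`, `{1, 2, 6}`, `{4, 5, 6}` on the
seven coordinates, they are the complements of the lines other than `{4, 5, 6}`. -/
def goodSupports : List (Finset (Fin 7)) :=
  [{0, 1, 5, 6}, {2, 3, 5, 6}, {0, 2, 4, 6}, {1, 3, 4, 6}, {0, 3, 4, 5}, {1, 2, 4, 5}]

/-- One word in the generators `centerSwap` for each of the 24 elements of the group that they
generate. -/
def symmetryWords : List (List (Fin 3)) :=
  (([[], [0], [1], [0, 1], [1, 0], [0, 1, 0]] : List (List (Fin 3))).map fun w =>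
    [w, w ++ [2], w ++ [2, 0], w ++ [2, 0, 1]]).flatten

/-- The symmetry given by a word in the generators. -/
def wordPerm (w : List (Fin 3)) : Equiv.Perm (Fin 7) := (w.map centerSwap).prod

theorem isCenterSymmetry_wordPerm (w : List (Fin 3)) : IsCenterSymmetry R (wordPerm w) := by
  induction w with
  | nil => intro f hf; simpa [wordPerm] using hf
  | cons i w ih => simpa [wordPerm] using (isCenterSymmetry_centerSwap i).mul ih

/-- The set contains one of the coordinates `0`, `1`, `2`, `3` and one of `4`, `5`, `6`. -/
def IsMixed (T : Finset (Fin 7)) : Prop := ∃ s ∈ T, ∃ t ∈ T, s < 4 ∧ 4 ≤ t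

instance : DecidablePred IsMixed := fun T =>
  inferInstanceAs (Decidable (∃ s ∈ T, ∃ t ∈ T, s < 4 ∧ 4 ≤ t))

/-- The symmetry `wordPerm w` maps the standard supports of the three primitive idempotents to `T₀`,
`T₁`, `T₂`. -/
def IsWordImage (T₀ T₁ T₂ : Finset (Fin 7)) (w : List (Fin 3)) : Prop :=
  (stdSupport 0 0).image (wordPerm w) = T₀ ∧ (stdSupport 1 1).image (wordPerm w) = T₁ ∧
    (stdSupport 2 2).image (wordPerm w) = T₂

instance (T₀ T₁ T₂ : Finset (Fin 7)) : DecidablePred (IsWordImage T₀ T₁ T₂) := fun _ =>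
  inferInstanceAs (Decidable (_ ∧ _ ∧ _))

/-- Up to symmetry there is only one configuration of supports. -/
theorem exists_wordPerm_eq : ∀ T₀ ∈ goodSupports, ∀ T₁ ∈ goodSupports, ∀ T₂ ∈ goodSupports,
    IsMixed (T₀ ∩ T₁) → IsMixed (T₀ ∩ T₂) → IsMixed (T₁ ∩ T₂) → T₀ ∪ T₁ ∪ T₂ = Finset.univ →
    ∃ w ∈ symmetryWords, IsWordImage T₀ T₁ T₂ w := by
  decide +kernel

end CenterOrder

/-! ### Squares in the order and the possible supports -/

section Classification

variable {R : Type*} [CommRing R]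

/-- The coefficient of `g m ^ 2` in the square of `centerVec g`, modulo twice the order; the indices
`0`, `1`, `2` stand for the parameters `g 1`, `g 2`, `g 3`. -/
def sqVec (m : Fin 3) : Fin 7 → R :=
  ![![0, 0, 8, 8, 0, 0, 0], ![0, 8, 0, 8, 0, 0, 0], ![0, 8, 8, 0, 0, 0, 0]] m

theorem centerVec_sq (g : Fin 7 → R) : ∃ h : Fin 7 → R, ∀ t, centerVec g t ^ 2 =
    g 0 * (2 * centerVec g t - g 0) + (g 1 ^ 2 * sqVec 0 t + g 2 ^ 2 * sqVec 1 t +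
      g 3 ^ 2 * sqVec 2 t) + 2 * centerVec h t := by
  refine ⟨![0, g 1 ^ 2, g 2 ^ 2, g 3 ^ 2, 2 * g 2 * g 3 + 4 * (g 2 + g 3) * g 4 + 4 * g 4 ^ 2,
    2 * g 1 * g 3 + 4 * (g 1 + g 3) * g 5 + 4 * g 5 ^ 2,
    2 * g 1 * g 2 + 4 * (g 1 + g 2) * g 6 + 4 * g 6 ^ 2], fun t => ?_⟩
  fin_cases t <;> simp [centerVec, sqVec] <;> ring

/-- The square of `z` is divisible by `π` in the projection of the order to the coordinates in `T`.
If `T` is the support of an idempotent `f` and `x = z * f`, then `x ^ 2` vanishes modulo `π`. -/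
def SqDvd (π : R) (T : Finset (Fin 7)) (z : Fin 7 → R) : Prop :=
  ∃ s ∈ centerOrder R, ∀ t ∈ T, z t ^ 2 = π * s t

theorem SqDvd.of_sqVec {π c' d : R} {T : Finset (Fin 7)} {g : Fin 7 → R} (hd : 2 = π * d)
    (hc : g 0 = π * c') (h : ∃ s ∈ centerOrder R, ∀ t ∈ T, g 1 ^ 2 * sqVec 0 t +
      g 2 ^ 2 * sqVec 1 t + g 3 ^ 2 * sqVec 2 t = π * s t) : SqDvd π T (centerVec g) := by
  obtain ⟨s, hs, hst⟩ := h
  obtain ⟨k, hk⟩ := centerVec_sq g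
  refine ⟨c' • ((2 : R) • centerVec g - algebraMap R _ (g 0)) + s + d • centerVec k, ?_, ?_⟩
  · refine add_mem (add_mem ?_ hs) ?_
    · exact Subalgebra.smul_mem _ (sub_mem (Subalgebra.smul_mem _ (centerVec_mem g) _)
        (Subalgebra.algebraMap_mem _ _)) _
    · exact Subalgebra.smul_mem _ (centerVec_mem k) _
  · intro t ht
    rw [hk t, hst t ht]
    simp only [Pi.add_apply, Pi.smul_apply, Pi.sub_apply, smul_eq_mul, Pi.algebraMap_apply,
      Algebra.algebraMap_self, RingHom.id_apply]
    linear_combination (2 * centerVec g t - g 0) * hc + centerVec k t * hd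

theorem sqVec_intCast (m : Fin 3) (t : Fin 7) : ((sqVec m t : ℤ) : R) = sqVec m t := by
  fin_cases m <;> fin_cases t <;> simp [sqVec]

theorem centerVec_intCast (v : Fin 7 → ℤ) (t : Fin 7) :
    ((centerVec v t : ℤ) : R) = centerVec (fun i => (v i : R)) t := by
  fin_cases t <;> simp [centerVec]

/-- Parameters of the elements of the order whose coordinates are `0` or `4` at `0`, `1`, `2`, `3`,
and `0` or `2` at `4`, `5`, `6`. Their supports are the words of the Hamming code of length seven:
the lines of the Fano plane, their complements, the empty set and the whole set. -/
def hammingWords : List (Fin 7 → ℤ) :=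
  [0, ![0, 1, 1, 1, -1, -1, -1], ![0, 0, 1, 1, -1, 0, 0], ![0, 1, 0, 0, 0, 0, 0],
    ![0, 0, 1, 0, 0, 0, 0], ![0, 1, 0, 1, 0, -1, 0], ![0, 0, 0, 1, 0, 0, 0],
    ![0, 1, 1, 0, 0, 0, -1], ![4, -2, -2, -1, 1, 1, 2], ![4, -1, -1, -2, 1, 1, 1],
    ![4, -2, -1, -2, 1, 2, 1], ![4, -1, -2, -1, 1, 1, 1], ![4, -2, -1, -1, 1, 1, 1],
    ![4, -1, -2, -2, 2, 1, 1], ![4, -2, -2, -2, 2, 2, 2], ![4, -1, -1, -1, 1, 1, 1]]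

/-- On a set of four coordinates that is not in `goodSupports`, half of `sqVec m` agrees with a word
of the Hamming code, hence with an element of the order. -/
theorem sqVec_of_notMem_goodSupports : ∀ T ∈ Finset.powersetCard 4 (Finset.univ : Finset (Fin 7)),
    T ∉ goodSupports → ∀ m : Fin 3, ∃ v ∈ hammingWords, ∀ t ∈ T,
      sqVec m t = 2 * (centerVec v t : ℤ) := by
  decide +kernel

/-- Let `T` be a set of four coordinates. The projection of the order to `T` contains a non-unit
whose square is not divisible by `π` only if `T` is the complement of a line of the Fano plane other
than `{4, 5, 6}`. -/
theorem mem_goodSupports {π d : R} (hd : 2 = π * d) {T : Finset (Fin 7)} (hT : T.card = 4)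
    {g : Fin 7 → R} {c' : R} (hc : g 0 = π * c') (hsq : ¬ SqDvd π T (centerVec g)) :
    T ∈ goodSupports := by
  by_contra hgood
  apply hsq
  have key : ∀ m : Fin 3, ∃ v : Fin 7 → R, ∀ t ∈ T, sqVec m t = 2 * centerVec v t := by
    intro m
    obtain ⟨v, -, hv⟩ := sqVec_of_notMem_goodSupports T
      (Finset.mem_powersetCard.mpr ⟨Finset.subset_univ _, hT⟩) hgood m
    refine ⟨fun i => (v i : R), fun t ht => ?_⟩
    rw [← sqVec_intCast, hv t ht, ← centerVec_intCast]
    push_cast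
    ring
  obtain ⟨v0, h0⟩ := key 0
  obtain ⟨v1, h1⟩ := key 1
  obtain ⟨v2, h2⟩ := key 2
  refine SqDvd.of_sqVec hd hc ⟨centerVec (d • (g 1 ^ 2 • v0 + g 2 ^ 2 • v1 + g 3 ^ 2 • v2)),
    centerVec_mem _, fun t ht => ?_⟩
  rw [h0 t ht, h1 t ht, h2 t ht, ← centerVec_smul, ← centerVec_add, ← centerVec_add,
    ← centerVec_smul, ← centerVec_smul, ← centerVec_smul]
  simp only [Pi.smul_apply, Pi.add_apply, smul_eq_mul]
  linear_combination (g 1 ^ 2 * centerVec v0 t + g 2 ^ 2 * centerVec v1 t +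
    g 3 ^ 2 * centerVec v2 t) * hd

/-- The form of the main part of the square on each set in `goodSupports`: if `y` and `z` are
congruent modulo `π`, then the contributions of `y ^ 2` and `z ^ 2`, which need not be divisible by
`π` separately, add up to `2 * y ^ 2 * w` modulo `π`. -/
theorem SqDvd.of_pair {π d c' r x y z: R} (hd : 2 = π * d) {T : Finset (Fin 7)} {g : Fin 7 → R}
    (hc : g 0 = π * c') {v w u : Fin 7 → R} (hyz : z = y + π * r)
    (h : ∀ t ∈ T, g 1 ^ 2 * sqVec 0 t + g 2 ^ 2 * sqVec 1 t + g 3 ^ 2 * sqVec 2 t =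
      x ^ 2 * (2 * centerVec v t) + y ^ 2 * (2 * centerVec w t - centerVec u t) +
        z ^ 2 * centerVec u t) : SqDvd π T (centerVec g) := by
  refine SqDvd.of_sqVec hd hc ⟨centerVec (d • (x ^ 2 • v + y ^ 2 • w) +
    (2 * y * r + π * r ^ 2) • u), centerVec_mem _, fun t ht => ?_⟩
  rw [h t ht, hyz]
  simp only [← centerVec_smul, ← centerVec_add]
  simp only [Pi.smul_apply, Pi.add_apply, smul_eq_mul]
  linear_combination (x ^ 2 * centerVec v t + y ^ 2 * centerVec w t) * hd

/-- If `z` vanishes on `T` outside of two coordinates that are both in `{0, 1, 2, 3}` or both in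
`{4, 5, 6}`, then its square is divisible by `π`. -/
theorem isMixed_of_not_sqDvd [IsDomain R] [CharZero R] {π d : R} (hd : 2 = π * d)
    {T U : Finset (Fin 7)} (hT : T ∈ goodSupports) (hU : U ⊆ T) (hU2 : U.card = 2)
    {g : Fin 7 → R} {c' : R} (hc : g 0 = π * c') (hz : ∀ t ∈ T, t ∉ U → centerVec g t = 0)
    (hsq : ¬ SqDvd π T (centerVec g)) : IsMixed U := by
  by_contra hmix
  apply hsq
  have two : (2 : R) ≠ 0 := two_ne_zero
  have four : (4 : R) ≠ 0 := by norm_num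
  have hcase : ∀ T ∈ goodSupports, ∀ U ∈ Finset.powersetCard 2 T, ¬ IsMixed U →
      (∀ t ∈ T, t < 4 → t ∉ U) ∨ (∀ t ∈ T, 4 ≤ t → t ∉ U) := by decide +kernel
  have hz' : (∀ t ∈ T, t < 4 → centerVec g t = 0) ∨ (∀ t ∈ T, 4 ≤ t → centerVec g t = 0) :=
    (hcase T hT U (Finset.mem_powersetCard.mpr ⟨hU, hU2⟩) hmix).imp
      (fun h t ht h4 => hz t ht (h t ht h4)) (fun h t ht h4 => hz t ht (h t ht h4))
  clear hz hcase hsq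
  simp only [goodSupports, List.mem_cons, List.not_mem_nil, or_false] at hT
  -- on each of the six sets, the vanishing makes two of `g 1`, `g 2`, `g 3` congruent modulo `π`
  rcases hT with rfl | rfl | rfl | rfl | rfl | rfl
  · have hr : ∃ r, g 3 = g 2 + π * r := by
      rcases hz' with h | h
      · have h0 := h 0 (by decide) (by decide)
        have h1 := h 1 (by decide) (by decide)
        simp only [centerVec, Matrix.cons_val] at h0 h1
        refine ⟨d * (-g 2 - g 4), mul_left_cancel₀ four ?_⟩
        linear_combination h1 - h0 + 4 * (-g 2 - g 4) * hd
      · have h0 := h 5 (by decide) (by decide)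
        have h1 := h 6 (by decide) (by decide)
        simp only [centerVec, Matrix.cons_val] at h0 h1
        exact ⟨0, mul_left_cancel₀ two (by linear_combination h1 - h0)⟩
    obtain ⟨r, hr⟩ := hr
    refine SqDvd.of_pair (x := g 1) (v := 0) (w := ![0, 0, 0, 0, 1, 0, 0])
        (u := ![0, 0, 0, 0, 1, 0, 0]) hd hc hr ?_
    simp [centerVec, sqVec]
    ring_nf; simp
  · have hr : ∃ r, g 3 = g 2 + π * r := by
      rcases hz' with h | h
      · have h0 := h 2 (by decide) (by decide)
        have h1 := h 3 (by decide) (by decide)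
        simp only [centerVec, Matrix.cons_val] at h0 h1
        refine ⟨d * (g 6 - g 5), mul_left_cancel₀ four ?_⟩
        linear_combination h0 - h1 + 4 * (g 6 - g 5) * hd
      · have h0 := h 5 (by decide) (by decide)
        have h1 := h 6 (by decide) (by decide)
        simp only [centerVec, Matrix.cons_val] at h0 h1
        exact ⟨0, mul_left_cancel₀ two (by linear_combination h1 - h0)⟩
    obtain ⟨r, hr⟩ := hr
    refine SqDvd.of_pair (x := g 1) (v := ![0, 1, 0, 0, 0, 0, 0]) (w := ![0, 1, 0, 0, 0, 0, 0])
        (u := ![0, 0, 0, 0, 0, 1, 0]) hd hc hr ?_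
    simp [centerVec, sqVec]
    ring_nf; simp
  · have hr : ∃ r, g 3 = g 1 + π * r := by
      rcases hz' with h | h
      · have h0 := h 0 (by decide) (by decide)
        have h1 := h 2 (by decide) (by decide)
        simp only [centerVec, Matrix.cons_val] at h0 h1
        refine ⟨d * (-g 1 - g 5), mul_left_cancel₀ four ?_⟩
        linear_combination h1 - h0 + 4 * (-g 1 - g 5) * hd
      · have h0 := h 4 (by decide) (by decide)
        have h1 := h 6 (by decide) (by decide)
        simp only [centerVec, Matrix.cons_val] at h0 h1
        exact ⟨0, mul_left_cancel₀ two (by linear_combination h1 - h0)⟩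
    obtain ⟨r, hr⟩ := hr
    refine SqDvd.of_pair (x := g 2) (v := 0) (w := ![0, 0, 0, 0, 0, 1, 0])
        (u := ![0, 0, 0, 0, 0, 1, 0]) hd hc hr ?_
    simp [centerVec, sqVec]
    ring_nf; simp
  · have hr : ∃ r, g 3 = g 1 + π * r := by
      rcases hz' with h | h
      · have h0 := h 1 (by decide) (by decide)
        have h1 := h 3 (by decide) (by decide)
        simp only [centerVec, Matrix.cons_val] at h0 h1
        refine ⟨d * (g 6 - g 4), mul_left_cancel₀ four ?_⟩
        linear_combination h0 - h1 + 4 * (g 6 - g 4) * hd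
      · have h0 := h 4 (by decide) (by decide)
        have h1 := h 6 (by decide) (by decide)
        simp only [centerVec, Matrix.cons_val] at h0 h1
        exact ⟨0, mul_left_cancel₀ two (by linear_combination h1 - h0)⟩
    obtain ⟨r, hr⟩ := hr
    refine SqDvd.of_pair (x := g 2) (v := ![0, 0, 1, 0, 0, 0, 0]) (w := ![0, 0, 1, 0, 0, 0, 0])
        (u := ![0, 0, 0, 0, 1, 0, 0]) hd hc hr ?_
    simp [centerVec, sqVec]
    ring_nf; simp
  · have hr : ∃ r, g 2 = g 1 + π * r := by
      rcases hz' with h | h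
      · have h0 := h 0 (by decide) (by decide)
        have h1 := h 3 (by decide) (by decide)
        simp only [centerVec, Matrix.cons_val] at h0 h1
        refine ⟨d * (-g 1 - g 6), mul_left_cancel₀ four ?_⟩
        linear_combination h1 - h0 + 4 * (-g 1 - g 6) * hd
      · have h0 := h 4 (by decide) (by decide)
        have h1 := h 5 (by decide) (by decide)
        simp only [centerVec, Matrix.cons_val] at h0 h1
        exact ⟨0, mul_left_cancel₀ two (by linear_combination h1 - h0)⟩
    obtain ⟨r, hr⟩ := hr
    refine SqDvd.of_pair (x := g 3) (v := 0) (w := ![0, 0, 0, 0, 0, 0, 1])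
        (u := ![0, 0, 0, 0, 0, 0, 1]) hd hc hr ?_
    simp [centerVec, sqVec]
    ring_nf; simp
  · have hr : ∃ r, g 2 = g 1 + π * r := by
      rcases hz' with h | h
      · have h0 := h 1 (by decide) (by decide)
        have h1 := h 2 (by decide) (by decide)
        simp only [centerVec, Matrix.cons_val] at h0 h1
        refine ⟨d * (g 5 - g 4), mul_left_cancel₀ four ?_⟩
        linear_combination h0 - h1 + 4 * (g 5 - g 4) * hd
      · have h0 := h 4 (by decide) (by decide)
        have h1 := h 5 (by decide) (by decide)
        simp only [centerVec, Matrix.cons_val] at h0 h1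
        exact ⟨0, mul_left_cancel₀ two (by linear_combination h1 - h0)⟩
    obtain ⟨r, hr⟩ := hr
    refine SqDvd.of_pair (x := g 3) (v := ![0, 0, 0, 1, 0, 0, 0]) (w := ![0, 0, 0, 1, 0, 0, 0])
        (u := ![0, 0, 0, 0, 1, 0, 0]) hd hc hr ?_
    simp [centerVec, sqVec]
    ring_nf; simp

end Classification

/-! ### The structure constants of the order -/

section StructureConstants

variable {R : Type*} [CommRing R]

/-- The vector giving the closed paths of length two: in the normal form, the product of the arrow
from `i` to `l` and the one back is `zetaVec (-(i + l))`, restricted to the support of the `i`-th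
idempotent. For `i ≠ l` in `Fin 3`, the index `-(i + l)` is the third one. -/
def zetaVec (l : Fin 3) : Fin 7 → R :=
  ![![4, 4, 0, 0, 2, 0, 0], ![4, 0, 4, 0, 0, 2, 0], ![4, 0, 0, 4, 0, 0, 2]] l

theorem zetaVec_mem (l : Fin 3) : zetaVec l ∈ centerOrder R := by
  refine ⟨![![4, -1, -2, -2, 2, 1, 1], ![4, -2, -1, -2, 1, 2, 1], ![4, -2, -2, -1, 1, 1, 2]] l, ?_⟩
  symm
  fin_cases l <;> apply eq_centerVec <;> simp [zetaVec] <;> ring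

/-- The vector giving the product of the arrow from `i` to `p` and the one from `p` to `l` for
distinct `i`, `p`, `l`, as a multiple of the arrow from `i` to `l`. -/
def rhoVec : Fin 7 → R := ![2, 2, 2, 2, 0, 0, 0]

theorem rhoVec_mem : rhoVec ∈ centerOrder R := by
  refine ⟨![2, -1, -1, -1, 1, 1, 1], ?_⟩
  symm
  apply eq_centerVec <;> simp [rhoVec] <;> ring

/-- The vector with `p` in the first four and `p + 2 * w` in the last three coordinates. -/
def twoVec (p w : R) : Fin 7 → R := centerVec ![p, w, w, w, -w, -w, -w]

theorem twoVec_eq (p w : R) :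
    twoVec p w = ![p, p, p, p, p + 2 * w, p + 2 * w, p + 2 * w] := by
  symm
  apply eq_centerVec <;> simp <;> ring

theorem twoVec_mul {p w p' q' : R} (hp : p * p' = 1) (hq : (p + 2 * w) * q' = 1) :
    twoVec p w * twoVec p' (-(w * p' * q')) = 1 := by
  have h : p' + 2 * -(w * p' * q') = q' := by
    linear_combination q' * hp - p' * hq
  rw [twoVec_eq, twoVec_eq, h]
  funext t
  fin_cases t <;> simp [hp, hq]

/-- A closed path of length two whose square does not vanish modulo `π` is, up to a unit of the
order, the standard one. On the support of the `i`-th idempotent, the vanishing of `z` at two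
coordinates leaves two parameters `y` and `δ`. If `y` were not a unit, the square would be divisible
by `π`. -/
theorem exists_unit_eq_zetaVec [IsDomain R] [CharZero R] [IsLocalRing R] {π d : R}
    (hd : 2 = π * d) (hπ : IsLocalRing.maximalIdeal R = Ideal.span {π}) {i j : Fin 3} (hij : i ≠ j)
    {z : Fin 7 → R} (hz : z ∈ centerOrder R)
    (h0 : ∀ t ∈ stdSupport i i, t ∉ stdSupport i j → z t = 0)
    (hsq : ¬ SqDvd π (stdSupport i i) z) :
    ∃ u v : centerOrder R, u * v = 1 ∧
      ∀ t ∈ stdSupport i i, z t = u.1 t * zetaVec (-(i + j)) t := by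
  obtain ⟨g, rfl⟩ := hz
  have two : (2 : R) ≠ 0 := two_ne_zero
  -- the other parameters have no influence on the four coordinates of `stdSupport i i`
  obtain ⟨x, y, δ, hA, hB, hsq', hconc⟩ : ∃ x y δ : R, g 0 + 4 * (x + y) + 8 * δ = 0 ∧
      g 0 + 2 * x = 0 ∧ (∀ c' x' y', g 0 = π * c' → x = π * x' → y = π * y' →
        SqDvd π (stdSupport i i) (centerVec g)) ∧
      ∀ p w : R, g 0 = 4 * p → g 0 + 2 * y = 2 * (p + 2 * w) →
        ∀ t ∈ stdSupport i i, centerVec g t = twoVec p w t * zetaVec (-(i + j)) t := by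
    refine ⟨![g 1, g 2, g 3] j, ![g 1, g 2, g 3] (-(i + j)), ![g 4, g 5, g 6] i, ?_, ?_, ?_, ?_⟩
    · have h := h0 (i.castSucc.castAdd 3 + 1)
      clear h0 hsq
      fin_cases i <;> fin_cases j <;> first | exact absurd rfl hij | skip
      all_goals simpa [centerVec, stdSupport, add_comm] using h
    · have h := h0 (j.natAdd 4)
      clear h0 hsq
      fin_cases i <;> fin_cases j <;> first | exact absurd rfl hij | skip
      all_goals simpa [centerVec, stdSupport, add_comm] using h
    · intro c' x' y' hc hx hy
      refine SqDvd.of_sqVec hd hc ⟨centerVec (Pi.single (i.natAdd 4) (π * (x' ^ 2 + y' ^ 2))),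
        centerVec_mem _, ?_⟩
      clear h0 hsq
      fin_cases i <;> fin_cases j <;> first | exact absurd rfl hij | skip
      all_goals
        simp at hx hy
        simp [stdSupport, sqVec, centerVec, hx, hy]
        try ring
    · intro p w hp hw
      rw [twoVec_eq]
      have h1 := h0 (i.castSucc.castAdd 3 + 1)
      have h2 := h0 (j.natAdd 4)
      clear h0 hsq
      fin_cases i <;> fin_cases j <;> first | exact absurd rfl hij | skip
      all_goals
        simp [centerVec, stdSupport] at hw h1 h2
        simp [stdSupport, zetaVec, centerVec]
        refine ⟨?_, ?_, ?_, ?_⟩ <;> first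
          | linear_combination hp
          | linear_combination h1
          | linear_combination h2
          | linear_combination hw
  obtain rfl : x = -2 * y - 4 * δ := mul_left_cancel₀ two (by linear_combination hA - hB)
  have hp : g 0 = 4 * (y + 2 * δ) := by linear_combination hB
  have hdvd : ∀ r : R, ¬ IsUnit r → π ∣ r := fun r hr => by
    rwa [← Ideal.mem_span_singleton, ← hπ, IsLocalRing.mem_maximalIdeal]
  have hπu : ¬ IsUnit π := by
    rw [← mem_nonunits_iff, ← IsLocalRing.mem_maximalIdeal, hπ]
    exact Ideal.mem_span_singleton_self π
  have hunit : ∀ r s : R, IsUnit r → IsUnit (r + 2 * s) := by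
    intro r s hr
    by_contra hn
    refine hπu (isUnit_of_dvd_unit ?_ hr)
    have h1 := hdvd _ hn
    rw [hd, mul_assoc] at h1
    exact (dvd_add_left (dvd_mul_right π _)).mp h1
  have hy : IsUnit y := by
    by_contra hy
    obtain ⟨y', rfl⟩ := hdvd _ hy
    refine hsq (hsq' (4 * (y' + d * δ)) (-2 * y' - 2 * d * δ) y' ?_ ?_ rfl)
    · rw [hp]; linear_combination 4 * δ * hd
    · linear_combination -2 * δ * hd
  obtain ⟨p', hp'⟩ := (hunit y δ hy).exists_right_inv
  obtain ⟨q', hq'⟩ := (hunit _ (y + δ) (hunit y δ hy)).exists_right_inv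
  refine ⟨⟨twoVec (y + 2 * δ) (y + δ), centerVec_mem _⟩, ⟨twoVec p' _, centerVec_mem _⟩,
    Subtype.ext (twoVec_mul hp' hq'), hconc _ _ hp ?_⟩
  rw [hp]; ring

/-- The projection of the order to `stdSupport i l`, restricted to the elements that vanish at the
coordinate outside of `stdSupport i j`, is spanned by `rhoVec`. -/
theorem eq_smul_rhoVec [IsDomain R] {i j l : Fin 3} (hij : i ≠ j) (hjl : j ≠ l)
    (hil : i ≠ l) {w : Fin 7 → R} (hw : w ∈ centerOrder R)
    (h0 : ∀ t ∈ stdSupport i l, t ∉ stdSupport i j → w t = 0) :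
    ∃ r : R, ∀ t ∈ stdSupport i l, w t = r * rhoVec t := by
  obtain ⟨g, rfl⟩ := hw
  have key : ∀ i j l : Fin 3, i ≠ j → j ≠ l → i ≠ l →
    stdSupport i l = {0, (j.natAdd 4)} ∧ j.natAdd 4 ∉ stdSupport i j := by decide
  obtain ⟨h1, h2⟩ := key i j l hij hjl hil
  rw [h1] at h0 ⊢
  have h3 := h0 (j.natAdd 4) (by simp) h2
  refine ⟨-(![g 1, g 2, g 3] j), ?_⟩
  intro t ht
  simp only [Finset.mem_insert, Finset.mem_singleton] at ht
  rcases ht with rfl | rfl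
  · fin_cases j <;> simp [centerVec, rhoVec] at h3 ⊢ <;> linear_combination h3
  · rw [h3]
    fin_cases j <;> simp [rhoVec]

end StructureConstants

/-! ### The normal form of an algebra, and its uniqueness -/

section NormalForm

variable {R : Type*} [CommRing R]

variable (R) in
/-- The vector `zetaVec l` as an element of the order. -/
def zeta (l : Fin 3) : centerOrder R := ⟨zetaVec l, zetaVec_mem l⟩

variable (R) in
/-- The vector `rhoVec` as an element of the order. -/
def rho : centerOrder R := ⟨rhoVec, rhoVec_mem⟩

/-- The coefficient of `b i l` in the product `b i j * b j l` of two elements of the normal form. -/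
def structureConstant (i j l : Fin 3) : centerOrder R :=
  if i = j ∨ j = l then 1 else
    if i = l then zeta R (-(i + j)) else rho R

/-- The algebra `C` is spanned over the central order, through `j`, by the elements `b i l`, where
the relations are that `b i l` is supported on `stdSupport i l`, and the multiplication is given by
`structureConstant`. -/
structure IsNormalForm {C : Type*} [Ring C] [Algebra R C] (j : centerOrder R →ₐ[R] C)
    (b : Fin 3 → Fin 3 → C) : Prop where
  commute : ∀ s x, j s * x = x * j s
  exists_eq_sum : ∀ x, ∃ s : Fin 3 → Fin 3 → centerOrder R, x = ∑ i, ∑ l, j (s i l) * b i l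
  sum_eq_zero_iff : ∀ s : Fin 3 → Fin 3 → centerOrder R, ∑ i, ∑ l, j (s i l) * b i l = 0 ↔
    ∀ i l, ∀ t ∈ stdSupport i l, (s i l).1 t = 0
  mul_of_ne : ∀ i p q l, p ≠ q → b i p * b q l = 0
  mul : ∀ i p l, b i p * b p l = j (structureConstant i p l) * b i l

variable {C C' : Type*} [Ring C] [Algebra R C] [Ring C'] [Algebra R C']

/-- The linear combinations of the `b i l` with coefficients in the order. -/
def combination (j : centerOrder R →ₐ[R] C) (b : Fin 3 → Fin 3 → C) :
    (Fin 3 → Fin 3 → centerOrder R) →ₗ[R] C where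
  toFun s := ∑ i, ∑ l, j (s i l) * b i l
  map_add' s s' := by simp [add_mul, Finset.sum_add_distrib]
  map_smul' a s := by simp [Finset.smul_sum]

theorem IsNormalForm.combination_mul {j : centerOrder R →ₐ[R] C} {b : Fin 3 → Fin 3 → C}
    (h : IsNormalForm j b) (s s' : Fin 3 → Fin 3 → centerOrder R) :
    combination j b s * combination j b s' =
      combination j b fun i l => ∑ p, s i p * s' p l * structureConstant i p l := by
  have key : ∀ i p q l, (j (s i p) * b i p) * (j (s' q l) * b q l) =
      if p = q then j (s i p * s' p l * structureConstant i p l) * b i l else 0 := by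
    intro i p q l
    have e : (j (s i p) * b i p) * (j (s' q l) * b q l) =
        j (s i p) * j (s' q l) * (b i p * b q l) := by
      rw [mul_assoc, ← mul_assoc (b i p), ← h.commute, mul_assoc, mul_assoc]
    rw [e]
    split_ifs with hpq
    · subst hpq
      rw [h.mul, map_mul, map_mul, mul_assoc, mul_assoc, mul_assoc]
    · rw [h.mul_of_ne _ _ _ _ hpq, mul_zero]
  change (∑ i, ∑ p, j (s i p) * b i p) * (∑ q, ∑ l, j (s' q l) * b q l) =
    ∑ i, ∑ l, j (∑ p, s i p * s' p l * structureConstant i p l) * b i l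
  rw [Finset.sum_mul]
  refine Finset.sum_congr rfl fun i _ => ?_
  simp only [Finset.sum_mul, map_sum]
  rw [Finset.sum_comm (s := Finset.univ) (t := Finset.univ) (f := fun l p => _ * b i l)]
  refine Finset.sum_congr rfl fun p _ => ?_
  rw [Finset.mul_sum, Finset.sum_eq_single p]
  · rw [Finset.mul_sum]
    exact Finset.sum_congr rfl fun l _ => by rw [key, if_pos rfl]
  · intro q _ hq
    rw [Finset.mul_sum]
    exact Finset.sum_eq_zero fun l _ => by rw [key, if_neg hq.symm]
  · simp

/-- The normal form determines the algebra: kernel and multiplication of `combination j b` do not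
depend on `C`. -/
theorem IsNormalForm.nonempty_algEquiv {j : centerOrder R →ₐ[R] C} {b : Fin 3 → Fin 3 → C}
    (h : IsNormalForm j b) {j' : centerOrder R →ₐ[R] C'} {b' : Fin 3 → Fin 3 → C'}
    (h' : IsNormalForm j' b') : Nonempty (C ≃ₐ[R] C') := by
  have hs : Function.Surjective (combination j b) := fun x => by
    obtain ⟨s, hs⟩ := h.exists_eq_sum x
    exact ⟨s, hs.symm⟩
  have hs' : Function.Surjective (combination j' b') := fun x => by
    obtain ⟨s, hs⟩ := h'.exists_eq_sum x
    exact ⟨s, hs.symm⟩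
  have hker : LinearMap.ker (combination j b) = LinearMap.ker (combination j' b') := by
    ext s
    exact (h.sum_eq_zero_iff s).trans (h'.sum_eq_zero_iff s).symm
  let E : C ≃ₗ[R] C' := ((combination j b).quotKerEquivOfSurjective hs).symm.trans
    ((Submodule.quotEquivOfEq _ _ hker).trans ((combination j' b').quotKerEquivOfSurjective hs'))
  have hE : ∀ s, E (combination j b s) = combination j' b' s := by
    intro s
    have : ((combination j b).quotKerEquivOfSurjective hs).symm (combination j b s) =
        Submodule.Quotient.mk s := by
      rw [LinearEquiv.symm_apply_eq]
      rfl
    simp only [E, LinearEquiv.trans_apply, this]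
    rfl
  have hmul : ∀ x y, E (x * y) = E x * E y := by
    intro x y
    obtain ⟨s, rfl⟩ := hs x
    obtain ⟨s', rfl⟩ := hs y
    rw [h.combination_mul, hE, hE, hE, h'.combination_mul]
  refine ⟨AlgEquiv.ofLinearEquiv E ?_ hmul⟩
  have h1 := hmul (E.symm 1) 1
  simpa using h1.symm

end NormalForm

/-! ### Supports -/

section Support

variable {R : Type*} [CommRing R]

/-- The vector with `8` at `t` and zero elsewhere; it is in the order, while the idempotent itself
is not. -/
def epsVec (t : Fin 7) : centerOrder R :=
  ⟨Pi.single t 8, (![![8, -4, -4, -4, 3, 3, 3], ![0, 0, 0, 0, 1, 0, 0], ![0, 0, 0, 0, 0, 1, 0],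
    ![0, 0, 0, 0, 0, 0, 1], ![0, 4, 0, 0, 0, -2, -2], ![0, 0, 4, 0, -2, 0, -2],
    ![0, 0, 0, 4, -2, -2, 0]] t : Fin 7 → R), by
      symm
      fin_cases t <;> apply eq_centerVec <;> simp <;> ring⟩

theorem mul_epsVec (s : centerOrder R) (t : Fin 7) : s * epsVec t = s.1 t • epsVec t := by
  apply Subtype.ext
  funext u
  by_cases h : u = t
  · subst h; simp [epsVec]
  · simp [epsVec, h]

theorem sum_smul_epsVec (s : centerOrder R) : ∑ t, s.1 t • epsVec t = (8 : R) • s := by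
  apply Subtype.ext
  funext u
  simp [epsVec, Finset.sum_apply, Pi.single_apply, mul_comm]

variable {C : Type*} [Ring C] [Algebra R C] (j : centerOrder R →ₐ[R] C)

open scoped Classical in
/-- The coordinates `t` at which `x` is nonzero: the component of `x` at the `t`-th irreducible
character is, up to the factor `8`, the element `j (epsVec t) * x`. -/
noncomputable def support (x : C) : Finset (Fin 7) := {t | j (epsVec t) * x ≠ 0}

variable {j}

theorem mem_support {x : C} {t : Fin 7} : t ∈ support j x ↔ j (epsVec t) * x ≠ 0 := by
  simp [support]

/-- If `C` is torsion-free, then the order acts on `x` through the coordinates in its support. -/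
theorem map_mul_eq_zero_iff [IsDomain R] [CharZero R] [Module.IsTorsionFree R C] {x : C}
    {s : centerOrder R} : j s * x = 0 ↔ ∀ t ∈ support j x, s.1 t = 0 := by
  have eight : (8 : R) ≠ 0 := by norm_num
  constructor
  · intro h t ht
    have h1 : s.1 t • (j (epsVec t) * x) = 0 := by
      rw [← smul_mul_assoc, ← map_smul, ← mul_epsVec, mul_comm, map_mul, mul_assoc, h, mul_zero]
    exact (smul_eq_zero.mp h1).resolve_right (mem_support.mp ht)
  · intro h
    have h1 : (8 : R) • (j s * x) = 0 := by
      rw [← smul_mul_assoc, ← map_smul, ← sum_smul_epsVec, map_sum, Finset.sum_mul]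
      refine Finset.sum_eq_zero fun t _ => ?_
      rw [map_smul, smul_mul_assoc]
      by_cases ht : t ∈ support j x
      · rw [h t ht, zero_smul]
      · rw [not_not.mp (mt mem_support.mpr ht), smul_zero]
    exact (smul_eq_zero.mp h1).resolve_left eight

theorem map_mul_eq_iff [IsDomain R] [CharZero R] [Module.IsTorsionFree R C] {x : C}
    {s s' : centerOrder R} : j s * x = j s' * x ↔ ∀ t ∈ support j x, s.1 t = s'.1 t := by
  rw [← sub_eq_zero, ← sub_mul, ← map_sub, map_mul_eq_zero_iff]
  simp [sub_eq_zero]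

theorem support_mul_subset_left (x y : C) : support j (x * y) ⊆ support j x := by
  intro t ht
  rw [mem_support] at ht ⊢
  intro h
  exact ht (by rw [← mul_assoc, h, zero_mul])

theorem support_mul_subset_right (hj : ∀ s x, j s * x = x * j s) (x y : C) :
    support j (x * y) ⊆ support j y := by
  intro t ht
  rw [mem_support] at ht ⊢
  intro h
  exact ht (by rw [← mul_assoc, hj, mul_assoc, h, mul_zero])

/-- The module generated by `x` over the order has the rank of the projection of the order to the
support of `x`. -/
theorem finrank_eq_card_support [IsDomain R] [CharZero R] [Module.IsTorsionFree R C] {x : C}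
    {M : Submodule R C} [Module.Finite R M] (hM : ∀ y, y ∈ M ↔ ∃ s, y = j s * x) :
    Module.finrank R M = (support j x).card := by
  have eight : (8 : R) ≠ 0 := by norm_num
  let v : support j x → M := fun t => ⟨j (epsVec t.1) * x, (hM _).mpr ⟨_, rfl⟩⟩
  have hv : LinearIndependent R v := by
    rw [Fintype.linearIndependent_iff]
    intro g hg t
    have h1 : ∑ u : support j x, g u • (j (epsVec u.1) * x) = 0 := by
      have := congrArg (Submodule.subtype M) hg
      simpa [v] using this
    have h2 : j (∑ u : support j x, g u • epsVec u.1) * x = 0 := by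
      rw [← h1]
      simp [Finset.sum_mul]
    have h3 := map_mul_eq_zero_iff.mp h2 t.1 t.2
    have h4 : (∑ u : support j x, g u • epsVec u.1 : centerOrder R).1 t.1 = g t * 8 := by
      simp only [AddSubmonoidClass.coe_finsetSum, Finset.sum_apply, SetLike.val_smul,
        Pi.smul_apply, smul_eq_mul]
      rw [Finset.sum_eq_single t]
      · simp [epsVec]
      · intro u _ hu
        have : t.1 ≠ u.1 := fun h => hu (Subtype.ext h.symm)
        simp [epsVec, this]
      · simp
    rw [h4] at h3
    exact (mul_eq_zero.mp h3).resolve_right eight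
  apply le_antisymm
  · have hspan : Module.finrank R (Submodule.span R (Set.range v)) = (support j x).card := by
      rw [finrank_span_eq_card hv]
      simp
    rw [← hspan]
    have hmem : ∀ y : M, (8 : R) • y ∈ Submodule.span R (Set.range v) := by
      intro y
      obtain ⟨s, hs⟩ := (hM _).mp y.2
      have : (8 : R) • y = ∑ t : support j x, s.1 t.1 • v t := by
        apply Subtype.ext
        have h1 : (8 : R) • (y : C) = ∑ t, s.1 t • (j (epsVec t) * x) := by
          rw [hs, ← smul_mul_assoc, ← map_smul, ← sum_smul_epsVec, map_sum, Finset.sum_mul]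
          simp
        rw [Submodule.coe_smul, h1, ← Finset.sum_subset (Finset.subset_univ (support j x)),
          ← Finset.sum_coe_sort]
        · simp [v]
        · intro t _ ht
          rw [not_not.mp (mt mem_support.mpr ht), smul_zero]
      rw [this]
      exact Submodule.sum_mem _ fun t _ => Submodule.smul_mem _ _ (Submodule.subset_span ⟨t, rfl⟩)
    have := Module.Finite.span_of_finite R (Set.finite_range v)
    refine LinearMap.finrank_le_finrank_of_injective
      (f := LinearMap.codRestrict _ (LinearMap.lsmul R M (8 : R)) hmem) ?_
    intro y y' h
    have := congrArg Subtype.val h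
    exact smul_right_injective _ eight this
  · simpa using hv.fintype_card_le_finrank

end Support

/-! ### Peirce components modulo `π` -/

section Reduction

/-- The Peirce component `e C f` of an algebra `C`. -/
def peirceComponent (R : Type*) {C : Type*} [CommRing R] [Ring C] [Algebra R C] (e f : C) :
    Submodule R C where
  carrier := {y | e * y * f = y}
  zero_mem' := by simp
  add_mem' {x y} hx hy := by
    simp only [Set.mem_ofPred_eq] at hx hy ⊢
    rw [mul_add, add_mul, hx, hy]
  smul_mem' a x hx := by
    simp only [Set.mem_ofPred_eq] at hx ⊢
    rw [mul_smul_comm, smul_mul_assoc, hx]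

theorem mem_peirceComponent {R C : Type*} [CommRing R] [Ring C] [Algebra R C] {e f y : C} :
    y ∈ peirceComponent R e f ↔ e * y * f = y := Iff.rfl

theorem mul_mul_mem_peirceComponent {R C : Type*} [CommRing R] [Ring C] [Algebra R C] {e f : C}
    (he : IsIdempotentElem e) (hf : IsIdempotentElem f) (y : C) : e * y *
        f ∈ peirceComponent R e f := by
  rw [mem_peirceComponent, ← mul_assoc, ← mul_assoc, he.eq, mul_assoc _ f, hf.eq]

/-- The properties of the group algebra of `Ã₄` over `k` on which the argument depends. The `e i`
are a complete system of orthogonal idempotents, the Peirce component of `e i` and `e l` is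
generated by `b i l` over the center, its dimension is `4` or `2`, the closed path through `i` and
`l` has nonzero square, and the dimension of the center is at most seven. -/
structure IsQuiverModel (k : Type*) {B : Type*} [Field k] [Ring B] [Algebra k B]
    (e : Fin 3 → B) (b : Fin 3 → Fin 3 → B) : Prop where
  idem : CompleteOrthogonalIdempotents e
  diag : ∀ i, b i i = e i
  mem : ∀ i l, b i l ∈ peirceComponent k (e i) (e l)
  gen : ∀ i l, ∀ y ∈ peirceComponent k (e i) (e l), ∃ w ∈ Subalgebra.center k B, y = w * b i l
  sq_ne : ∀ i l, i ≠ l → (b i l * b l i) ^ 2 ≠ 0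
  finrank : ∀ i l, Module.finrank k (peirceComponent k (e i) (e l)) = (stdSupport i l).card
  center_finite : Module.Finite k (Subalgebra.center k B)
  center_finrank : Module.finrank k (Subalgebra.center k B) ≤ 7

/-- The homomorphism `r` identifies `B` with `C / π C`. The inclusion `π C ⊆ ker r` is not a field,
because it holds whenever `π` acts as zero on `B`. -/
structure IsReduction {R C B : Type*} [CommRing R] [Ring C] [Ring B] [Algebra R C] [Algebra R B]
    (π : R) (r : C →ₐ[R] B) : Prop where
  surjective : Function.Surjective r
  ker : ∀ x, r x = 0 → ∃ y, x = π • y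

/-- The homomorphism `j` embeds the order into the center of `C`, and its image is pure: if `j s` is
divisible by `π` in `C`, then `s` is divisible by `π`. -/
structure IsCentralOrder {R C B : Type*} [CommRing R] [Ring C] [Ring B] [Algebra R C] [Algebra R B]
    (π : R) (r : C →ₐ[R] B) (j : centerOrder R →ₐ[R] C) : Prop where
  commute : ∀ s x, j s * x = x * j s
  injective : Function.Injective j
  pure : ∀ s, r (j s) = 0 → ∃ s', s = π • s'

/-- The rank of a free module is the dimension of its reduction modulo `π`. -/
theorem finrank_eq_of_reduction {R k M V : Type*} [CommRing R] [IsDomain R]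
    [Field k] [Algebra R k] {π : R} (hk : Function.Surjective (algebraMap R k))
    (hπ : ∀ a, algebraMap R k a = 0 ↔ π ∣ a) [AddCommGroup M] [Module R M] [Module.Free R M]
    [Module.Finite R M] [AddCommGroup V] [Module R V] [Module k V] [IsScalarTower R k V]
    (f : M →ₗ[R] V) (hf : Function.Surjective f) (hker : ∀ x, f x = 0 → ∃ y, x = π • y) :
    Module.finrank R M = Module.finrank k V := by
  let b := Module.finBasis R M
  have hli : LinearIndependent k (fun i => f (b i)) := by
    rw [Fintype.linearIndependent_iff]
    intro g hg i
    choose g' hg' using fun i => hk (g i)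
    have h1 : f (∑ i, g' i • b i) = 0 := by
      rw [map_sum, ← hg]
      refine Finset.sum_congr rfl fun i _ => ?_
      rw [map_smul, ← hg', algebraMap_smul]
    obtain ⟨y, hy⟩ := hker _ h1
    have h2 := congrArg (fun z => b.repr z i) hy
    simp only [map_smul, Finsupp.smul_apply, smul_eq_mul, map_sum, Module.Basis.repr_self,
      Finsupp.coe_finsetSum, Finset.sum_apply, Finsupp.single_apply, mul_ite, mul_one, mul_zero,
      Finset.sum_ite_eq', Finset.mem_univ, if_true] at h2
    rw [← hg', hπ, h2]
    exact dvd_mul_right _ _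
  have hspan : ⊤ ≤ Submodule.span k (Set.range fun i => f (b i)) := by
    intro v _
    obtain ⟨x, rfl⟩ := hf v
    rw [← b.sum_repr x, map_sum]
    refine Submodule.sum_mem _ fun i _ => ?_
    rw [map_smul, ← algebraMap_smul k]
    exact Submodule.smul_mem _ _ (Submodule.subset_span ⟨i, rfl⟩)
  rw [Module.finrank_eq_card_basis (Module.Basis.mk hli hspan), Fintype.card_fin]

variable {R k C B : Type*} [CommRing R] [IsDomain R] [CharZero R]
  [Field k] [Algebra R k] [Ring C] [Algebra R C]
  [Ring B] [Algebra k B] [Algebra R B] [IsScalarTower R k B]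
  {π : R} {e : Fin 3 → B} {b : Fin 3 → Fin 3 → B} {r : C →ₐ[R] B} {j : centerOrder R →ₐ[R] C}

/-- The order maps onto the center of `B`: by purity, the image of the order has dimension seven,
and the center of `B` is not larger. -/
theorem IsCentralOrder.exists_map_eq (hk : Function.Surjective (algebraMap R k))
    (hπ : ∀ a, algebraMap R k a = 0 ↔ π ∣ a) (hB : IsQuiverModel k e b) (hr : IsReduction π r)
    (hj : IsCentralOrder π r j) {w : B} (hw : w ∈ Subalgebra.center k B) :
    ∃ s, r (j s) = w := by
  have := hB.center_finite
  have hcen : ∀ s, r (j s) ∈ Subalgebra.center k B := by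
    intro s
    rw [Subalgebra.mem_center_iff]
    intro y
    obtain ⟨x, rfl⟩ := hr.surjective y
    rw [← map_mul, ← map_mul, hj.commute]
  let s₀ : (Fin 7 → R) → centerOrder R := fun g => ⟨centerVec g, centerVec_mem g⟩
  have hs₀add : ∀ g h, s₀ (g + h) = s₀ g + s₀ h := fun g h =>
    Subtype.ext (centerVec_add g h).symm
  have hs₀smul : ∀ (a : R) g, s₀ (a • g) = a • s₀ g := fun a g =>
    Subtype.ext (centerVec_smul a g).symm
  let φ : (Fin 7 → k) →ₗ[k] Subalgebra.center k B :=
    Fintype.linearCombination k fun t => ⟨r (j (s₀ (Pi.single t 1))), hcen _⟩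
  have hφ : ∀ g : Fin 7 → R, (φ fun t => algebraMap R k (g t) : B) = r (j (s₀ g)) := by
    intro g
    have h1 : s₀ g = ∑ t, g t • s₀ (Pi.single t 1) := by
      apply Subtype.ext
      simp only [AddSubmonoidClass.coe_finsetSum, SetLike.val_smul, s₀, centerVec_smul]
      have h2 : ∀ (u : Finset (Fin 7)) (f : Fin 7 → Fin 7 → R),
          ∑ t ∈ u, centerVec (f t) = centerVec (∑ t ∈ u, f t) := by
        intro u f
        induction u using Finset.induction_on with
        | empty =>
          simp only [Finset.sum_empty]
          apply eq_centerVec <;> simp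
        | insert a u ha ih => rw [Finset.sum_insert ha, Finset.sum_insert ha, ih, centerVec_add]
      rw [h2]
      congr 1
      funext t
      simp [Finset.sum_apply, Pi.single_apply]
    rw [h1, map_sum, map_sum, Fintype.linearCombination_apply, AddSubmonoidClass.coe_finsetSum]
    refine Finset.sum_congr rfl fun t _ => ?_
    rw [map_smul, map_smul, SetLike.val_smul, algebraMap_smul]
  have hinj : Function.Injective φ := by
    rw [injective_iff_map_eq_zero]
    intro v hv
    choose g hg using fun t => hk (v t)
    obtain rfl : (fun t => algebraMap R k (g t)) = v := funext hg
    have h1 : r (j (s₀ g)) = 0 := by rw [← hφ, hv]; rfl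
    obtain ⟨⟨_, h, rfl⟩, hs⟩ := hj.pure _ h1
    have h2 : g = π • h := by
      apply centerVec_injective
      rw [← centerVec_smul]
      exact congrArg Subtype.val hs
    funext t
    rw [Pi.zero_apply, hπ, h2]
    exact dvd_mul_right _ _
  have hfin : Module.finrank k (Fin 7 → k) = Module.finrank k (Subalgebra.center k B) := by
    apply le_antisymm
    · exact LinearMap.finrank_le_finrank_of_injective hinj
    · rw [Module.finrank_fin_fun]; exact hB.center_finrank
  obtain ⟨v, hv⟩ := (LinearMap.injective_iff_surjective_of_finrank_eq_finrank hfin).mp hinj ⟨w, hw⟩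
  choose g hg using fun t => hk (v t)
  obtain rfl : (fun t => algebraMap R k (g t)) = v := funext hg
  exact ⟨s₀ g, by rw [← hφ, hv]⟩

/-- The `f i` are orthogonal idempotents lifting the `e i`, and the elements `β i l` of the Peirce
components lift the `b i l`. -/
structure IsArrowLift (r : C →ₐ[R] B) (e : Fin 3 → B) (b : Fin 3 → Fin 3 → B) (f : Fin 3 → C)
    (β : Fin 3 → Fin 3 → C) : Prop where
  idem : CompleteOrthogonalIdempotents f
  map_idem : ∀ i, r (f i) = e i
  diag : ∀ i, β i i = f i
  mem : ∀ i l, β i l ∈ peirceComponent R (f i) (f l)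
  map : ∀ i l, r (β i l) = b i l

theorem exists_isArrowLift (hB : IsQuiverModel k e b) (hr : IsReduction π r) {f : Fin 3 → C}
    (hf : CompleteOrthogonalIdempotents f) (hfe : ∀ i, r (f i) = e i) :
    ∃ β, IsArrowLift r e b f β := by
  choose x hx using fun i l => hr.surjective (b i l)
  refine ⟨fun i l => if i = l then f i else f i * x i l * f l, hf, hfe, fun i => if_pos rfl, ?_, ?_⟩
  · intro i l
    split_ifs with h
    · subst h
      rw [mem_peirceComponent, (hf.idem i).eq, (hf.idem i).eq]
    · exact mul_mul_mem_peirceComponent (hf.idem i) (hf.idem l) _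
  · intro i l
    split_ifs with h
    · subst h
      rw [hfe, hB.diag]
    · rw [map_mul, map_mul, hfe, hfe, hx]
      exact hB.mem i l

variable {f : Fin 3 → C} {β : Fin 3 → Fin 3 → C}

variable [IsDiscreteValuationRing R] [Module.Finite R C]

/-- The Peirce component of `f i` and `f l` is generated by `β i l` over the order, by Nakayama's
lemma. -/
theorem IsArrowLift.mem_peirceComponent_iff (hk : Function.Surjective (algebraMap R k))
    (hπ : ∀ a, algebraMap R k a = 0 ↔ π ∣ a) (hB : IsQuiverModel k e b) (hr : IsReduction π r)
    (hj : IsCentralOrder π r j) (hβ : IsArrowLift r e b f β) (i l : Fin 3) (y : C) :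
    y ∈ peirceComponent R (f i) (f l) ↔ ∃ s, y = j s * β i l := by
  constructor
  · let N : Submodule R C :=
      LinearMap.range ((LinearMap.mulRight R (β i l)).comp j.toLinearMap)
    have hle : peirceComponent R (f i) (f l) ≤ N := by
      refine Submodule.le_of_le_smul_of_le_jacobson_bot (I := Ideal.span {π})
        (IsNoetherian.noetherian _) ?_ ?_
      · rw [IsLocalRing.jacobson_eq_maximalIdeal ⊥ bot_ne_top, Ideal.span_singleton_le_iff_mem,
          IsLocalRing.mem_maximalIdeal]
        intro hu
        have h1 := (hπ π).mpr dvd_rfl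
        exact (hu.map (algebraMap R k)).ne_zero h1
      · intro y hy
        have h1 : r y ∈ peirceComponent k (e i) (e l) := by
          rw [_root_.mem_peirceComponent, ← hβ.map_idem, ← hβ.map_idem, ← map_mul, ← map_mul, hy]
        obtain ⟨w, hw, hyw⟩ := hB.gen i l _ h1
        obtain ⟨s, rfl⟩ := hj.exists_map_eq hk hπ hB hr hw
        obtain ⟨y', hy'⟩ := hr.ker (y - j s * β i l) (by
          rw [map_sub, map_mul, hβ.map, hyw, sub_self])
        have h2 : f i * (y - j s * β i l) * f l = y - j s * β i l := by
          have h3 : f i * (j s * β i l) * f l = j s * β i l := by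
            rw [← mul_assoc, ← hj.commute, mul_assoc, mul_assoc, ← mul_assoc (f i), hβ.mem i l]
          rw [mul_sub, sub_mul, h3, hy]
        have h3 : y = j s * β i l + π • (f i * y' * f l) := by
          rw [← smul_mul_assoc, ← mul_smul_comm, ← hy', h2]
          abel
        rw [h3]
        refine Submodule.add_mem_sup ⟨s, rfl⟩ (Submodule.smul_mem_smul
          (Ideal.mem_span_singleton_self π) ?_)
        exact mul_mul_mem_peirceComponent (hβ.idem.idem i) (hβ.idem.idem l) _
    intro hy
    obtain ⟨s, hs⟩ := hle hy
    exact ⟨s, hs.symm⟩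
  · rintro ⟨s, rfl⟩
    rw [_root_.mem_peirceComponent, ← mul_assoc, ← hj.commute, mul_assoc, mul_assoc, ← mul_assoc
        (f i),
      hβ.mem i l]

theorem IsArrowLift.card_support [Module.Free R C] (hk : Function.Surjective (algebraMap R k))
    (hπ : ∀ a, algebraMap R k a = 0 ↔ π ∣ a) (hB : IsQuiverModel k e b) (hr : IsReduction π r)
    (hj : IsCentralOrder π r j) (hβ : IsArrowLift r e b f β) (i l : Fin 3) :
    (support j (β i l)).card = (stdSupport i l).card := by
  rw [← hB.finrank i l, ← finrank_eq_card_support (M := peirceComponent R (f i) (f l))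
    (hβ.mem_peirceComponent_iff hk hπ hB hr hj i l)]
  have hmap : ∀ y ∈ peirceComponent R (f i) (f l), r y ∈ peirceComponent k (e i) (e l) :=
      fun y hy => by
    rw [_root_.mem_peirceComponent, ← hβ.map_idem, ← hβ.map_idem, ← map_mul, ← map_mul, hy]
  refine finrank_eq_of_reduction (V := peirceComponent k (e i) (e l)) hk hπ
    (LinearMap.codRestrict ((peirceComponent k (e i) (e l)).restrictScalars R)
      (r.toLinearMap.comp (Submodule.subtype _)) fun y => hmap y y.2) ?_ ?_
  · rintro ⟨y, hy⟩
    obtain ⟨x, rfl⟩ := hr.surjective y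
    refine ⟨⟨f i * x * f l, mul_mul_mem_peirceComponent (hβ.idem.idem i) (hβ.idem.idem l) _⟩, ?_⟩
    apply Subtype.ext
    change r (f i * x * f l) = r x
    rw [map_mul, map_mul, hβ.map_idem, hβ.map_idem, hy]
  · rintro ⟨y, hy⟩ h
    obtain ⟨y', rfl⟩ := hr.ker y (congrArg Subtype.val h)
    refine ⟨⟨f i * y' * f l, mul_mul_mem_peirceComponent (hβ.idem.idem i) (hβ.idem.idem l) _⟩, ?_⟩
    apply Subtype.ext
    change π • y' = π • (f i * y' * f l)
    rw [← smul_mul_assoc, ← mul_smul_comm, hy]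

end Reduction

/-! ### The supports of the Peirce components -/

section Supports

variable {R k C B : Type*} [CommRing R] [IsDomain R] [CharZero R]
  [Field k] [Algebra R k] [Ring C] [Algebra R C] [Module.IsTorsionFree R C]
  [Ring B] [Algebra k B] [Algebra R B] [IsScalarTower R k B]
  {π : R} {e : Fin 3 → B} {b : Fin 3 → Fin 3 → B} {r : C →ₐ[R] B} {j : centerOrder R →ₐ[R] C}
  {f : Fin 3 → C} {β : Fin 3 → Fin 3 → C}

theorem IsArrowLift.mul_eq (hβ : IsArrowLift r e b f β) (i l : Fin 3) :
    f i * β i l = β i l ∧ β i l * f l = β i l := by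
  have h := hβ.mem i l
  rw [mem_peirceComponent] at h
  constructor
  · rw [← h, ← mul_assoc, ← mul_assoc, (hβ.idem.idem i).eq]
  · rw [← h, mul_assoc, (hβ.idem.idem l).eq]

/-- Each coordinate occurs in the support of some idempotent, because these sum up to `1`. -/
theorem IsArrowLift.biUnion_support (hβ : IsArrowLift r e b f β) (hj : IsCentralOrder π r j)
    (t : Fin 7) : ∃ i, t ∈ support j (β i i) := by
  by_contra! h
  have h0 : j (epsVec t) = 0 := by
    rw [← mul_one (j (epsVec t)), ← hβ.idem.complete, Finset.mul_sum]
    refine Finset.sum_eq_zero fun i _ => ?_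
    rw [← hβ.diag]
    exact not_not.mp (mt mem_support.mpr (h i))
  have h1 : (epsVec t : centerOrder R) = 0 := hj.injective (by rw [h0, map_zero])
  have h2 := congrFun (congrArg Subtype.val h1) t
  simp [epsVec] at h2

theorem IsArrowLift.support_subset_left (hβ : IsArrowLift r e b f β) (i l : Fin 3) :
    support j (β i l) ⊆ support j (β i i) := by
  have h := support_mul_subset_left (j := j) (f i) (β i l)
  rwa [(hβ.mul_eq i l).1, ← hβ.diag] at h

theorem IsArrowLift.support_subset_right (hβ : IsArrowLift r e b f β) (hj : IsCentralOrder π r j)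
    (i l : Fin 3) : support j (β i l) ⊆ support j (β l l) := by
  have h := support_mul_subset_right hj.commute (β i l) (f l)
  rwa [(hβ.mul_eq i l).2, ← hβ.diag] at h

/-- A product of two arrows vanishes at the coordinates at which the first one does. -/
theorem apply_eq_zero_of_mul_eq {i l p : Fin 3} {q : Fin 3} {z : centerOrder R}
    (hz : β i l * β p q = j z * β i q) {t : Fin 7} (ht : t ∈ support j (β i q))
    (ht' : t ∉ support j (β i l)) : z.1 t = 0 := by
  have h1 : z.1 t • (j (epsVec t) * β i q) = 0 := by
    rw [← smul_mul_assoc, ← map_smul, ← mul_epsVec, mul_comm z, map_mul, mul_assoc, ← hz,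
      ← mul_assoc, not_not.mp (mt mem_support.mpr ht'), zero_mul]
  exact (smul_eq_zero.mp h1).resolve_right (mem_support.mp ht)

/-- A closed path of length two has a square that does not vanish modulo `π`, as this holds in `B`.
-/
theorem IsArrowLift.not_sqDvd (hπ : ∀ a, algebraMap R k a = 0 ↔ π ∣ a)
    (hB : IsQuiverModel k e b) (hβ : IsArrowLift r e b f β)
    (hj : IsCentralOrder π r j) {i l : Fin 3} (hil : i ≠ l) {z : centerOrder R}
    (hz : β i l * β l i = j z * β i i) : ¬ SqDvd π (support j (β i i)) z.1 := by
  rintro ⟨s, hs, hst⟩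
  apply hB.sq_ne i l hil
  have h1 : j (z ^ 2) * β i i = j (π • ⟨s, hs⟩) * β i i :=
    map_mul_eq_iff.mpr fun t ht => by
      simpa using hst t ht
  have h2 : (β i l * β l i) ^ 2 = π • (j ⟨s, hs⟩ * β i i) := by
    rw [← smul_mul_assoc, ← map_smul, ← h1, hz, hβ.diag, sq, mul_assoc, ← mul_assoc (f i),
      ← hj.commute, mul_assoc (j z) (f i), (hβ.idem.idem i).eq, ← mul_assoc, map_pow, sq]
  rw [← hβ.map, ← hβ.map, ← map_mul, ← map_pow, h2, map_smul, ← algebraMap_smul k π,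
    (hπ π).mpr dvd_rfl, zero_smul]

/-- The endomorphism of the order given by a symmetry. -/
def IsCenterSymmetry.toAlgHom {σ : Equiv.Perm (Fin 7)} (h : IsCenterSymmetry R σ) :
    centerOrder R →ₐ[R] centerOrder R where
  toFun s := ⟨s.1 ∘ σ, h _ s.2⟩
  map_one' := rfl
  map_mul' _ _ := rfl
  map_zero' := rfl
  map_add' _ _ := rfl
  commutes' _ := rfl

theorem inv_wordPerm (w : List (Fin 3)) : (wordPerm w)⁻¹ = wordPerm w.reverse := by
  have h : ∀ i, (centerSwap i)⁻¹ = centerSwap i := by decide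
  rw [wordPerm, wordPerm, List.prod_inv_reverse, List.map_reverse, List.map_map]
  congr 2
  exact List.map_congr_left fun i _ => h i

/-- Composing `j` with a symmetry of the order permutes the supports. -/
theorem exists_isCentralOrder_support (hj : IsCentralOrder π r j) (w : List (Fin 3)) :
    ∃ j', IsCentralOrder π r j' ∧
      ∀ (x : C) t, t ∈ support j' x ↔ wordPerm w t ∈ support j x := by
  have hσ : IsCenterSymmetry R (wordPerm w)⁻¹ := by
    rw [inv_wordPerm]
    exact isCenterSymmetry_wordPerm _
  refine ⟨j.comp hσ.toAlgHom, ⟨fun s x => hj.commute _ x, ?_, ?_⟩, ?_⟩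
  · refine hj.injective.comp fun s s' h => ?_
    apply Subtype.ext
    exact (wordPerm w)⁻¹.surjective.injective_comp_right (congrArg Subtype.val h)
  · intro s h
    obtain ⟨s', hs'⟩ := hj.pure _ h
    refine ⟨(isCenterSymmetry_wordPerm w).toAlgHom s', ?_⟩
    apply Subtype.ext
    funext t
    have := congrFun (congrArg Subtype.val hs') (wordPerm w t)
    have h2 : ((wordPerm w)⁻¹ (wordPerm w t)) = t := Equiv.symm_apply_apply _ _
    change s.1 ((wordPerm w)⁻¹ (wordPerm w t)) = _ at this
    rwa [h2] at this
  · intro x t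
    rw [mem_support, mem_support]
    have : hσ.toAlgHom (epsVec t) = epsVec (wordPerm w t) := by
      apply Subtype.ext
      funext u
      simp [IsCenterSymmetry.toAlgHom, epsVec, Pi.single_apply, Equiv.symm_apply_eq]
    rw [AlgHom.comp_apply, this]

end Supports

section Standardise

variable {R k C B : Type*} [CommRing R] [IsDomain R] [CharZero R] [IsDiscreteValuationRing R]
  [Field k] [Algebra R k] [Ring C] [Algebra R C] [Module.Finite R C] [Module.Free R C]
  [Ring B] [Algebra k B] [Algebra R B] [IsScalarTower R k B]
  {π : R} {e : Fin 3 → B} {b : Fin 3 → Fin 3 → B} {r : C →ₐ[R] B} {j : centerOrder R →ₐ[R] C}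
  {f : Fin 3 → C} {β : Fin 3 → Fin 3 → C}

theorem stdSupport_card (i l : Fin 3) :
    (stdSupport i l).card = if i = l then 4 else 2 := by
  revert i l; decide

theorem centerVec_eq_add_two_mul {R : Type*} [CommRing R] (g : Fin 7 → R) (t : Fin 7) :
    ∃ y, centerVec g t = g 0 + 2 * y := by
  refine ⟨![0, 2 * (g 2 + g 3) + 4 * g 4, 2 * (g 1 + g 3) + 4 * g 5, 2 * (g 1 + g 2) + 4 * g 6,
    g 1, g 2, g 3] t, ?_⟩
  fin_cases t <;> simp [centerVec] <;> ring

theorem IsArrowLift.exists_mul_eq (hk : Function.Surjective (algebraMap R k))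
    (hπ : ∀ a, algebraMap R k a = 0 ↔ π ∣ a) (hB : IsQuiverModel k e b) (hr : IsReduction π r)
    (hj : IsCentralOrder π r j) (hβ : IsArrowLift r e b f β) (i p l : Fin 3) :
    ∃ z, β i p * β p l = j z * β i l := by
  rw [← hβ.mem_peirceComponent_iff hk hπ hB hr hj, _root_.mem_peirceComponent, ← mul_assoc,
    (hβ.mul_eq i p).1, mul_assoc, (hβ.mul_eq p l).2]

/-- The element `z` of the order that gives the closed path through `i` and `l` vanishes on the
support of `f i` outside of the one of `β i l`, and its square is not divisible by `π`; this
restricts both supports. -/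
theorem IsArrowLift.support_mem_goodSupports (hk : Function.Surjective (algebraMap R k)) {d : R}
    (hd : 2 = π * d)
    (hπ : ∀ a, algebraMap R k a = 0 ↔ π ∣ a) (hB : IsQuiverModel k e b) (hr : IsReduction π r)
    (hj : IsCentralOrder π r j) (hβ : IsArrowLift r e b f β) {i l : Fin 3} (hil : i ≠ l) :
    support j (β i i) ∈ goodSupports ∧ IsMixed (support j (β i l)) := by
  obtain ⟨z, hz⟩ := hβ.exists_mul_eq hk hπ hB hr hj i l i
  have hsq := hβ.not_sqDvd hπ hB hj hil hz
  have h0 : ∀ t ∈ support j (β i i), t ∉ support j (β i l) → z.1 t = 0 :=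
    fun t ht ht' => apply_eq_zero_of_mul_eq hz ht ht'
  have hc1 : (support j (β i i)).card = 4 := by
    rw [hβ.card_support hk hπ hB hr hj, stdSupport_card, if_pos rfl]
  have hc2 : (support j (β i l)).card = 2 := by
    rw [hβ.card_support hk hπ hB hr hj, stdSupport_card, if_neg hil]
  obtain ⟨_, g, rfl⟩ := z
  -- all coordinates are congruent to `g 0` modulo `2`, and one of them vanishes
  obtain ⟨c', hc'⟩ : ∃ c', g 0 = π * c' := by
    obtain ⟨t, ht, ht'⟩ := Finset.exists_mem_notMem_of_card_lt_card (hc2.trans_lt (by omega :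
      2 < (support j (β i i)).card))
    have h1 := h0 t ht ht'
    have h2 : (2 : R) ∣ g 0 := by
      obtain ⟨y, hy⟩ := centerVec_eq_add_two_mul g t
      exact ⟨-y, by linear_combination h1 - hy⟩
    rw [hd] at h2
    exact (dvd_of_mul_right_dvd h2)
  exact ⟨mem_goodSupports hd hc1 hc' hsq, isMixed_of_not_sqDvd hd (mem_goodSupports hd hc1 hc' hsq)
    (hβ.support_subset_left i l) hc2 hc' h0 hsq⟩

/-- After composing `j` with a symmetry of the order, all supports are the standard ones. The
idempotents are ordered by `exists_wordPerm_eq`; the support of `β i l` is contained in those of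
`f i` and `f l`, and has two elements. -/
theorem IsArrowLift.exists_support_eq (hk : Function.Surjective (algebraMap R k))
    {d : R} (hd : 2 = π * d)
    (hπ : ∀ a, algebraMap R k a = 0 ↔ π ∣ a) (hB : IsQuiverModel k e b) (hr : IsReduction π r)
    (hj : IsCentralOrder π r j) (hβ : IsArrowLift r e b f β) :
    ∃ j', IsCentralOrder π r j' ∧ ∀ i l, support j' (β i l) = stdSupport i l := by
  have hgood := fun {i l : Fin 3} (h : i ≠ l) => hβ.support_mem_goodSupports hk hd hπ hB hr hj h
  have hsub : ∀ i l, support j (β i l) ⊆ support j (β i i) ∩ support j (β l l) := fun i l =>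
    Finset.subset_inter (hβ.support_subset_left i l) (hβ.support_subset_right hj i l)
  have hmix : ∀ {i l : Fin 3}, i ≠ l → IsMixed (support j (β i i) ∩ support j (β l l)) := by
    intro i l h
    obtain ⟨s, hs, t, ht, hst⟩ := (hgood h).2
    exact ⟨s, hsub i l hs, t, hsub i l ht, hst⟩
  obtain ⟨w, -, hw0, hw1, hw2⟩ := exists_wordPerm_eq _ (hgood (i := 0) (l := 1) (by decide)).1
    _ (hgood (i := 1) (l := 2) (by decide)).1 _ (hgood (i := 2) (l := 0) (by decide)).1
    (hmix (by decide)) (hmix (by decide)) (hmix (by decide)) (by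
      ext t
      obtain ⟨i, hi⟩ := hβ.biUnion_support hj t
      fin_cases i <;> simp_all)
  obtain ⟨j', hj', hsupp⟩ := exists_isCentralOrder_support hj w
  refine ⟨j', hj', ?_⟩
  have hdiag : ∀ i, support j' (β i i) = stdSupport i i := by
    intro i
    ext t
    rw [hsupp]
    have h : (stdSupport i i).image (wordPerm w) = support j (β i i) := by
      fin_cases i <;> assumption
    rw [← h, Finset.mem_image]
    simp
  intro i l
  have hstd : ∀ i l : Fin 3, stdSupport i i ∩ stdSupport l l = stdSupport i l := by decide
  refine Finset.eq_of_subset_of_card_le ?_ ?_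
  · rw [← hstd, ← hdiag i, ← hdiag l]
    exact Finset.subset_inter (hβ.support_subset_left i l) (hβ.support_subset_right hj' i l)
  · exact (hβ.card_support hk hπ hB hr hj' i l).ge

end Standardise

/-! ### Rescaling the arrows -/

section Frame

variable {R C : Type*} [CommRing R] [Ring C] [Algebra R C]

/-- The elements `β i l` generate the Peirce components of the idempotents `f i` over the order, and
have the standard supports. Their products are not yet normalised. -/
structure IsFrame (j : centerOrder R →ₐ[R] C) (f : Fin 3 → C) (β : Fin 3 → Fin 3 → C) : Prop where
  commute : ∀ s x, j s * x = x * j s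
  idem : CompleteOrthogonalIdempotents f
  diag : ∀ i, β i i = f i
  left : ∀ i l, f i * β i l = β i l
  right : ∀ i l, β i l * f l = β i l
  gen : ∀ i l y, f i * y * f l = y → ∃ s, y = j s * β i l
  support : ∀ i l, support j (β i l) = stdSupport i l

variable {j : centerOrder R →ₐ[R] C} {f : Fin 3 → C} {β : Fin 3 → Fin 3 → C}

theorem mul_comm_mul (hj : ∀ s x, j s * x = x * j s) (s t : centerOrder R) (x y : C) :
    (j s * x) * (j t * y) = j (s * t) * (x * y) := by
  rw [mul_assoc, ← mul_assoc x, ← hj, mul_assoc, ← mul_assoc, map_mul]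

/-- The arrows may be multiplied by units of the order. -/
theorem IsFrame.rescale (h : IsFrame j f β) {u v : Fin 3 → Fin 3 → centerOrder R}
    (huv : ∀ i l, u i l * v i l = 1) (hu : ∀ i, u i i = 1) :
    IsFrame j f fun i l => j (u i l) * β i l where
  commute := h.commute
  idem := h.idem
  diag i := by rw [hu, map_one, one_mul, h.diag]
  left i l := by rw [← mul_assoc, ← h.commute, mul_assoc, h.left]
  right i l := by rw [mul_assoc, h.right]
  gen i l y hy := by
    obtain ⟨s, rfl⟩ := h.gen i l y hy
    refine ⟨s * v i l, ?_⟩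
    rw [← mul_assoc, ← map_mul, mul_assoc, mul_comm (v i l), huv, mul_one]
  support i l := by
    rw [← h.support]
    ext t
    rw [mem_support, mem_support, not_iff_not]
    constructor
    · intro h0
      have h1 : j (v i l) * (j (epsVec t) * (j (u i l) * β i l)) = j (epsVec t) * β i l := by
        rw [← mul_assoc, ← mul_assoc, ← map_mul, ← map_mul]
        congr 2
        linear_combination (epsVec t) * huv i l
      rw [← h1, h0, mul_zero]
    · intro h0
      rw [← mul_assoc, ← map_mul, mul_comm, map_mul, mul_assoc, h0, mul_zero]

theorem IsFrame.mul_mem (h : IsFrame j f β) (i p l : Fin 3) :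
    ∃ z, β i p * β p l = j z * β i l := by
  apply h.gen
  rw [← mul_assoc, h.left, mul_assoc, h.right]

theorem IsFrame.mul_of_ne (h : IsFrame j f β) (i p q l : Fin 3) (hpq : p ≠ q) :
    β i p * β q l = 0 := by
  rw [← h.right i p, ← h.left q l, mul_assoc, ← mul_assoc (f p), h.idem.ortho hpq, zero_mul,
    mul_zero]

theorem IsFrame.isNormalForm [IsDomain R] [CharZero R] [Module.IsTorsionFree R C]
    (h : IsFrame j f β)
    (hzeta : ∀ i p, i ≠ p → β i p * β p i = j (zeta R (-(i + p))) * f i)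
    (hrho : ∀ i p l, i ≠ p → p ≠ l → i ≠ l → β i p * β p l = j (rho R) * β i l) :
    IsNormalForm j β where
  commute := h.commute
  exists_eq_sum x := by
    have hx : ∀ i l, ∃ s, f i * x * f l = j s * β i l := fun i l => by
      apply h.gen
      rw [← mul_assoc, ← mul_assoc, (h.idem.idem i).eq, mul_assoc _ (f l), (h.idem.idem l).eq]
    choose s hs using hx
    refine ⟨s, ?_⟩
    simp only [← hs]
    simp only [← Finset.mul_sum, ← Finset.sum_mul, h.idem.complete, one_mul, mul_one]
  sum_eq_zero_iff s := by
    have hcomp : ∀ p q, f p * (∑ i, ∑ l, j (s i l) * β i l) * f q = j (s p q) * β p q := by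
      intro p q
      have h1 : ∀ i l, f p * (j (s i l) * β i l) * f q =
          if i = p ∧ l = q then j (s p q) * β p q else 0 := by
        intro i l
        have h2 : f p * (j (s i l) * β i l) * f q = j (s i l) * (f p * β i l * f q) := by
          rw [← mul_assoc, ← h.commute, mul_assoc, mul_assoc, ← mul_assoc (f p)]
        rw [h2]
        split_ifs with hip
        · obtain ⟨rfl, rfl⟩ := hip
          rw [h.left, h.right]
        · by_cases hi : i = p
          · have hl : l ≠ q := fun hl => hip ⟨hi, hl⟩
            rw [← h.right i l, ← mul_assoc (f p), mul_assoc _ (f l), h.idem.ortho hl, mul_zero,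
              mul_zero]
          · rw [← h.left i l, ← mul_assoc (f p), h.idem.ortho (Ne.symm hi), zero_mul, zero_mul,
              mul_zero]
      simp only [Finset.mul_sum, Finset.sum_mul, h1]
      rw [Finset.sum_eq_single p, Finset.sum_eq_single q]
      · simp
      · intro l _ hl; simp [hl]
      · simp
      · intro i _ hi; simp [hi]
      · simp
    constructor
    · intro h0 i l
      rw [← h.support, ← map_mul_eq_zero_iff, ← hcomp, h0, mul_zero, zero_mul]
    · intro h0
      refine Finset.sum_eq_zero fun i _ => Finset.sum_eq_zero fun l _ => ?_
      rw [map_mul_eq_zero_iff, h.support]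
      exact h0 i l
  mul_of_ne := h.mul_of_ne
  mul i p l := by
    unfold structureConstant
    by_cases h1 : i = p
    · subst h1
      rw [if_pos (Or.inl rfl), map_one, one_mul, h.diag, h.left]
    by_cases h2 : p = l
    · subst h2
      rw [if_pos (Or.inr rfl), map_one, one_mul, h.diag, h.right]
    rw [if_neg (by tauto)]
    by_cases h3 : i = l
    · subst h3
      rw [if_pos rfl, h.diag, hzeta i p h1]
    · rw [if_neg h3, hrho i p l h1 h2 h3]

variable [IsDomain R] [CharZero R] [Module.IsTorsionFree R C]

theorem zetaVec_eq_zero {i l : Fin 3} (h : i ≠ l) {t : Fin 7} (ht : t ∈ stdSupport i i)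
    (ht' : t ∉ stdSupport i l) : (zetaVec (-(i + l)) t : R) = 0 := by
  have key : ∀ i l : Fin 3, i ≠ l → ∀ t ∈ stdSupport i i, t ∉ stdSupport i l →
    (zetaVec (-(i + l)) t : ℤ) = 0 := by decide
  have hcast : ((zetaVec (-(i + l)) t : ℤ) : R) = zetaVec (-(i + l)) t := by
    generalize -(i + l) = m
    fin_cases m <;> fin_cases t <;> simp [zetaVec]
  rw [← hcast, key i l h t ht ht', Int.cast_zero]

/-- One of the two closed paths through `i` and `l` determines the other: multiply by `β l i`, and
use that both vanish outside of `stdSupport l i`. -/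
theorem IsFrame.zeta_symm (h : IsFrame j f β) {i l : Fin 3} (hil : i ≠ l)
    (hz : β i l * β l i = j (zeta R (-(i + l))) * f i) :
    β l i * β i l = j (zeta R (-(l + i))) * f l := by
  obtain ⟨z, hz'⟩ := h.mul_mem l i l
  rw [hz', h.diag, ← h.diag, map_mul_eq_iff, h.support]
  intro t ht
  by_cases ht' : t ∈ stdSupport l i
  · have h1 : j z * β l i = j (zeta R (-(l + i))) * β l i := by
      rw [← h.left l i, ← h.diag l, ← mul_assoc, ← hz', mul_assoc, hz, ← mul_assoc, ← h.commute,
        mul_assoc, h.right, h.diag, h.left, add_comm l i]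
    rw [map_mul_eq_iff, h.support] at h1
    exact h1 t ht'
  · refine Eq.trans ?_ (zetaVec_eq_zero (Ne.symm hil) ht ht').symm
    refine apply_eq_zero_of_mul_eq hz' ?_ ?_
    · rwa [h.support]
    · rwa [h.support]

/-- Rescaling `β i l` for `i < l` by the units of `exists_unit_eq_zetaVec`, one obtains the standard
closed paths of length two. -/
theorem IsFrame.exists_zeta [IsLocalRing R] (h : IsFrame j f β) {π d : R}
    (hd : 2 = π * d) (hπ : IsLocalRing.maximalIdeal R = Ideal.span {π})
    (hsq : ∀ i l, i ≠ l → ∀ z, β i l * β l i = j z * β i i → ¬ SqDvd π (stdSupport i i) z.1) :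
    ∃ β', IsFrame j f β' ∧ ∀ i p, i ≠ p →
      β' i p * β' p i = j (zeta R (-(i + p))) * f i := by
  have hex : ∀ i l, ∃ u v : centerOrder R, u * v = 1 ∧ (i = l → u = 1) ∧
      (i ≠ l → j u * (β i l * β l i) = j (zeta R (-(i + l))) * f i) := by
    intro i l
    by_cases hil : i = l
    · exact ⟨1, 1, one_mul 1, fun _ => rfl, fun h => absurd hil h⟩
    · obtain ⟨z, hz⟩ := h.mul_mem i l i
      obtain ⟨u, v, huv, hut⟩ := exists_unit_eq_zetaVec hd hπ hil z.2
        (fun t ht ht' => apply_eq_zero_of_mul_eq hz (by rwa [h.support]) (by rwa [h.support]))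
        (hsq i l hil z hz)
      refine ⟨v, u, by rw [mul_comm, huv], fun h => absurd h hil, fun _ => ?_⟩
      rw [hz, ← mul_assoc, ← map_mul, h.diag, ← h.diag, map_mul_eq_iff, h.support]
      intro t ht
      have h1 := congrFun (congrArg Subtype.val huv) t
      change u.1 t * v.1 t = 1 at h1
      change v.1 t * z.1 t = zetaVec (-(i + l)) t
      rw [hut t ht]
      linear_combination zetaVec (-(i + l)) t * h1
  choose u v huv hdiag hu using hex
  have hframe := h.rescale (u := fun i l => if i < l then u i l else 1)
    (v := fun i l => if i < l then v i l else 1)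
    (fun i l => by split_ifs <;> simp [huv]) (fun i => by simp)
  refine ⟨_, hframe, ?_⟩
  have hlt : ∀ i l, i < l → (j (if i < l then u i l else 1) * β i l) *
      (j (if l < i then u l i else 1) * β l i) =
      j (zeta R (-(i + l))) * f i := by
    intro i l hil
    rw [mul_comm_mul h.commute, if_pos hil, if_neg hil.not_gt, mul_one, hu i l hil.ne]
  intro i p hip
  rcases lt_or_gt_of_ne hip with hlt' | hlt'
  · exact hlt i p hlt'
  · exact hframe.zeta_symm hlt'.ne (hlt p i hlt')

/-- Once the closed paths of length two are standard, a product `β i p * β p l` of arrows with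
distinct `i`, `p`, `l` is `β i l` times a scalar multiple of `rho R`. Transposing two neighbouring
indices inverts the scalar, so that only one scalar is left, and it is removed by rescaling `β 0 1`
and `β 1 0`. -/
theorem IsFrame.exists_rho (h : IsFrame j f β)
    (hz : ∀ i p, i ≠ p → β i p * β p i = j (zeta R (-(i + p))) * f i) :
    ∃ β', IsNormalForm j β' := by
  have hex : ∀ i p l, ∃ a : R, i ≠ p → p ≠ l → i ≠ l →
      β i p * β p l = j (a • rho R) * β i l := by
    intro i p l
    by_cases hd : i ≠ p ∧ p ≠ l ∧ i ≠ l
    · obtain ⟨h1, h2, h3⟩ := hd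
      obtain ⟨w, hw⟩ := h.mul_mem i p l
      obtain ⟨a, ha⟩ := eq_smul_rhoVec h1 h2 h3 w.2 fun t ht ht' =>
        apply_eq_zero_of_mul_eq hw (by rwa [h.support]) (by rwa [h.support])
      refine ⟨a, fun _ _ _ => ?_⟩
      rw [hw, map_mul_eq_iff, h.support]
      intro t ht
      exact ha t ht
    · exact ⟨0, fun h1 h2 h3 => absurd ⟨h1, h2, h3⟩ hd⟩
  choose a ha using hex
  have four : (4 : R) ≠ 0 := by norm_num
  have hzero : ∀ i l, (0 : Fin 7) ∈ stdSupport i l := by decide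
  -- compare the two sides at the coordinate `0`, which belongs to all supports, where `zeta` is `4`
  -- and `rho` is `2`
  have hcoef : ∀ {m i l : Fin 3} {x y : R},
      j (zeta R m) * β i l = j ((x • rho R) * (y • rho R)) * β i l → x * y = 1 := by
    intro m i l x y e
    rw [map_mul_eq_iff, h.support] at e
    have e0 := e 0 (hzero _ _)
    have e1 : (zeta R m).1 0 = 4 := by
      fin_cases m <;> simp [zeta, zetaVec]
    rw [e1] at e0
    simp only [rho, MulMemClass.coe_mul, SetLike.val_smul, Pi.mul_apply, Pi.smul_apply, rhoVec,
      smul_eq_mul, Matrix.cons_val_zero] at e0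
    exact mul_left_cancel₀ four (by linear_combination -e0)
  have hleft : ∀ i p l, i ≠ p → p ≠ l → i ≠ l → a i p l * a p i l = 1 := by
    intro i p l h1 h2 h3
    refine hcoef (m := -(p + i)) (i := p) (l := l) ?_
    have e1 : β p i * (β i p * β p l) = j (zeta R (-(p + i))) * β p l := by
      rw [← mul_assoc, hz p i h1.symm, mul_assoc, h.left]
    rw [← e1, ha i p l h1 h2 h3, ← mul_assoc, ← h.commute, mul_assoc, ha p i l h1.symm h3 h2,
      ← mul_assoc, ← map_mul]
  have hright : ∀ i p l, i ≠ p → p ≠ l → i ≠ l → a i p l * a i l p = 1 := by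
    intro i p l h1 h2 h3
    refine hcoef (m := -(p + l)) (i := i) (l := p) ?_
    have e1 : (β i p * β p l) * β l p = j (zeta R (-(p + l))) * β i p := by
      rw [mul_assoc, hz p l h2, ← mul_assoc, ← h.commute, mul_assoc, h.right]
    rw [← e1, ha i p l h1 h2 h3, mul_assoc, ha i l p h3 h2.symm h1, ← mul_assoc, ← map_mul]
  have a1 := hleft 0 1 2 (by decide) (by decide) (by decide)
  have a2 := hright 0 1 2 (by decide) (by decide) (by decide)
  have a3 := hright 1 0 2 (by decide) (by decide) (by decide)
  have a4 := hleft 0 2 1 (by decide) (by decide) (by decide)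
  have a5 := hleft 1 2 0 (by decide) (by decide) (by decide)
  have b1 : a 0 2 1 = a 1 0 2 := by linear_combination a 1 0 2 * a2 - a 0 2 1 * a1
  have b2 : a 1 2 0 = a 0 1 2 := by linear_combination a 0 1 2 * a3 - a 1 2 0 * a1
  let x : Fin 3 → Fin 3 → R := ![![1, a 1 0 2, 1], ![a 0 1 2, 1, 1], ![1, 1, 1]]
  let y : Fin 3 → Fin 3 → R := ![![1, a 0 1 2, 1], ![a 1 0 2, 1, 1], ![1, 1, 1]]
  have hxy : ∀ i l, x i l * y i l = 1 := by
    intro i l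
    fin_cases i <;> fin_cases l <;> simp [x, y, a1, mul_comm (a 1 0 2)]
  have hxx : ∀ i l, i ≠ l → x i l * x l i = 1 := by
    intro i l hil
    fin_cases i <;> fin_cases l <;> first | exact absurd rfl hil | skip
    all_goals simp [x, a1, mul_comm (a 1 0 2)]
  have hframe := h.rescale (u := fun i l => algebraMap R _ (x i l))
    (v := fun i l => algebraMap R _ (y i l)) (fun i l => by rw [← map_mul, hxy, map_one])
    (fun i => by fin_cases i <;> simp [x])
  refine ⟨_, hframe.isNormalForm ?_ ?_⟩
  · intro i p hip
    rw [mul_comm_mul h.commute, ← map_mul (algebraMap R _), hxx i p hip, map_one, map_one, one_mul,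
      hz i p hip]
  · intro i p l h1 h2 h3
    have key : x i p * x p l * a i p l = x i l := by
      fin_cases i <;> fin_cases p <;> first | exact absurd rfl h1 | skip
      all_goals fin_cases l <;> first | exact absurd rfl h2 | exact absurd rfl h3 | skip
      all_goals
        simp [x]
        first
          | exact a1
          | exact b1
          | exact b2
          | linear_combination a1
          | linear_combination a4 - a 2 0 1 * b1
          | linear_combination a5 - a 2 1 0 * b2
    rw [mul_comm_mul h.commute, ha i p l h1 h2 h3, ← mul_assoc, ← map_mul j,
      ← mul_assoc (j (rho R)), ← map_mul j]
    congr 2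
    rw [← key, Algebra.smul_def, map_mul, map_mul]
    ring

end Frame

/-! ### Existence of the normal form -/

section Uniqueness

variable {R k C C' B : Type*} [CommRing R] [IsDomain R] [CharZero R] [IsDiscreteValuationRing R]
  [Field k] [Algebra R k] [Ring C] [Algebra R C] [Module.Finite R C] [Module.Free R C]
  [Ring C'] [Algebra R C'] [Module.Finite R C'] [Module.Free R C']
  [Ring B] [Algebra k B] [Algebra R B] [IsScalarTower R k B]
  {π d : R} {e : Fin 3 → B} {b : Fin 3 → Fin 3 → B}

/-- Every algebra with a central order whose reduction modulo `π` is the quiver model has a normal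
form. -/
theorem exists_isNormalForm (hk : Function.Surjective (algebraMap R k))
    (hπ : ∀ a, algebraMap R k a = 0 ↔ π ∣ a) (hd : 2 = π * d)
    (hB : IsQuiverModel k e b) {r : C →ₐ[R] B} (hr : IsReduction π r)
    {j : centerOrder R →ₐ[R] C} (hj : IsCentralOrder π r j)
    {f : Fin 3 → C} (hf : CompleteOrthogonalIdempotents f) (hfe : ∀ i, r (f i) = e i) :
    ∃ (j' : centerOrder R →ₐ[R] C) (β : Fin 3 → Fin 3 → C), IsNormalForm j' β := by
  obtain ⟨β, hβ⟩ := exists_isArrowLift hB hr hf hfe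
  obtain ⟨j', hj', hsupp⟩ := hβ.exists_support_eq hk hd hπ hB hr hj
  have hmax : IsLocalRing.maximalIdeal R = Ideal.span {π} := by
    have h1 : RingHom.ker (algebraMap R k) = Ideal.span {π} := by
      ext a
      rw [RingHom.mem_ker, hπ, Ideal.mem_span_singleton]
    have h2 := RingHom.ker_isMaximal_of_surjective _ hk
    rw [← h1, IsLocalRing.eq_maximalIdeal h2]
  have hframe : IsFrame j' f β :=
    { commute := hj'.commute
      idem := hf
      diag := hβ.diag
      left := fun i l => (hβ.mul_eq i l).1
      right := fun i l => (hβ.mul_eq i l).2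
      gen := fun i l y hy => (hβ.mem_peirceComponent_iff hk hπ hB hr hj' i l y).mp hy
      support := hsupp }
  obtain ⟨β', hβ', hzeta⟩ := hframe.exists_zeta hd hmax fun i l hil z hz => by
    rw [← hsupp]
    exact hβ.not_sqDvd hπ hB hj' hil hz
  obtain ⟨β'', h⟩ := hβ'.exists_rho hzeta
  exact ⟨j', β'', h⟩

end Uniqueness

/-! ### Newton iteration in finite free algebras over a complete ring -/

section Hensel

open Polynomial

variable {R : Type*} [CommRing R] {π : R}

theorem exists_smul_of_aeval_sub {C : Type*} [Ring C] [Algebra R C] {x y : C} {a : R}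
    (h : ∃ z, x - y = a • z) (p : R[X]) : ∃ z, aeval x p - aeval y p = a • z := by
  obtain ⟨z, hz⟩ := h
  induction p using Polynomial.induction_on' with
  | add p q hp hq =>
    obtain ⟨u, hu⟩ := hp
    obtain ⟨v, hv⟩ := hq
    exact ⟨u + v, by rw [map_add, map_add, smul_add, ← hu, ← hv]; abel⟩
  | monomial n c =>
    have hpow : ∃ w, x ^ n - y ^ n = a • w := by
      induction n with
      | zero => exact ⟨0, by simp⟩
      | succ n ih =>
        obtain ⟨w, hw⟩ := ih
        refine ⟨w * x + y ^ n * z, ?_⟩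
        rw [smul_add, ← smul_mul_assoc, ← mul_smul_comm, ← hw, ← hz, pow_succ, pow_succ]
        noncomm_ring
    obtain ⟨w, hw⟩ := hpow
    refine ⟨c • w, ?_⟩
    rw [aeval_monomial, aeval_monomial, ← Algebra.smul_def, ← Algebra.smul_def, ← smul_sub, hw,
      smul_comm]

variable [IsAdicComplete (Ideal.span {π}) R]

theorem exists_limit {M : Type*} [AddCommGroup M] [Module R M] [Module.Free R M]
    [Module.Finite R M] (x : ℕ → M) (hx : ∀ n, ∃ y, x (n + 1) - x n = π ^ n • y) :
    ∃ L, ∀ n, ∃ y, L - x n = π ^ n • y := by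
  let b := Module.Free.chooseBasis R M
  have hcoord : ∀ i, ∃ l : R, ∀ n, π ^ n ∣ l - b.repr (x n) i := by
    intro i
    have hstep : ∀ n, π ^ n ∣ b.repr (x (n + 1)) i - b.repr (x n) i := by
      intro n
      obtain ⟨y, hy⟩ := hx n
      refine ⟨b.repr y i, ?_⟩
      rw [← Finsupp.sub_apply, ← map_sub, hy, map_smul, Finsupp.smul_apply, smul_eq_mul]
    have hcauchy : ∀ {m n}, m ≤ n → π ^ m ∣ b.repr (x m) i - b.repr (x n) i := by
      intro m n hmn
      induction n, hmn using Nat.le_induction with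
      | base => simp
      | succ n hmn ih =>
        have h1 := dvd_sub ih ((pow_dvd_pow π hmn).trans (hstep n))
        convert h1 using 1
        ring
    have hmem : ∀ (n : ℕ) (a c : R), a ≡ c [SMOD (Ideal.span {π} ^ n • ⊤ : Submodule R R)] ↔
        π ^ n ∣ a - c := by
      intro n a c
      rw [SModEq.sub_mem, Ideal.span_singleton_pow, smul_eq_mul, Ideal.mul_top,
        Ideal.mem_span_singleton]
    obtain ⟨l, hl⟩ := IsPrecomplete.prec (I := Ideal.span {π}) (M := R) inferInstance
      (f := fun n => b.repr (x n) i) (fun {m n} hmn => (hmem m _ _).mpr (hcauchy hmn))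
    refine ⟨l, fun n => ?_⟩
    rw [dvd_sub_comm]
    exact (hmem n _ _).mp (hl n)
  choose l hl using hcoord
  choose y hy using hl
  refine ⟨∑ i, l i • b i, fun n => ⟨∑ i, y i n • b i, ?_⟩⟩
  conv_lhs => rw [← b.sum_repr (x n)]
  rw [← Finset.sum_sub_distrib, Finset.smul_sum]
  refine Finset.sum_congr rfl fun i _ => ?_
  rw [← sub_smul, hy, mul_smul]

theorem eq_zero_of_forall_pow_smul {M : Type*} [AddCommGroup M] [Module R M] [Module.Free R M]
    [Module.Finite R M] {x : M} (hx : ∀ n, ∃ y, x = π ^ n • y) : x = 0 := by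
  let b := Module.Free.chooseBasis R M
  apply b.repr.injective
  ext i
  rw [map_zero, Finsupp.zero_apply]
  refine IsHausdorff.haus (I := Ideal.span {π}) (M := R) inferInstance _ fun n => ?_
  rw [SModEq.zero, Ideal.span_singleton_pow, smul_eq_mul, Ideal.mul_top,
    Ideal.mem_span_singleton]
  obtain ⟨y, hy⟩ := hx n
  exact ⟨b.repr y i, by rw [hy, map_smul, Finsupp.smul_apply, smul_eq_mul]⟩

/-- If the substitution `x ↦ x - p x * q x` squares the defect `p x` up to a factor, then its
iteration converges from any root of `p` modulo `π` to a root. No element has to be inverted, and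
the algebra need not be commutative. -/
theorem exists_root_of_newton {C : Type*} [Ring C] [Algebra R C] [Module.Free R C]
    [Module.Finite R C] {p q v : R[X]} (h : p.comp (X - p * q) = p ^ 2 * v) {x : C}
    (hx : ∃ y, aeval x p = π • y) : ∃ x' : C, aeval x' p = 0 ∧ ∃ y, x' - x = π • y := by
  let N : C → C := fun z => aeval z (X - p * q)
  have hN : ∀ z, N z = z - aeval z p * aeval z q := fun z => by simp [N]
  have hpN : ∀ z, aeval (N z) p = aeval z p ^ 2 * aeval z v := fun z => by
    rw [← aeval_comp, h]; simp
  let s : ℕ → C := fun n => N^[n] x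
  have hs : ∀ n, s (n + 1) = N (s n) := fun n => Function.iterate_succ_apply' N n x
  have hdef : ∀ n, ∃ y, aeval (s n) p = π ^ (n + 1) • y := by
    intro n
    induction n with
    | zero => simpa [s] using hx
    | succ n ih =>
      obtain ⟨y, hy⟩ := ih
      refine ⟨π ^ n • (y * y * aeval (s n) v), ?_⟩
      rw [hs, hpN, hy, sq, smul_mul_smul_comm, smul_mul_assoc, smul_smul, ← pow_add, ← pow_add]
      congr 2
      omega
  have hstep : ∀ n, ∃ y, s (n + 1) - s n = π ^ (n + 1) • y := by
    intro n
    obtain ⟨y, hy⟩ := hdef n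
    refine ⟨-(y * aeval (s n) q), ?_⟩
    rw [hs, hN, hy, smul_mul_assoc, smul_neg]
    abel
  obtain ⟨L, hL⟩ := exists_limit s (π := π) fun n => by
    obtain ⟨y, hy⟩ := hstep n
    exact ⟨π • y, by rw [hy, pow_succ, mul_smul]⟩
  refine ⟨L, eq_zero_of_forall_pow_smul (π := π) fun n => ?_, ?_⟩
  · obtain ⟨y, hy⟩ := exists_smul_of_aeval_sub (hL n) p
    obtain ⟨z, hz⟩ := hdef n
    refine ⟨y + π • z, ?_⟩
    rw [smul_add, ← hy, smul_smul, ← pow_succ, ← hz]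
    abel
  · obtain ⟨y, hy⟩ := hL 1
    obtain ⟨z, hz⟩ := hstep 0
    refine ⟨y + z, ?_⟩
    rw [pow_one] at hy
    rw [zero_add, pow_one] at hz
    rw [smul_add, ← hy, ← hz]
    change _ = L - s 1 + (s 1 - x)
    abel

theorem exists_isIdempotentElem_sub_eq_smul {C : Type*} [Ring C] [Algebra R C] [Module.Free R C]
    [Module.Finite R C] {x : C} (hx : ∃ y, x * x - x = π • y) :
    ∃ x' : C, IsIdempotentElem x' ∧ ∃ y, x' - x = π • y := by
  obtain ⟨x', h1, h2⟩ := exists_root_of_newton (R := R) (C := C) (π := π) (p := X ^ 2 - X)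
    (q := 2 * X - 1) (v := 4 * X ^ 2 - 4 * X - 3) (by simp; ring) (x := x)
    (by simpa [sq] using hx)
  exact ⟨x', by simpa [sq, sub_eq_zero, IsIdempotentElem] using h1, h2⟩

theorem exists_pow_three_eq_one {C : Type*} [Ring C] [Algebra R C] [Module.Free R C]
    [Module.Finite R C] {t : R} (ht : 3 * t = 1) {x : C} (hx : ∃ y, x ^ 3 - 1 = π • y) :
    ∃ x' : C, x' ^ 3 = 1 ∧ ∃ y, x' - x = π • y := by
  have ht' : (3 : R[X]) * Polynomial.C t = 1 := by
    rw [← map_ofNat Polynomial.C, ← map_mul, ht, map_one]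
  obtain ⟨x', h1, h2⟩ := exists_root_of_newton (R := R) (C := C) (π := π) (p := X ^ 3 - 1)
    (q := Polynomial.C t * X)
    (v := Polynomial.C t - 1 + (Polynomial.C t - Polynomial.C t ^ 3) * (X ^ 3 - 1) -
      Polynomial.C t ^ 3 * (X ^ 3 - 1) ^ 2) (by
      simp only [sub_comp, pow_comp, X_comp, one_comp]
      linear_combination X ^ 3 * (1 - X ^ 3 + Polynomial.C t * (X ^ 3 - 1) ^ 2) * ht') (x := x)
    (by simpa using hx)
  exact ⟨x', by simpa [sub_eq_zero] using h1, h2⟩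

end Hensel

/-! ### Eigenspaces of an element of order three -/

section CubeRoot

variable {R C : Type*} [CommRing R] [Ring C] [Algebra R C]

/-- The projections to the eigenspaces of an element `c` with `c ^ 3 = 1`, where `w` is a primitive
cube root of unity and `t` is the inverse of `3`; on the image of the `i`-th one, `c` acts as
`w ^ (-i) = w ^ (2 * i)`. -/
def eigenIdempotent (w t : R) (c : C) (i : Fin 3) : C :=
  t • (1 + w ^ (i : ℕ) • c + w ^ (2 * (i : ℕ)) • c ^ 2)

theorem pow_three_eq_one_of_cyclotomic {w : R} (hw : w ^ 2 + w + 1 = 0) : w ^ 3 = 1 := by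
  linear_combination (w - 1) * hw

theorem pow_eq_pow_mod_three {w : R} (hw : w ^ 2 + w + 1 = 0) (n : ℕ) : w ^ n = w ^ (n % 3) :=
  pow_eq_pow_mod n (pow_three_eq_one_of_cyclotomic hw)

variable {w t : R} {c : C}

theorem mul_eigenIdempotent (hw : w ^ 2 + w + 1 = 0) (hc : c ^ 3 = 1) (i : Fin 3) :
    c * eigenIdempotent w t c i = w ^ (2 * (i : ℕ)) • eigenIdempotent w t c i := by
  have h1 : w ^ (2 * (i : ℕ)) * w ^ (i : ℕ) = 1 := by
    rw [← pow_add, pow_eq_pow_mod_three hw, show (2 * (i : ℕ) + i) % 3 = 0 by omega, pow_zero]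
  have h2 : (w ^ (2 * (i : ℕ))) ^ 2 = w ^ (i : ℕ) := by
    rw [← pow_mul, pow_eq_pow_mod_three hw, pow_eq_pow_mod_three hw (i : ℕ)]
    congr 1; omega
  rw [eigenIdempotent, mul_smul_comm, smul_comm _ t]
  congr 1
  simp only [mul_add, mul_one, mul_smul_comm, smul_add, ← pow_succ', hc, ← pow_two, smul_smul, h1,
    h2, one_smul]
  abel

theorem pow_mul_eigenIdempotent (hw : w ^ 2 + w + 1 = 0) (hc : c ^ 3 = 1) (i : Fin 3) (n : ℕ) :
    c ^ n * eigenIdempotent w t c i = w ^ (2 * (i : ℕ) * n) • eigenIdempotent w t c i := by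
  induction n with
  | zero => simp
  | succ n ih =>
    rw [pow_succ', mul_assoc, ih, mul_smul_comm, mul_eigenIdempotent hw hc, smul_smul, ← pow_add]
    rfl

theorem eigenIdempotent_mul_eq_self (hw : w ^ 2 + w + 1 = 0) (ht : 3 * t = 1) (hc : c ^ 3 = 1)
    {i : Fin 3} {x : C} :
    eigenIdempotent w t c i * x = x ↔ c * x = w ^ (2 * (i : ℕ)) • x := by
  constructor
  · intro h
    rw [← h, ← mul_assoc, mul_eigenIdempotent hw hc, smul_mul_assoc]
  · intro h
    have h1 : w ^ (i : ℕ) * w ^ (2 * (i : ℕ)) = 1 := by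
      rw [← pow_add, pow_eq_pow_mod_three hw, show ((i : ℕ) + 2 * i) % 3 = 0 by omega, pow_zero]
    have h2 : w ^ (2 * (i : ℕ)) * (w ^ (2 * (i : ℕ)) * w ^ (2 * (i : ℕ))) = 1 := by
      rw [← pow_add, ← pow_add, pow_eq_pow_mod_three hw,
        show (2 * (i : ℕ) + (2 * i + 2 * i)) % 3 = 0 by omega, pow_zero]
    simp only [eigenIdempotent, smul_mul_assoc, add_mul, one_mul, pow_two, mul_assoc, h,
      mul_smul_comm, smul_smul, h1, h2, one_smul]
    rw [show x + x + x = (3 : R) • x by module, smul_smul, mul_comm, ht, one_smul]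

theorem completeOrthogonalIdempotents_eigenIdempotent (hw : w ^ 2 + w + 1 = 0) (ht : 3 * t = 1)
    (hc : c ^ 3 = 1) : CompleteOrthogonalIdempotents (eigenIdempotent w t c) where
  idem i := (eigenIdempotent_mul_eq_self hw ht hc).mpr (mul_eigenIdempotent hw hc i)
  ortho i l hil := by
    have h : eigenIdempotent w t c i * eigenIdempotent w t c l =
        (t * (1 + w ^ (i : ℕ) * w ^ (2 * (l : ℕ)) +
          w ^ (2 * (i : ℕ)) * w ^ (2 * (l : ℕ) * 2))) • eigenIdempotent w t c l := by
      conv_lhs => rw [eigenIdempotent]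
      rw [smul_mul_assoc, add_mul, add_mul, one_mul, smul_mul_assoc, smul_mul_assoc,
        mul_eigenIdempotent hw hc, pow_mul_eigenIdempotent hw hc, mul_smul, add_smul, add_smul,
        one_smul, smul_smul, smul_smul]
    have h0 : 1 + w ^ (i : ℕ) * w ^ (2 * (l : ℕ)) + w ^ (2 * (i : ℕ)) * w ^ (2 * (l : ℕ) * 2) =
        0 := by
      have h3 := pow_three_eq_one_of_cyclotomic hw
      rw [← pow_add, ← pow_add, pow_eq_pow_mod_three hw, pow_eq_pow_mod_three hw (2 * _ + _)]
      fin_cases i <;> fin_cases l <;>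
        first | exact absurd rfl hil | (norm_num; linear_combination hw)
    change _ * _ = _
    rw [h, h0, mul_zero, zero_smul]
  complete := by
    have h2 : w ^ (2 * 2) = w := by rw [pow_eq_pow_mod_three hw]; norm_num
    rw [Fin.sum_univ_three]
    simp only [eigenIdempotent, Fin.val_zero, Fin.val_one, Fin.val_two, h2, pow_zero, pow_one,
      mul_zero, mul_one, one_smul]
    rw [← smul_add, ← smul_add]
    have h : (1 + c + c ^ 2) + (1 + w • c + w ^ 2 • c ^ 2) + (1 + w ^ 2 • c + w • c ^ 2) =
        (3 : R) • (1 : C) + (w ^ 2 + w + 1) • c + (w ^ 2 + w + 1) • c ^ 2 := by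
      module
    rw [h, hw, zero_smul, zero_smul, add_zero, add_zero, smul_smul, mul_comm, ht, one_smul]

end CubeRoot

/-! ### The group algebra of `Ã₄` as a skew group algebra -/

section GroupAlgebra

local notation "Q" => QuaternionGroup 2

theorem tildeA4_eq (g : TildeA4) : g = SemidirectProduct.inl g.left *
    (SemidirectProduct.inr (Multiplicative.ofAdd 1)) ^ (Multiplicative.toAdd g.right).val := by
  obtain ⟨q, m⟩ := g
  revert q m
  decide +kernel

theorem inr_mul_inl (q : Q) :
    (SemidirectProduct.inr (Multiplicative.ofAdd 1) : TildeA4) * SemidirectProduct.inl q =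
    SemidirectProduct.inl (quaternionRotation q) *
      SemidirectProduct.inr (Multiplicative.ofAdd 1) := by
  revert q
  decide +kernel

variable (R : Type*) [CommRing R]

/-- The embedding of the group algebra of `Q₈` into the one of `Ã₄`. -/
noncomputable def quaternionEmbedding : MonoidAlgebra R Q →ₐ[R] MonoidAlgebra R TildeA4 :=
  MonoidAlgebra.mapDomainAlgHom R R SemidirectProduct.inl

/-- The automorphism of order three of the group algebra of `Q₈`. -/
noncomputable def algebraRotation : MonoidAlgebra R Q →ₐ[R] MonoidAlgebra R Q :=
  MonoidAlgebra.mapDomainAlgHom R R (quaternionRotation : Q →* Q)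

/-- The generator of `C₃`, as an element of the group algebra of `Ã₄`. -/
noncomputable def cyclicGenerator : MonoidAlgebra R TildeA4 :=
  MonoidAlgebra.single (SemidirectProduct.inr (Multiplicative.ofAdd 1)) 1

@[simp] theorem quaternionEmbedding_single (q : Q) (a : R) :
    quaternionEmbedding R (MonoidAlgebra.single q a) =
    MonoidAlgebra.single (SemidirectProduct.inl q) a := by
  simp [quaternionEmbedding]

@[simp] theorem algebraRotation_single (q : Q) (a : R) :
    algebraRotation R (MonoidAlgebra.single q a) =
    MonoidAlgebra.single (quaternionRotation q) a := by
  simp [algebraRotation]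

theorem cyclicGenerator_pow_three : cyclicGenerator R ^ 3 = 1 := by
  rw [cyclicGenerator, MonoidAlgebra.single_pow, one_pow, MonoidAlgebra.one_def]
  congr 1

theorem cyclicGenerator_mul (v : MonoidAlgebra R Q) : cyclicGenerator R * quaternionEmbedding R v =
    quaternionEmbedding R (algebraRotation R v) * cyclicGenerator R := by
  induction v using MonoidAlgebra.induction_linear with
  | zero => simp
  | add x y hx hy => simp only [map_add, mul_add, add_mul, hx, hy]
  | single q a =>
    simp only [cyclicGenerator, quaternionEmbedding_single, algebraRotation_single,
      MonoidAlgebra.single_mul_single, one_mul, mul_one, inr_mul_inl]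

variable {R}

/-- The element `v` of the group algebra of `Q₈` such that `f * e = v * e`, where `e` is the `i`-th
idempotent `eigenIdempotent w t (cyclicGenerator R)`. -/
noncomputable def quaternionPart (w : R) (i : Fin 3) : MonoidAlgebra R TildeA4 →ₗ[R]
    MonoidAlgebra R Q :=
  Finsupp.linearCombination R (fun g : TildeA4 => MonoidAlgebra.single g.left
    (w ^ (2 * (i : ℕ) * (Multiplicative.toAdd g.right).val))) ∘ₗ
    (MonoidAlgebra.coeffLinearEquiv R).toLinearMap

theorem quaternionPart_single (w : R) (i : Fin 3) (g : TildeA4) (a : R) :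
    quaternionPart w i (MonoidAlgebra.single g a) = MonoidAlgebra.single g.left
      (a * w ^ (2 * (i : ℕ) * (Multiplicative.toAdd g.right).val)) := by
  simp [quaternionPart, MonoidAlgebra.coeffLinearEquiv]

variable {w t : R}

theorem mul_eigenIdempotent_eq_quaternionPart (hw : w ^ 2 + w + 1 = 0)
    (f : MonoidAlgebra R TildeA4) (i : Fin 3) :
    f * eigenIdempotent w t (cyclicGenerator R) i =
      quaternionEmbedding R (quaternionPart w i f) * eigenIdempotent w t (cyclicGenerator R) i := by
  induction f using MonoidAlgebra.induction_linear with
  | zero => simp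
  | add x y hx hy => simp only [map_add, add_mul, hx, hy]
  | single g a =>
    have h : MonoidAlgebra.single g a = quaternionEmbedding R (MonoidAlgebra.single g.left a) *
        cyclicGenerator R ^ (Multiplicative.toAdd g.right).val := by
      conv_lhs => rw [tildeA4_eq g]
      rw [quaternionEmbedding_single, cyclicGenerator, MonoidAlgebra.single_pow, one_pow,
        MonoidAlgebra.single_mul_single, mul_one]
    rw [quaternionPart_single, h, mul_assoc,
      pow_mul_eigenIdempotent hw (cyclicGenerator_pow_three R),
      mul_comm a, ← MonoidAlgebra.smul_single', map_smul, smul_mul_assoc, mul_smul_comm]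

theorem quaternionPart_mul_eigenIdempotent (hw : w ^ 2 + w + 1 = 0) (ht : 3 * t = 1)
    (v : MonoidAlgebra R Q) (i : Fin 3) :
    quaternionPart w i (quaternionEmbedding R v * eigenIdempotent w t (cyclicGenerator R) i) =
        v := by
  induction v using MonoidAlgebra.induction_linear with
  | zero => simp
  | add x y hx hy => simp only [map_add, add_mul, hx, hy]
  | single q a =>
    have h1 : w ^ (i : ℕ) * w ^ (2 * (i : ℕ) * 1) = 1 := by
      rw [← pow_add, pow_eq_pow_mod_three hw, show ((i : ℕ) + 2 * i * 1) % 3 = 0 by omega, pow_zero]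
    have h2 : w ^ (2 * (i : ℕ)) * (w ^ (2 * (i : ℕ) * 2)) = 1 := by
      rw [← pow_add, pow_eq_pow_mod_three hw,
        show (2 * (i : ℕ) + (2 * i * 2)) % 3 = 0 by omega, pow_zero]
    simp only [eigenIdempotent, cyclicGenerator, MonoidAlgebra.single_pow, mul_smul_comm, map_smul,
      mul_add, mul_one, map_add, quaternionEmbedding_single, MonoidAlgebra.single_mul_single,
      quaternionPart_single]
    have e1 : ∀ m, (SemidirectProduct.inl q * SemidirectProduct.inr m : TildeA4).left = q := by
      intro m; simp
    have e2 : (SemidirectProduct.inr (Multiplicative.ofAdd 1) ^ 2 : TildeA4) =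
      SemidirectProduct.inr (Multiplicative.ofAdd 2) := by decide +kernel
    have e3 : ∀ m, (SemidirectProduct.inl q * SemidirectProduct.inr m : TildeA4).right = m := by
      intro m; simp
    have e4 : (Multiplicative.toAdd (Multiplicative.ofAdd (2 : ZMod 3))).val = 2 := rfl
    have e5 : (Multiplicative.toAdd (Multiplicative.ofAdd (1 : ZMod 3))).val = 1 := rfl
    simp only [e1, e2, e3, e4, e5, SemidirectProduct.left_inl, SemidirectProduct.right_inl,
        toAdd_one,
      ZMod.val_zero, mul_zero, pow_zero, mul_one, one_pow, MonoidAlgebra.smul_single']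
    rw [← MonoidAlgebra.single_add, ← MonoidAlgebra.single_add, MonoidAlgebra.smul_single']
    congr 1
    rw [mul_one] at h1
    linear_combination t * a * h1 + t * a * h2 + a * ht

theorem quaternionEmbedding_mul_inj (hw : w ^ 2 + w + 1 = 0) (ht : 3 * t = 1)
    {v v' : MonoidAlgebra R Q} (i : Fin 3)
    (h : quaternionEmbedding R v * eigenIdempotent w t (cyclicGenerator R) i =
      quaternionEmbedding R v' * eigenIdempotent w t (cyclicGenerator R) i) : v = v' := by
  rw [← quaternionPart_mul_eigenIdempotent hw ht v i, h, quaternionPart_mul_eigenIdempotent hw ht]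

/-- The Peirce component of the `i`-th and the `l`-th idempotent corresponds to an eigenspace of
`algebraRotation` on the group algebra of `Q₈`. -/
theorem eigenIdempotent_mul_quaternionEmbedding_mul (hw : w ^ 2 + w + 1 = 0) (ht : 3 * t = 1)
    (v : MonoidAlgebra R Q) (i l : Fin 3) :
    eigenIdempotent w t (cyclicGenerator R) i *
      (quaternionEmbedding R v * eigenIdempotent w t (cyclicGenerator R) l) =
      quaternionEmbedding R v * eigenIdempotent w t (cyclicGenerator R) l ↔
    algebraRotation R v = w ^ (2 * (i : ℕ) + l) • v := by
  have h0 : ∀ a : R, a • (quaternionEmbedding R v * eigenIdempotent w t (cyclicGenerator R) l) =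
      quaternionEmbedding R (a • v) * eigenIdempotent w t (cyclicGenerator R) l := by
    intro a
    rw [map_smul, smul_mul_assoc]
  have h0' : cyclicGenerator R *
      (quaternionEmbedding R v * eigenIdempotent w t (cyclicGenerator R) l) =
      quaternionEmbedding R (w ^ (2 * (l : ℕ)) • algebraRotation R v) *
        eigenIdempotent w t (cyclicGenerator R) l := by
    rw [← mul_assoc, cyclicGenerator_mul, mul_assoc,
      mul_eigenIdempotent hw (cyclicGenerator_pow_three R), mul_smul_comm, map_smul, smul_mul_assoc]
  rw [eigenIdempotent_mul_eq_self hw ht (cyclicGenerator_pow_three R), h0, h0']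
  have h1 : w ^ (l : ℕ) * w ^ (2 * (l : ℕ)) = 1 := by
    rw [← pow_add, pow_eq_pow_mod_three hw, show ((l : ℕ) + 2 * l) % 3 = 0 by omega, pow_zero]
  constructor
  · intro h
    have h2 := congrArg (w ^ (l : ℕ) • ·) (quaternionEmbedding_mul_inj hw ht l h)
    simp only [smul_smul, h1, one_smul] at h2
    rw [h2, ← pow_add, add_comm]
  · intro h
    rw [h, smul_smul, add_comm, pow_add, ← mul_assoc, mul_comm (w ^ (2 * (l : ℕ))), h1, one_mul]

end GroupAlgebra

/-! ### The group algebra of `Q₈` and its automorphism of order three -/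

section QuaternionAlgebra

local notation "Q" => QuaternionGroup 2

/-- The elements of `Q₈`, sorted into the orbits of `quaternionRotation`. -/
theorem quaternion_forall {P : Q → Prop} : (∀ q, P q) ↔
    (P (.a 0) ∧ P (.a 2)) ∧ (P (.a 1) ∧ P (.xa 0) ∧ P (.xa 3)) ∧
      (P (.a 3) ∧ P (.xa 2) ∧ P (.xa 1)) := by
  constructor
  · intro h
    exact ⟨⟨h _, h _⟩, ⟨h _, h _, h _⟩, h _, h _, h _⟩
  · rintro ⟨⟨h0, h2⟩, ⟨h1, h4, h7⟩, h3, h6, h5⟩ (n | n) <;> change Fin 4 at n <;> fin_cases n <;>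
      assumption

variable {R : Type*} [CommRing R]

theorem coeff_algebraRotation (v : MonoidAlgebra R Q) (q : Q) :
    (algebraRotation R v).coeff (quaternionRotation q) = v.coeff q := by
  change (MonoidAlgebra.mapDomain _ v).coeff _ = _
  rw [MonoidAlgebra.coeff_mapDomain]
  exact Finsupp.mapDomain_apply quaternionRotation.injective _ _

theorem sum_quaternion (f : Q → R) : ∑ q, f q = f (.a 0) + f (.a 2) +
    (f (.a 1) + f (.xa 0) + f (.xa 3)) +
    (f (.a 3) + f (.xa 2) + f (.xa 1)) := by
  rw [show (Finset.univ : Finset Q) = {.a 0, .a 2, .a 1, .xa 0, .xa 3, .a 3, .xa 2,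
      .xa 1} by decide]
  repeat rw [Finset.sum_insert (by decide)]
  rw [Finset.sum_singleton]
  ring

theorem coeff_mul_quaternion (v v' : MonoidAlgebra R Q) (h : Q) :
    (v * v').coeff h = v.coeff (.a 0) * v'.coeff ((.a 0)⁻¹ * h) + v.coeff (.a 2) *
        v'.coeff ((.a 2)⁻¹ * h) +
      (v.coeff (.a 1) * v'.coeff ((.a 1)⁻¹ * h) + v.coeff (.xa 0) * v'.coeff ((.xa 0)⁻¹ * h) +
        v.coeff (.xa 3) * v'.coeff ((.xa 3)⁻¹ * h)) +
      (v.coeff (.a 3) * v'.coeff ((.a 3)⁻¹ * h) + v.coeff (.xa 2) * v'.coeff ((.xa 2)⁻¹ * h) +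
        v.coeff (.xa 1) * v'.coeff ((.xa 1)⁻¹ * h)) := by
  rw [MonoidAlgebra.coeff_mul_apply_left, Finsupp.sum_fintype _ _ (by simp), sum_quaternion]

/-- The element of the group algebra of `Q₈` with the given coefficients. -/
noncomputable def ofQuaternionCoeff (f : Q → R) : MonoidAlgebra R Q :=
  .ofCoeff (Finsupp.equivFunOnFinite.symm f)

/-- The eigenvector `i + δ ^ 2 * j + δ * k` of `algebraRotation`. -/
noncomputable def rotationEigenvector (δ : R) : MonoidAlgebra R Q :=
  ofQuaternionCoeff fun
    | .a n => ![0, 1, 0, 0] (n : Fin 4)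
    | .xa n => ![δ ^ 2, 0, 0, δ] (n : Fin 4)

/-- The element `p + q * z + (r + u * z) * (i + j + k)` of the group algebra of `Q₈`, with
`z = i ^ 2`. -/
noncomputable def rotationInvariant (p q r u : R) : MonoidAlgebra R Q :=
  ofQuaternionCoeff fun
    | .a n => ![p, r, q, u] (n : Fin 4)
    | .xa n => ![r, u, u, r] (n : Fin 4)

theorem ext_of_quaternionRotation {v v' : MonoidAlgebra R Q}
    (h : ∀ q, v.coeff (quaternionRotation q) = v'.coeff (quaternionRotation q)) : v = v' := by
  ext q
  obtain ⟨q, rfl⟩ := quaternionRotation.surjective q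
  exact h q

theorem algebraRotation_rotationEigenvector {δ : R} (hδ : δ ^ 3 = 1) :
    algebraRotation R (rotationEigenvector δ) = δ • rotationEigenvector δ := by
  apply ext_of_quaternionRotation
  intro q
  rw [coeff_algebraRotation]
  have h : 1 = δ * δ ^ 2 := by rw [← hδ]; ring
  revert q
  rw [quaternion_forall]
  exact ⟨⟨(mul_zero _).symm, (mul_zero _).symm⟩, ⟨h, pow_two δ, (mul_one δ).symm⟩,
      (mul_zero _).symm,
    (mul_zero _).symm, (mul_zero _).symm⟩

theorem algebraRotation_rotationInvariant (p q r u : R) :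
    algebraRotation R (rotationInvariant p q r u) = rotationInvariant p q r u := by
  apply ext_of_quaternionRotation
  intro q
  rw [coeff_algebraRotation]
  revert q
  rw [quaternion_forall]
  exact ⟨⟨rfl, rfl⟩, ⟨rfl, rfl, rfl⟩, rfl, rfl, rfl⟩

theorem eq_rotationInvariant {v : MonoidAlgebra R Q} (hv : algebraRotation R v = v) :
    v = rotationInvariant (v.coeff (.a 0)) (v.coeff (.a 2)) (v.coeff (.a 1)) (v.coeff (.a 3)) := by
  have h : ∀ q, v.coeff (quaternionRotation q) = v.coeff q := by
    intro q
    conv_lhs => rw [← hv]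
    exact coeff_algebraRotation v q
  have h1 : v.coeff (.xa 0) = v.coeff (.a 1) := h (.a 1)
  have h2 : v.coeff (.xa 3) = v.coeff (.xa 0) := h (.xa 0)
  have h3 : v.coeff (.xa 2) = v.coeff (.a 3) := h (.a 3)
  have h4 : v.coeff (.xa 1) = v.coeff (.xa 2) := h (.xa 2)
  ext q
  revert q
  rw [quaternion_forall]
  exact ⟨⟨rfl, rfl⟩, ⟨rfl, h1, h2.trans h1⟩, rfl, h3, h4.trans h3⟩

theorem coeff_rotationInvariant_mul (p q : R) (v : MonoidAlgebra R Q) (h : Q) :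
    (rotationInvariant p q 0 0 * v).coeff h = p * v.coeff h + q * v.coeff (.a 2 * h) := by
  rw [coeff_mul_quaternion]
  change p * v.coeff (1 * h) + q * v.coeff (.a 2 * h) + (0 * _ + 0 * _ + 0 * _) +
    (0 * _ + 0 * _ + 0 * _) = _
  rw [one_mul]
  ring

/-- For `δ ≠ 1`, the eigenspace of `algebraRotation` is generated by `rotationEigenvector δ` over
the group algebra of the center `{1, z}`. -/
theorem eq_smul_rotationEigenvector {δ : R} (hδ : δ ^ 3 = 1) (hδ' : IsUnit (δ - 1))
    {v : MonoidAlgebra R Q} (hv : algebraRotation R v = δ • v) :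
    v = rotationInvariant (v.coeff (.a 1)) (v.coeff (.a 3)) 0 0 * rotationEigenvector δ := by
  have h : ∀ q, δ * v.coeff (quaternionRotation q) = v.coeff q := by
    intro q
    rw [← coeff_algebraRotation v q, hv]
    rfl
  have h' : ∀ q, v.coeff (quaternionRotation q) = v.coeff q * δ ^ 2 := by
    intro q
    linear_combination δ ^ 2 * h q - v.coeff (quaternionRotation q) * hδ
  have h1 : v.coeff (.xa 0) = _ := h' (.a 1)
  have h2 : v.coeff (.xa 3) = _ := h' (.xa 0)
  have h3 : v.coeff (.xa 2) = _ := h' (.a 3)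
  have h4 : v.coeff (.xa 1) = _ := h' (.xa 2)
  have h5 : δ * v.coeff (.a 0) = v.coeff (.a 0) := h (.a 0)
  have h6 : δ * v.coeff (.a 2) = v.coeff (.a 2) := h (.a 2)
  have h5' : v.coeff (.a 0) = 0 := hδ'.mul_right_eq_zero.mp (by linear_combination h5)
  have h6' : v.coeff (.a 2) = 0 := hδ'.mul_right_eq_zero.mp (by linear_combination h6)
  have h7 : ∀ a : R, a * δ ^ 2 * δ ^ 2 = a * δ := fun a => by linear_combination a * δ * hδ
  rw [h1, h7] at h2
  rw [h3, h7] at h4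
  ext q
  rw [coeff_rotationInvariant_mul]
  revert q
  rw [quaternion_forall]
  refine ⟨⟨h5'.trans ?_, h6'.trans ?_⟩, ⟨?_, h1.trans ?_, h2.trans ?_⟩, ?_, h3.trans ?_,
      h4.trans ?_⟩
  · change 0 = _ * 0 + _ * 0; ring
  · change 0 = _ * 0 + _ * 0; ring
  · change _ = _ * 1 + _ * 0; ring
  · change _ = _ * δ ^ 2 + _ * 0; ring
  · change _ = _ * δ + _ * 0; ring
  · change _ = _ * 0 + _ * 1; ring
  · change _ = _ * 0 + _ * δ ^ 2; ring
  · change _ = _ * 0 + _ * δ; ring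

theorem rotationInvariant_mul (p q r u p' q' r' u' : R) :
    rotationInvariant p q r u * rotationInvariant p' q' r' u' =
      rotationInvariant (p * p' + q * q' + 3 * (r * u' + u * r'))
        (p * q' + q * p' + 3 * (r * r' + u * u'))
        (p * r' + r * p' + q * u' + u * q' + (r + u) * (r' + u'))
        (p * u' + u * p' + q * r' + r * q' + (r + u) * (r' + u')) := by
  ext h
  rw [coeff_mul_quaternion]
  revert h
  rw [quaternion_forall]
  refine ⟨⟨?_, ?_⟩, ⟨?_, ?_, ?_⟩, ?_, ?_, ?_⟩
  · change p * p' + q * q' + (r * u' + r * u' + r * u') + (u * r' + u * r' + u * r') =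
      p * p' + q * q' + 3 * (r * u' + u * r')
    ring
  · change p * q' + q * p' + (r * r' + r * r' + r * r') + (u * u' + u * u' + u * u') =
      p * q' + q * p' + 3 * (r * r' + u * u')
    ring
  · change p * r' + q * u' + (r * p' + r * r' + r * u') + (u * q' + u * u' + u * r') =
      p * r' + r * p' + q * u' + u * q' + (r + u) * (r' + u')
    ring
  · change p * r' + q * u' + (r * u' + r * p' + r * r') + (u * r' + u * q' + u * u') =
      p * r' + r * p' + q * u' + u * q' + (r + u) * (r' + u')
    ring
  · change p * r' + q * u' + (r * r' + r * u' + r * p') + (u * u' + u * r' + u * q') =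
      p * r' + r * p' + q * u' + u * q' + (r + u) * (r' + u')
    ring
  · change p * u' + q * r' + (r * q' + r * u' + r * r') + (u * p' + u * r' + u * u') =
      p * u' + u * p' + q * r' + r * q' + (r + u) * (r' + u')
    ring
  · change p * u' + q * r' + (r * r' + r * q' + r * u') + (u * u' + u * p' + u * r') =
      p * u' + u * p' + q * r' + r * q' + (r + u) * (r' + u')
    ring
  · change p * u' + q * r' + (r * u' + r * r' + r * q') + (u * r' + u * u' + u * p') =
      p * u' + u * p' + q * r' + r * q' + (r + u) * (r' + u')
    ring

theorem rotationEigenvector_mul {δ : R} (hδ : δ ^ 3 = 1) :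
    rotationEigenvector δ * rotationEigenvector (δ ^ 2) = rotationInvariant 0 3 δ (δ ^ 2) := by
  have hδ4 : (δ ^ 2) ^ 2 = δ := by linear_combination δ * hδ
  ext h
  rw [coeff_mul_quaternion]
  revert h
  rw [quaternion_forall]
  refine ⟨⟨?_, ?_⟩, ⟨?_, ?_, ?_⟩, ?_, ?_, ?_⟩
  · change 0 * 0 + 0 * 0 + (1 * 0 + δ ^ 2 * 0 + δ * 0) + (0 * _ + 0 * _ + 0 * _) = 0
    ring
  · change 0 * 0 + 0 * 0 + (1 * 1 + δ ^ 2 * (δ ^ 2) ^ 2 + δ * δ ^ 2) + (0 * _ + 0 * _ + 0 * _) = 3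
    linear_combination (2 + δ ^ 3) * hδ
  · change 0 * 1 + 0 * 0 + (1 * 0 + δ ^ 2 * δ ^ 2 + δ * 0) + (0 * _ + 0 * _ + 0 * _) = δ
    linear_combination δ * hδ
  · change 0 * _ + 0 * _ + (1 * 0 + δ ^ 2 * 0 + δ * 1) + (0 * _ + 0 * _ + 0 * _) = δ
    ring
  · change 0 * _ + 0 * _ + (1 * (δ ^ 2) ^ 2 + δ ^ 2 * 0 + δ * 0) + (0 * _ + 0 * _ + 0 * _) = δ
    linear_combination δ * hδ
  · change 0 * _ + 0 * _ + (1 * 0 + δ ^ 2 * 0 + δ * (δ ^ 2) ^ 2) + (0 * _ + 0 * _ + 0 * _) = δ ^ 2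
    linear_combination δ ^ 2 * hδ
  · change 0 * _ + 0 * _ + (1 * δ ^ 2 + δ ^ 2 * 0 + δ * 0) + (0 * _ + 0 * _ + 0 * _) = δ ^ 2
    ring
  · change 0 * _ + 0 * _ + (1 * 0 + δ ^ 2 * 1 + δ * 0) + (0 * _ + 0 * _ + 0 * _) = δ ^ 2
    ring

end QuaternionAlgebra

/-! ### The center of the group algebra of `Ã₄` -/

section Center

/-- The seven conjugacy classes of `Ã₄`, with representatives `1`, `z`, `i`, `c`, `c ^ 2`, `z * c`
and `z * c ^ 2`. -/
def classIndex (g : TildeA4) : Fin 7 :=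
  match g.left with
  | .a n => ![![0, 2, 1, 2], ![3, 5, 5, 3], ![4, 4, 6, 6]] (Multiplicative.toAdd g.right :
      Fin 3) (n : Fin 4)
  | .xa n => ![![2, 2, 2, 2], ![5, 3, 3, 5], ![4, 6, 6, 4]] (Multiplicative.toAdd g.right :
      Fin 3) (n : Fin 4)

/-- Representatives of the conjugacy classes. -/
def classRepresentative : Fin 7 → TildeA4 :=
  ![⟨.a 0, .ofAdd 0⟩, ⟨.a 2, .ofAdd 0⟩, ⟨.a 1, .ofAdd 0⟩, ⟨.a 0, .ofAdd 1⟩, ⟨.a 0, .ofAdd 2⟩,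
    ⟨.a 2, .ofAdd 1⟩, ⟨.a 2, .ofAdd 2⟩]

theorem classIndex_mul_comm (g h : TildeA4) : classIndex (g * h) = classIndex (h * g) := by
  obtain ⟨q, m⟩ := g
  obtain ⟨q', m'⟩ := h
  revert q m q' m'
  decide +kernel

theorem exists_conj_eq_classRepresentative (g : TildeA4) :
    ∃ q m, (⟨q, m⟩ : TildeA4) * classRepresentative (classIndex g) = g * ⟨q, m⟩ := by
  obtain ⟨q, m⟩ := g
  revert q m
  decide +kernel

theorem classIndex_classRepresentative (n : Fin 7) : classIndex (classRepresentative n) = n := by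
  revert n
  decide +kernel

instance : Finite TildeA4 := Finite.of_equiv _ SemidirectProduct.equivProd.symm

variable {R : Type*} [CommRing R]

/-- The combination of class sums with the given coefficients. -/
noncomputable def classFunction (a : Fin 7 → R) : MonoidAlgebra R TildeA4 :=
  .ofCoeff (Finsupp.equivFunOnFinite.symm (a ∘ classIndex))

@[simp] theorem coeff_classFunction (a : Fin 7 → R) (g : TildeA4) : (classFunction a).coeff g =
    a (classIndex g) := rfl

theorem classFunction_mem_center (a : Fin 7 → R) : classFunction a ∈ Subalgebra.center R
    (MonoidAlgebra R TildeA4) := by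
  rw [Subalgebra.mem_center_iff]
  intro f
  induction f using MonoidAlgebra.induction_linear with
  | zero => simp
  | add x y hx hy => simp only [mul_add, add_mul, hx, hy]
  | single g b =>
    ext h
    rw [MonoidAlgebra.coeff_mul_single_apply, MonoidAlgebra.coeff_single_mul_apply, mul_comm,
      coeff_classFunction, coeff_classFunction, classIndex_mul_comm]

theorem eq_classFunction {f : MonoidAlgebra R TildeA4}
    (hf : f ∈ Subalgebra.center R (MonoidAlgebra R TildeA4)) :
    f = classFunction fun n => f.coeff (classRepresentative n) := by
  ext g
  rw [coeff_classFunction]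
  obtain ⟨q, m, h⟩ := exists_conj_eq_classRepresentative g
  have h1 := congrArg (fun x => x.coeff (g * ⟨q, m⟩)) (Subalgebra.mem_center_iff.mp hf
      (MonoidAlgebra.single ⟨q, m⟩ 1))
  simp only [MonoidAlgebra.coeff_mul_single_apply, MonoidAlgebra.coeff_single_mul_apply, one_mul,
      mul_one,
    mul_inv_cancel_right] at h1
  rw [← h1, ← h, inv_mul_cancel_left]

/-- The class sums are a basis of the center of the group algebra. -/
noncomputable def classEquiv (R : Type*) [CommRing R] :
    (Fin 7 → R) ≃ₗ[R] Subalgebra.center R (MonoidAlgebra R TildeA4) where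
  toFun a := ⟨classFunction a, classFunction_mem_center a⟩
  map_add' _ _ := Subtype.ext (MonoidAlgebra.ext (Finsupp.ext fun _ => rfl))
  map_smul' _ _ := Subtype.ext (MonoidAlgebra.ext (Finsupp.ext fun _ => rfl))
  invFun f n := (f : MonoidAlgebra R TildeA4).coeff (classRepresentative n)
  left_inv a := by
    funext n
    simp [classIndex_classRepresentative]
  right_inv f := Subtype.ext (eq_classFunction f.2).symm

local notation "Q" => QuaternionGroup 2

theorem coeff_quaternionPart (w : R) (i : Fin 3) (f : MonoidAlgebra R TildeA4) (q : Q) :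
    (quaternionPart w i f).coeff q = f.coeff ⟨q, .ofAdd 0⟩ + f.coeff ⟨q, .ofAdd 1⟩ *
        w ^ (2 * (i : ℕ)) +
      f.coeff ⟨q, .ofAdd 2⟩ * w ^ (2 * (i : ℕ) * 2) := by
  induction f using MonoidAlgebra.induction_linear with
  | zero => simp
  | add x y hx hy =>
    simp only [map_add, MonoidAlgebra.coeff_add, Finsupp.add_apply, hx, hy]
    ring
  | single g b =>
    obtain ⟨q', m⟩ := g
    rw [quaternionPart_single, MonoidAlgebra.coeff_single, MonoidAlgebra.coeff_single]
    classical
    have key : ∀ m', (⟨q', m⟩ : TildeA4) = ⟨q, m'⟩ ↔ q' = q ∧ m = m' := fun m' =>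
      SemidirectProduct.ext_iff
    simp only [Finsupp.single_apply, key]
    by_cases h : q' = q
    · have hm : ∀ m : Multiplicative (ZMod 3), m = .ofAdd 0 ∨ m = .ofAdd 1 ∨ m = .ofAdd 2 := by
          decide
      have h01 : (Multiplicative.ofAdd (0 : ZMod 3)) ≠ .ofAdd 1 := by decide
      have h02 : (Multiplicative.ofAdd (0 : ZMod 3)) ≠ .ofAdd 2 := by decide
      have h12 : (Multiplicative.ofAdd (1 : ZMod 3)) ≠ .ofAdd 2 := by decide
      have v0 : (0 : ZMod 3).val = 0 := rfl
      have v1 : (1 : ZMod 3).val = 1 := rfl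
      have v2 : (2 : ZMod 3).val = 2 := rfl
      rcases hm m with rfl | rfl | rfl <;>
        simp only [h, true_and, toAdd_ofAdd, v0, v1, v2, h01, h02, h12, h01.symm, h02.symm,
            h12.symm,
          if_true, if_false, mul_zero, mul_one, pow_zero, zero_mul, zero_add, add_zero]
    · simp only [h, false_and, if_false, zero_mul, add_zero]

theorem quaternionPart_classFunction {w : R} (hw : w ^ 2 + w + 1 = 0) (i : Fin 3) (a : Fin 7 → R) :
    quaternionPart w i (classFunction a) = rotationInvariant
      (a 0 + w ^ (2 * (i : ℕ)) * a 3 + w ^ (i : ℕ) * a 4)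
      (a 1 + w ^ (2 * (i : ℕ)) * a 5 + w ^ (i : ℕ) * a 6)
      (a 2 + w ^ (2 * (i : ℕ)) * a 5 + w ^ (i : ℕ) * a 4)
      (a 2 + w ^ (2 * (i : ℕ)) * a 3 + w ^ (i : ℕ) * a 6) := by
  ext q
  have h : w ^ (2 * (i : ℕ) * 2) = w ^ (i : ℕ) := by
    rw [pow_eq_pow_mod_three hw, pow_eq_pow_mod_three hw (i : ℕ)]
    congr 1; omega
  rw [coeff_quaternionPart, h, mul_comm, mul_comm _ (w ^ (i : ℕ))]
  revert q
  rw [quaternion_forall]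
  exact ⟨⟨rfl, rfl⟩, ⟨rfl, rfl, rfl⟩, rfl, rfl, rfl⟩

end Center

/-! ### The group algebra of `Ã₄` over a field of characteristic two -/

section QuiverModel

local notation "Q" => QuaternionGroup 2

variable {k : Type*} [Field k]

/-- The idempotents `e i`, and the elements `v * e l` of the Peirce components of `e i` and `e l`,
where `v` is the eigenvector `rotationEigenvector` for the appropriate eigenvalue. -/
noncomputable def quiverArrow (w t : k) (i l : Fin 3) : MonoidAlgebra k TildeA4 :=
  if i = l then eigenIdempotent w t (cyclicGenerator k) i
  else quaternionEmbedding k (rotationEigenvector (w ^ (2 * (i : ℕ) + l))) *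
    eigenIdempotent w t (cyclicGenerator k) l

variable {w t : k}

theorem pow_mul_three_eq_one (hw : w ^ 2 + w + 1 = 0) (n : ℕ) : (w ^ n) ^ 3 = 1 := by
  rw [← pow_mul, mul_comm, pow_mul, pow_three_eq_one_of_cyclotomic hw, one_pow]

theorem ne_one_of_cyclotomic [CharP k 2] (hw : w ^ 2 + w + 1 = 0) : w ≠ 1 := by
  rintro rfl
  have h2 : (2 : k) = 0 := CharTwo.two_eq_zero
  have : (1 : k) = 0 := by linear_combination hw - h2
  exact one_ne_zero this

theorem isUnit_pow_sub_one [CharP k 2] (hw : w ^ 2 + w + 1 = 0) {i l : Fin 3} (h : i ≠ l) :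
    IsUnit (w ^ (2 * (i : ℕ) + l) - 1) := by
  rw [isUnit_iff_ne_zero, sub_ne_zero]
  have h1 := ne_one_of_cyclotomic hw
  have h2 : w ^ 2 ≠ 1 := by
    intro h2
    apply h1
    rw [← pow_three_eq_one_of_cyclotomic hw, pow_succ, h2, one_mul]
  rw [pow_eq_pow_mod_three hw]
  fin_cases i <;> fin_cases l <;> first | exact absurd rfl h | simpa using h1 | simpa using h2

theorem mem_peirce_iff (hw : w ^ 2 + w + 1 = 0) (ht : 3 * t = 1) {i l : Fin 3}
    {y : MonoidAlgebra k TildeA4} :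
    y ∈ peirceComponent k (eigenIdempotent w t (cyclicGenerator k) i) (eigenIdempotent w t
        (cyclicGenerator k) l) ↔
    ∃ v, algebraRotation k v = w ^ (2 * (i : ℕ) + l) • v ∧
      y = quaternionEmbedding k v * eigenIdempotent w t (cyclicGenerator k) l := by
  have hidem := completeOrthogonalIdempotents_eigenIdempotent hw ht (cyclicGenerator_pow_three k)
  rw [mem_peirceComponent]
  constructor
  · intro h
    have h1 : y * eigenIdempotent w t (cyclicGenerator k) l = y := by
      rw [← h, mul_assoc, hidem.idem l]
    rw [mul_eigenIdempotent_eq_quaternionPart hw] at h1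
    refine ⟨_, ?_, h1.symm⟩
    rw [← eigenIdempotent_mul_quaternionEmbedding_mul hw ht, h1, ← h, mul_assoc, ← mul_assoc _ _
        (y * _),
      hidem.idem i]
  · rintro ⟨v, hv, rfl⟩
    rw [mul_assoc, mul_assoc, hidem.idem l, eigenIdempotent_mul_quaternionEmbedding_mul hw ht, hv]

/-- The Peirce components are the eigenspaces of `algebraRotation` by `mem_peirce_iff`. They have
dimension four for the eigenvalue `1` and two for the others, and the center acts on them through
`quaternionPart`. -/
theorem isQuiverModel_groupAlgebra [CharP k 2] (hw : w ^ 2 + w + 1 = 0) (ht : 3 * t = 1) :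
    IsQuiverModel k (eigenIdempotent w t (cyclicGenerator k)) (quiverArrow w t) where
  idem := completeOrthogonalIdempotents_eigenIdempotent hw ht (cyclicGenerator_pow_three k)
  diag i := if_pos rfl
  mem i l := by
    rw [mem_peirce_iff hw ht, quiverArrow]
    split_ifs with h
    · subst h
      refine ⟨rotationInvariant 1 0 0 0, ?_, ?_⟩
      · rw [algebraRotation_rotationInvariant, pow_eq_pow_mod_three hw,
          show (2 * (i : ℕ) + i) % 3 = 0 by omega, pow_zero, one_smul]
      · have : rotationInvariant (1 : k) 0 0 0 = 1 := by
          ext q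
          revert q
          rw [quaternion_forall, MonoidAlgebra.one_def]
          simp only [MonoidAlgebra.coeff_single, Finsupp.single_apply]
          exact ⟨⟨rfl, rfl⟩, ⟨rfl, rfl, rfl⟩, rfl, rfl, rfl⟩
        rw [this, map_one, one_mul]
    · exact ⟨_, algebraRotation_rotationEigenvector (pow_mul_three_eq_one hw _), rfl⟩
  gen i l y hy := by
    have hidem := completeOrthogonalIdempotents_eigenIdempotent hw ht (cyclicGenerator_pow_three k)
    obtain ⟨v, hv, rfl⟩ := (mem_peirce_iff hw ht).mp hy
    rw [quiverArrow]
    split_ifs with h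
    · subst h
      rw [pow_eq_pow_mod_three hw, show (2 * (i : ℕ) + i) % 3 = 0 by omega, pow_zero,
          one_smul] at hv
      have h1 : w ^ (2 * (i : ℕ)) * w ^ (i : ℕ) = 1 := by
        rw [← pow_add, pow_eq_pow_mod_three hw, show (2 * (i : ℕ) + i) % 3 = 0 by omega, pow_zero]
      generalize v.coeff (.a 0) = p, v.coeff (.a 2) = q, v.coeff (.a 1) = r, v.coeff (.a 3) = u,
        eq_rotationInvariant hv = hv'
      refine ⟨classFunction ![p - u, q - r, 0, u * w ^ (i : ℕ), 0, r * w ^ (i : ℕ), 0],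
        classFunction_mem_center _, ?_⟩
      rw [mul_eigenIdempotent_eq_quaternionPart hw (classFunction _),
          quaternionPart_classFunction hw, hv']
      congr 3
      · change p = p - u + _ * (u * _) + _ * 0
        linear_combination -u * h1
      · change q = q - r + _ * (r * _) + _ * 0
        linear_combination -r * h1
      · change r = 0 + _ * (r * _) + _ * 0
        linear_combination -r * h1
      · change u = 0 + _ * (u * _) + _ * 0
        linear_combination -u * h1
    · have hδ := pow_mul_three_eq_one hw (2 * (i : ℕ) + l)
      have hv' := eq_smul_rotationEigenvector hδ (isUnit_pow_sub_one hw h) hv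
      refine ⟨classFunction ![v.coeff (.a 1), v.coeff (.a 3), 0, 0, 0, 0, 0],
        classFunction_mem_center _, ?_⟩
      rw [← (eigenIdempotent_mul_quaternionEmbedding_mul hw ht _ i l).mpr
        (algebraRotation_rotationEigenvector hδ), ← mul_assoc,
        mul_eigenIdempotent_eq_quaternionPart hw (classFunction _),
        quaternionPart_classFunction hw, mul_assoc,
            (eigenIdempotent_mul_quaternionEmbedding_mul hw ht _ i l).mpr
        (algebraRotation_rotationEigenvector hδ), ← mul_assoc, ← map_mul]
      conv_lhs => rw [hv']
      congr 4
      · change _ = v.coeff (.a 1) + _ * 0 + _ * 0; ring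
      · change _ = v.coeff (.a 3) + _ * 0 + _ * 0; ring
      · change _ = 0 + _ * 0 + _ * 0; ring
      · change _ = 0 + _ * 0 + _ * 0; ring
  sq_ne i l h := by
    have hδ := pow_mul_three_eq_one hw (2 * (i : ℕ) + l)
    have h2 : w ^ (2 * (l : ℕ) + i) = (w ^ (2 * (i : ℕ) + l)) ^ 2 := by
      rw [← pow_mul, pow_eq_pow_mod_three hw, pow_eq_pow_mod_three hw (_ * 2)]
      congr 1; omega
    rw [quiverArrow, quiverArrow, if_neg h, if_neg h.symm, mul_assoc,
      (eigenIdempotent_mul_quaternionEmbedding_mul hw ht _ l i).mpr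
        (algebraRotation_rotationEigenvector (pow_mul_three_eq_one hw _)), ← mul_assoc, ← map_mul,
            h2,
      rotationEigenvector_mul hδ, pow_two, mul_assoc,
      (eigenIdempotent_mul_quaternionEmbedding_mul hw ht _ i i).mpr, ← mul_assoc, ← map_mul,
      rotationInvariant_mul]
    · intro h0
      have h1 := congrArg (fun v => (quaternionPart w i v).coeff (.a 0)) h0
      simp only [quaternionPart_mul_eigenIdempotent hw ht, map_zero] at h1
      change 0 * 0 + 3 * 3 + 3 * (_ * _ ^ 2 + _ ^ 2 * _) = (0 : k) at h1
      have h2 : (2 : k) = 0 := CharTwo.two_eq_zero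
      have h3 : (1 : k) = 0 := by linear_combination h1 - 6 * hδ - 7 * h2
      exact one_ne_zero h3
    · rw [algebraRotation_rotationInvariant, pow_eq_pow_mod_three hw (2 * (i : ℕ) + i),
        show (2 * (i : ℕ) + i) % 3 = 0 by omega, pow_zero, one_smul]
  finrank i l := by
    let ρ : MonoidAlgebra k Q →ₗ[k] MonoidAlgebra k TildeA4 :=
      LinearMap.mulRight k (eigenIdempotent w t (cyclicGenerator k) l) ∘ₗ
        (quaternionEmbedding k).toLinearMap
    have hρ : Function.Injective ρ := fun v v' h => quaternionEmbedding_mul_inj hw ht l h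
    let Λ : (Fin 4 → k) →ₗ[k] MonoidAlgebra k Q :=
      { toFun a := rotationInvariant (a 0) (a 1) (a 2) (a 3)
        map_add' a a' := by
          ext q
          revert q
          rw [quaternion_forall]
          exact ⟨⟨rfl, rfl⟩, ⟨rfl, rfl, rfl⟩, rfl, rfl, rfl⟩
        map_smul' c a := by
          ext q
          revert q
          rw [quaternion_forall]
          exact ⟨⟨rfl, rfl⟩, ⟨rfl, rfl, rfl⟩, rfl, rfl, rfl⟩ }
    have hcoeff : ∀ a, (Λ a).coeff (.a 0) = a 0 ∧ (Λ a).coeff (.a 2) = a 1 ∧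
        (Λ a).coeff (.a 1) = a 2 ∧ (Λ a).coeff (.a 3) = a 3 := fun a => ⟨rfl, rfl, rfl, rfl⟩
    by_cases h : i = l
    · subst h
      have hΛ : Function.Injective Λ := by
        intro a a' h
        obtain ⟨h0, h1, h2, h3⟩ := hcoeff a
        rw [h] at h0 h1 h2 h3
        funext x
        fin_cases x
        exacts [h0.symm, h1.symm, h2.symm, h3.symm]
      have hr : LinearMap.range (ρ ∘ₗ Λ) =
          peirceComponent k (eigenIdempotent w t (cyclicGenerator k) i)
            (eigenIdempotent w t (cyclicGenerator k) i) := by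
        ext y
        rw [mem_peirce_iff hw ht, pow_eq_pow_mod_three hw, show (2 * (i : ℕ) + i) % 3 = 0 by omega,
          pow_zero]
        simp only [one_smul, LinearMap.mem_range]
        constructor
        · rintro ⟨a, rfl⟩
          exact ⟨Λ a, algebraRotation_rotationInvariant _ _ _ _, rfl⟩
        · rintro ⟨v, hv, rfl⟩
          refine ⟨![v.coeff (.a 0), v.coeff (.a 2), v.coeff (.a 1), v.coeff (.a 3)], ?_⟩
          exact congrArg ρ (eq_rotationInvariant hv).symm
      rw [← hr, LinearMap.finrank_range_of_inj (f := ρ ∘ₗ Λ) (hρ.comp hΛ), Module.finrank_fin_fun]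
      fin_cases i <;> rfl
    · have hδ := pow_mul_three_eq_one hw (2 * (i : ℕ) + l)
      let Λ' : (Fin 2 → k) →ₗ[k] MonoidAlgebra k Q :=
        LinearMap.mulRight k (rotationEigenvector (w ^ (2 * (i : ℕ) + l))) ∘ₗ Λ ∘ₗ
          LinearMap.pi ![LinearMap.proj 0, LinearMap.proj 1, 0, 0]
      have hΛ' : ∀ a, Λ' a = rotationInvariant (a 0) (a 1) 0 0 *
          rotationEigenvector (w ^ (2 * (i : ℕ) + l)) := fun a => rfl
      have hΛ : Function.Injective Λ' := by
        have h1 : ∀ a, (Λ' a).coeff (.a 1) = a 0 * 1 + a 1 * 0 := fun a => by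
          rw [hΛ', coeff_rotationInvariant_mul]; rfl
        have h3 : ∀ a, (Λ' a).coeff (.a 3) = a 0 * 0 + a 1 * 1 := fun a => by
          rw [hΛ', coeff_rotationInvariant_mul]; rfl
        intro a a' h
        have h1' := h1 a
        have h3' := h3 a
        rw [h, h1] at h1'
        rw [h, h3] at h3'
        funext x
        fin_cases x
        · change a 0 = a' 0
          linear_combination -h1'
        · change a 1 = a' 1
          linear_combination -h3'
      have hr : LinearMap.range (ρ ∘ₗ Λ') =
          peirceComponent k (eigenIdempotent w t (cyclicGenerator k) i)
            (eigenIdempotent w t (cyclicGenerator k) l) := by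
        ext y
        rw [mem_peirce_iff hw ht]
        simp only [LinearMap.mem_range]
        constructor
        · rintro ⟨a, rfl⟩
          refine ⟨Λ' a, ?_, rfl⟩
          rw [hΛ', map_mul, algebraRotation_rotationInvariant,
              algebraRotation_rotationEigenvector hδ,
            mul_smul_comm]
        · rintro ⟨v, hv, rfl⟩
          refine ⟨![v.coeff (.a 1), v.coeff (.a 3)], ?_⟩
          exact congrArg ρ (eq_smul_rotationEigenvector hδ (isUnit_pow_sub_one hw h) hv).symm
      rw [← hr, LinearMap.finrank_range_of_inj (f := ρ ∘ₗ Λ') (hρ.comp hΛ), Module.finrank_fin_fun]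
      fin_cases i <;> fin_cases l <;> first | exact absurd rfl h | rfl
  center_finite := Module.Finite.equiv (classEquiv k)
  center_finrank := by
    rw [← (classEquiv k).finrank_eq, Module.finrank_fin_fun]

end QuiverModel

/-! ### The central characters -/

section CenterIso

local notation "Q" => QuaternionGroup 2

variable {R : Type*} [CommRing R]

/-- For `α ^ 2 = 1` and `β ^ 2 = 3 * α + β + α * β`, this is a ring homomorphism on the elements
`rotationInvariant p q r u`; it maps `z` to `α` and `i + j + k` to `β`. -/
def invariantValue (α β : R) (v : MonoidAlgebra R Q) : R :=
  v.coeff (.a 0) + α * v.coeff (.a 2) + β * (v.coeff (.a 1) + α * v.coeff (.a 3))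

theorem invariantValue_rotationInvariant (α β p q r u : R) :
    invariantValue α β (rotationInvariant p q r u) = p + α * q + β * (r + α * u) := rfl

theorem quaternionPart_mul {w t : R} (hw : w ^ 2 + w + 1 = 0) (ht : 3 * t = 1) (i : Fin 3)
    {f : MonoidAlgebra R TildeA4} (f' : MonoidAlgebra R TildeA4)
    (hf' : f' ∈ Subalgebra.center R (MonoidAlgebra R TildeA4)) :
    quaternionPart w i (f * f') = quaternionPart w i f * quaternionPart w i f' := by
  apply quaternionEmbedding_mul_inj hw ht i
  rw [← mul_eigenIdempotent_eq_quaternionPart hw, map_mul, mul_assoc (quaternionEmbedding R _),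
    ← mul_eigenIdempotent_eq_quaternionPart hw f', Subalgebra.mem_center_iff.mp hf', mul_assoc,
    mul_eigenIdempotent_eq_quaternionPart hw f, ← mul_assoc, ← mul_assoc,
    Subalgebra.mem_center_iff.mp hf']

theorem invariantValue_quaternionPart_mul {w t : R} (hw : w ^ 2 + w + 1 = 0) (ht : 3 * t = 1)
    (i : Fin 3)
    {α β : R} (hα : α ^ 2 = 1) (hβ : β ^ 2 = 3 * α + β + α * β)
    {f f' : MonoidAlgebra R TildeA4} (hf : f ∈ Subalgebra.center R (MonoidAlgebra R TildeA4))
    (hf' : f' ∈ Subalgebra.center R (MonoidAlgebra R TildeA4)) :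
    invariantValue α β (quaternionPart w i (f * f')) =
      invariantValue α β (quaternionPart w i f) * invariantValue α β (quaternionPart w i f') := by
  rw [quaternionPart_mul hw ht i f' hf', eq_classFunction hf, eq_classFunction hf',
    quaternionPart_classFunction hw, quaternionPart_classFunction hw, rotationInvariant_mul]
  simp only [invariantValue_rotationInvariant]
  generalize f.coeff (classRepresentative 0) + w ^ (2 * (i : ℕ)) * f.coeff (classRepresentative 3) +
      w ^ (i : ℕ) * f.coeff (classRepresentative 4) = p,
    f.coeff (classRepresentative 1) + w ^ (2 * (i : ℕ)) * f.coeff (classRepresentative 5) +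
      w ^ (i : ℕ) * f.coeff (classRepresentative 6) = q,
    f.coeff (classRepresentative 2) + w ^ (2 * (i : ℕ)) * f.coeff (classRepresentative 5) +
      w ^ (i : ℕ) * f.coeff (classRepresentative 4) = r,
    f.coeff (classRepresentative 2) + w ^ (2 * (i : ℕ)) * f.coeff (classRepresentative 3) +
      w ^ (i : ℕ) * f.coeff (classRepresentative 6) = u,
    f'.coeff (classRepresentative 0) + w ^ (2 * (i : ℕ)) * f'.coeff (classRepresentative 3) +
      w ^ (i : ℕ) * f'.coeff (classRepresentative 4) = p',
    f'.coeff (classRepresentative 1) + w ^ (2 * (i : ℕ)) * f'.coeff (classRepresentative 5) +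
      w ^ (i : ℕ) * f'.coeff (classRepresentative 6) = q',
    f'.coeff (classRepresentative 2) + w ^ (2 * (i : ℕ)) * f'.coeff (classRepresentative 5) +
      w ^ (i : ℕ) * f'.coeff (classRepresentative 4) = r',
    f'.coeff (classRepresentative 2) + w ^ (2 * (i : ℕ)) * f'.coeff (classRepresentative 3) +
      w ^ (i : ℕ) * f'.coeff (classRepresentative 6) = u'
  grind

/-- The coordinates in `centerOrder R` of the central element with coefficients `a` on the conjugacy
classes. -/
def classParameters (w : R) : (Fin 7 → R) →ₗ[R] (Fin 7 → R) where
  toFun a := ![a 0 + a 1 - 2 * a 2,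
    a 2 - a 1 - (a 3 - a 5) - (a 4 - a 6),
    a 2 - a 1 - w ^ 2 * (a 3 - a 5) - w * (a 4 - a 6),
    a 2 - a 1 - w * (a 3 - a 5) - w ^ 2 * (a 4 - a 6),
    a 1 + a 5 + a 6,
    a 1 + w ^ 2 * a 5 + w * a 6,
    a 1 + w * a 5 + w ^ 2 * a 6]
  map_add' a b := by
    funext n
    fin_cases n <;> simp <;> ring
  map_smul' c a := by
    funext n
    fin_cases n <;> simp <;> ring

/-- The inverse is the Fourier inversion on the cyclic group of order three. -/
theorem classParameters_bijective {w t : R} (hw : w ^ 2 + w + 1 = 0) (ht : 3 * t = 1) :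
    Function.Bijective (classParameters w) := by
  rw [Function.bijective_iff_has_inverse]
  refine ⟨fun g => ![g 0 - t * (g 4 + g 5 + g 6) + 2 *
      (t * (g 1 + g 2 + g 3) + t * (g 4 + g 5 + g 6)),
    t * (g 4 + g 5 + g 6), t * (g 1 + g 2 + g 3) + t * (g 4 + g 5 + g 6),
    t * (g 4 + w * g 5 + w ^ 2 * g 6) - t * (g 1 + w * g 2 + w ^ 2 * g 3),
    t * (g 4 + w ^ 2 * g 5 + w * g 6) - t * (g 1 + w ^ 2 * g 2 + w * g 3),
    t * (g 4 + w * g 5 + w ^ 2 * g 6), t * (g 4 + w ^ 2 * g 5 + w * g 6)], fun a => ?_, fun g => ?_⟩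
  · funext n
    fin_cases n <;> simp [classParameters] <;> grind
  · funext n
    fin_cases n <;> simp [classParameters] <;> grind

/-- The values of the seven central characters. By `classValues_apply`, they are obtained by
projecting to the Peirce component of one of the three idempotents, and applying a character of the
ring of elements `rotationInvariant p q r u`. -/
noncomputable def classValues (w : R) : Subalgebra.center R (MonoidAlgebra R TildeA4) →ₗ[R]
    (Fin 7 → R) where
  toFun f := centerVec (classParameters w ((classEquiv R).symm f))
  map_add' f f' := by rw [map_add, map_add, centerVec_add]
  map_smul' c f := by rw [map_smul, map_smul, centerVec_smul]; rfl

theorem classValues_apply {w : R} (hw : w ^ 2 + w + 1 = 0)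
    (f : Subalgebra.center R (MonoidAlgebra R TildeA4)) :
    classValues w f = ![invariantValue 1 (-1) (quaternionPart w 0 f),
      invariantValue 1 3 (quaternionPart w 0 f), invariantValue 1 3 (quaternionPart w 1 f),
      invariantValue 1 3 (quaternionPart w 2 f), invariantValue (-1) (2 * w +
          1) (quaternionPart w 1 f),
      invariantValue (-1) (2 * w + 1) (quaternionPart w 2 f),
      invariantValue (-1) (2 * w + 1) (quaternionPart w 0 f)] := by
  obtain ⟨a, rfl⟩ := (classEquiv R).surjective f
  have h : ((classEquiv R a : Subalgebra.center R (MonoidAlgebra R TildeA4)) :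
      MonoidAlgebra R TildeA4) = classFunction a := rfl
  rw [h]
  simp only [quaternionPart_classFunction hw, invariantValue_rotationInvariant]
  change centerVec (classParameters w ((classEquiv R).symm _)) = _
  rw [LinearEquiv.symm_apply_apply]
  funext n
  fin_cases n <;> simp [classParameters, centerVec] <;> grind

/-- The seven central characters, as an algebra homomorphism. -/
noncomputable def classCharacters {w t : R} (hw : w ^ 2 + w + 1 = 0) (ht : 3 * t = 1) :
    Subalgebra.center R (MonoidAlgebra R TildeA4) →ₐ[R] (Fin 7 → R) :=
  AlgHom.ofLinearMap (classValues w) (by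
      rw [classValues_apply hw]
      have h : ∀ i, quaternionPart w i ((1 : Subalgebra.center R (MonoidAlgebra R TildeA4)) :
          MonoidAlgebra R TildeA4) =
          rotationInvariant 1 0 0 0 := by
        intro i
        change quaternionPart w i (MonoidAlgebra.single 1 1) = _
        rw [quaternionPart_single]
        ext q
        have h1 : (1 : R) * w ^ (2 * (i : ℕ) * (Multiplicative.toAdd (1 : TildeA4).right).val) =
            1 := by
          change 1 * w ^ (2 * (i : ℕ) * 0) = 1
          rw [mul_zero, pow_zero, one_mul]
        rw [h1]
        revert q
        rw [quaternion_forall]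
        simp only [MonoidAlgebra.coeff_single, Finsupp.single_apply]
        exact ⟨⟨rfl, rfl⟩, ⟨rfl, rfl, rfl⟩, rfl, rfl, rfl⟩
      simp only [h, invariantValue_rotationInvariant]
      funext n
      fin_cases n <;> simp)
    (by
      intro f f'
      have hX : (-1 : R) ^ 2 = 3 * 1 + (-1) + 1 * (-1) := by ring
      have hA : (3 : R) ^ 2 = 3 * 1 + 3 + 1 * 3 := by ring
      have hB : (2 * w + 1) ^ 2 = 3 * (-1) + (2 * w + 1) + (-1) * (2 * w + 1) := by
        linear_combination 4 * hw
      have h1 : (1 : R) ^ 2 = 1 := one_pow 2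
      have h2 : (-1 : R) ^ 2 = 1 := by ring
      simp only [classValues_apply hw]
      rw [show ((f * f' : Subalgebra.center R (MonoidAlgebra R TildeA4)) :
          MonoidAlgebra R TildeA4) = f * f' from rfl]
      simp only [invariantValue_quaternionPart_mul hw ht _ h1 hX f.2 f'.2,
        invariantValue_quaternionPart_mul hw ht _ h1 hA f.2 f'.2,
        invariantValue_quaternionPart_mul hw ht _ h2 hB f.2 f'.2]
      funext n
      fin_cases n <;> rfl)

/-- The central characters identify the center of the group algebra with `centerOrder R`. -/
theorem exists_center_algEquiv [IsDomain R] [CharZero R] {w t : R} (hw : w ^ 2 + w + 1 = 0)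
    (ht : 3 * t = 1) :
    Nonempty (Subalgebra.center R (MonoidAlgebra R TildeA4) ≃ₐ[R] centerOrder R) := by
  have hval : ∀ f, classCharacters hw ht f =
      centerVec (classParameters w ((classEquiv R).symm f)) := fun f => rfl
  have hinj : Function.Injective (classCharacters hw ht) := by
    intro f f' h
    rw [hval, hval] at h
    exact (classEquiv R).symm.injective ((classParameters_bijective hw ht).injective
        (centerVec_injective h))
  have hrange : (classCharacters hw ht).range = centerOrder R := by
    ext x
    constructor
    · rintro ⟨f, rfl⟩
      exact centerVec_mem _
    · rintro ⟨g, rfl⟩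
      obtain ⟨a, rfl⟩ := (classParameters_bijective hw ht).surjective g
      refine ⟨classEquiv R a, ?_⟩
      change classCharacters hw ht _ = _
      rw [hval, LinearEquiv.symm_apply_apply]
  exact ⟨(AlgEquiv.ofInjective _ hinj).trans (Subalgebra.equivOfEq _ _ hrange)⟩

end CenterIso

/-! ### Reduction of the group algebra -/

section Reduction

variable {R k : Type*} [CommRing R] [Field k] [Algebra R k]

/-- Reduction of the coefficients of the elements of the group algebra. -/
noncomputable def groupAlgebraReduction (R k : Type*) [CommRing R] [Field k] [Algebra R k] :
    MonoidAlgebra R TildeA4 →ₐ[R] MonoidAlgebra k TildeA4 :=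
  MonoidAlgebra.mapAlgHom TildeA4 (Algebra.ofId R k)

theorem isReduction_groupAlgebraReduction {π : R} (hk : Function.Surjective (algebraMap R k))
    (hπ : ∀ a, algebraMap R k a = 0 ↔ π ∣ a) : IsReduction π (groupAlgebraReduction R k) where
  surjective f := by
    choose g hg using fun x => hk (f.coeff x)
    refine ⟨.ofCoeff (Finsupp.equivFunOnFinite.symm g), ?_⟩
    ext x
    rw [groupAlgebraReduction, MonoidAlgebra.coeff_mapAlgHom]
    exact hg x
  ker f hf := by
    have h : ∀ x, π ∣ f.coeff x := by
      intro x
      rw [← hπ]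
      have := congrArg (fun v => v.coeff x) hf
      rw [groupAlgebraReduction, MonoidAlgebra.coeff_mapAlgHom] at this
      exact this
    choose g hg using h
    exact ⟨.ofCoeff (Finsupp.equivFunOnFinite.symm g), MonoidAlgebra.ext (Finsupp.ext hg)⟩

theorem groupAlgebraReduction_eigenIdempotent (w t : R) (i : Fin 3) :
    groupAlgebraReduction R k (eigenIdempotent w t (cyclicGenerator R) i) =
      eigenIdempotent (algebraMap R k w) (algebraMap R k t) (cyclicGenerator k) i := by
  have h : groupAlgebraReduction R k (cyclicGenerator R) = cyclicGenerator k := by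
    simp [groupAlgebraReduction, cyclicGenerator]
  simp only [eigenIdempotent, map_smul, map_add, map_one, map_pow, h]
  simp only [← map_pow, algebraMap_smul]

theorem isCentralOrder_of_center_algEquiv [IsDomain R] {C B : Type*} [Ring C] [Algebra R C]
    [Module.Free R C]
    [Ring B] [Algebra R B] {π : R} (hπ0 : π ≠ 0) {r : C →ₐ[R] B} (hr : IsReduction π r)
    (ψ : centerOrder R ≃ₐ[R] Subalgebra.center R C) :
    IsCentralOrder π r ((Subalgebra.center R C).val.comp ψ.toAlgHom) where
  commute s x := (Subalgebra.mem_center_iff.mp (ψ s).2 x).symm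
  injective := Subtype.val_injective.comp ψ.injective
  pure s hs := by
    obtain ⟨y, hy⟩ := hr.ker _ hs
    have hy' : (ψ s : C) = π • y := hy
    have hyc : y ∈ Subalgebra.center R C := by
      rw [Subalgebra.mem_center_iff]
      intro x
      have h := Subalgebra.mem_center_iff.mp (ψ s).2 x
      rw [hy', mul_smul_comm, smul_mul_assoc] at h
      exact smul_right_injective C hπ0 h
    refine ⟨ψ.symm ⟨y, hyc⟩, ψ.injective ?_⟩
    rw [map_smul, AlgEquiv.apply_symm_apply]
    exact Subtype.ext hy'

end Reduction

/-! ### Full corners and Morita equivalence -/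

/-- `C` is identified by `ι` with the corner `e S e` of `S`, where `e = ι 1` is an idempotent with
`S e S = S`. -/
structure IsFullCorner {R C S : Type*} [CommRing R] [Ring C] [Ring S] [Algebra R C] [Algebra R S]
    (ι : C →ₗ[R] S) : Prop where
  map_mul : ∀ a b, ι (a * b) = ι a * ι b
  injective : Function.Injective ι
  exists_map_eq : ∀ x, ∃ c, ι c = ι 1 * x * ι 1
  full : ∃ (n : ℕ) (x y : Fin n → S), ∑ s, x s * ι 1 * y s = 1

namespace IsFullCorner

open CategoryTheory

theorem one_mul_map {R C S : Type*} [CommRing R] [Ring C] [Ring S]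
    [Algebra R C] [Algebra R S] {ι : C →ₗ[R] S} (h : IsFullCorner ι) (c : C) : ι 1 * ι c =
        ι c := by rw [← h.map_mul, one_mul]

theorem map_mul_one {R C S : Type*} [CommRing R] [Ring C] [Ring S]
    [Algebra R C] [Algebra R S] {ι : C →ₗ[R] S} (h : IsFullCorner ι) (c : C) : ι c * ι 1 =
        ι c := by rw [← h.map_mul, mul_one]

variable {R C S : Type u} [CommRing R] [Ring C] [Ring S] [Algebra R C] [Algebra R S]
  {ι : C →ₗ[R] S}

/-- The additive group `e M`, for `e = ι 1`. -/
def fixedSubgroup (ι : C →ₗ[R] S) (M : Type u) [AddCommGroup M] [Module S M] : AddSubgroup M where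
  carrier := {m | ι 1 • m = m}
  zero_mem' := smul_zero _
  add_mem' {a b} ha hb := by
    change _ • _ = _
    rw [smul_add, show ι 1 • a = a from ha, show ι 1 • b = b from hb]
  neg_mem' {a} ha := by
    change _ • _ = _
    rw [smul_neg, show ι 1 • a = a from ha]

/-- The action of the corner on `e M`. -/
@[reducible] def fixedModule (h : IsFullCorner ι) (M : Type u) [AddCommGroup M] [Module S M] :
    Module C (fixedSubgroup ι M) where
  smul c m := ⟨ι c • (m : M), by
    change ι 1 • ι c • (m : M) = _
    rw [smul_smul, h.one_mul_map]⟩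
  one_smul m := Subtype.ext m.2
  mul_smul a b m := Subtype.ext (by
    change ι (a * b) • (m : M) = ι a • ι b • (m : M)
    rw [h.map_mul, mul_smul])
  smul_zero a := Subtype.ext (smul_zero (ι a))
  smul_add a m n := Subtype.ext (smul_add (ι a) (m : M) n)
  add_smul a b m := Subtype.ext (by
    change ι (a + b) • (m : M) = ι a • (m : M) + ι b • (m : M)
    rw [map_add, add_smul])
  zero_smul m := Subtype.ext (by
    change ι 0 • (m : M) = 0
    rw [map_zero, zero_smul])

/-- The functor `M ↦ e M` from the modules over an algebra to the modules over its corner. -/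
def fixedFunctor (h : IsFullCorner ι) : ModuleCat.{u} S ⥤ ModuleCat.{u} C where
  obj M :=
    letI := h.fixedModule M
    ModuleCat.of C (fixedSubgroup ι M)
  map {M N} f :=
    letI := h.fixedModule M
    letI := h.fixedModule N
    ModuleCat.ofHom
      { toFun m := ⟨f.hom m, by
          change ι 1 • f.hom m = _
          rw [← map_smul, show ι 1 • (m : M) = m from m.2]⟩
        map_add' m n := Subtype.ext (map_add f.hom (m : M) n)
        map_smul' c m := Subtype.ext (map_smul f.hom (ι c) (m : M)) }

theorem smul_mem_fixedSubgroup (h : IsFullCorner ι) (M : Type u) [AddCommGroup M] [Module S M]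
    (m : M) :
    ι 1 • m ∈ fixedSubgroup ι M := by
  change ι 1 • ι 1 • m = _
  rw [smul_smul, h.one_mul_map]

instance (h : IsFullCorner ι) : h.fixedFunctor.Faithful where
  map_injective {M N} f g hfg := by
    obtain ⟨n, x, y, hxy⟩ := h.full
    ext m
    have key : ∀ m : M, f.hom (ι 1 • m) = g.hom (ι 1 • m) := by
      intro m
      have := congrArg (fun q : h.fixedFunctor.obj M ⟶ h.fixedFunctor.obj N =>
        (q.hom ⟨ι 1 • m, h.smul_mem_fixedSubgroup M m⟩ : fixedSubgroup ι N).1) hfg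
      exact this
    have hm : m = ∑ s, x s • ι 1 • y s • m := by
      simp only [smul_smul, ← Finset.sum_smul, hxy, one_smul, ← mul_assoc]
    rw [hm, map_sum, map_sum]
    refine Finset.sum_congr rfl fun s _ => ?_
    rw [map_smul, key, ← map_smul]

instance (h : IsFullCorner ι) : h.fixedFunctor.Full where
  map_surjective {M N} g := by
    obtain ⟨n, x, y, hxy⟩ := h.full
    choose κ hκ using h.exists_map_eq
    let := h.fixedModule M
    let := h.fixedModule N
    let g' : fixedSubgroup ι M →ₗ[C] fixedSubgroup ι N := g.hom
    let G : M → N := fun m => (g' ⟨ι 1 • m, h.smul_mem_fixedSubgroup M m⟩).1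
    have Gadd : ∀ m m', G (m + m') = G m + G m' := by
      intro m m'
      change _ = (g' _ + g' _ : fixedSubgroup ι N).1
      rw [← map_add]
      exact congrArg (fun q => (g' q).1) (Subtype.ext (smul_add _ _ _))
    have Gmul : ∀ (a : S) (m : M), G (a • ι 1 • m) = ι 1 • a • G m := by
      intro a m
      have h1 : G (a • ι 1 • m) = (κ a • g' ⟨ι 1 • m, h.smul_mem_fixedSubgroup M m⟩).1 := by
        rw [← map_smul]
        refine congrArg (fun q => (g' q).1) (Subtype.ext ?_)
        change ι 1 • a • ι 1 • m = ι (κ a) • ι 1 • m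
        rw [hκ, smul_smul, smul_smul, smul_smul, mul_assoc _ (ι 1) (ι 1), h.one_mul_map]
      rw [h1]
      change ι (κ a) • G m = _
      rw [hκ, mul_assoc, mul_smul, mul_smul]
      congr 2
      exact (g' _).2
    have Gfix : ∀ m, ι 1 • G m = G m := fun m => (g' _).2
    have hsum : ∀ m : M, m = ∑ s, x s • ι 1 • y s • m := by
      intro m
      simp only [smul_smul, ← Finset.sum_smul, hxy, one_smul, ← mul_assoc]
    have hsum' : ∀ m : N, m = ∑ s, x s • ι 1 • y s • m := by
      intro m
      simp only [smul_smul, ← Finset.sum_smul, hxy, one_smul, ← mul_assoc]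
    let Ghom : M →+ N := AddMonoidHom.mk' G Gadd
    have Gsum : ∀ (f : Fin n → M), G (∑ s, f s) = ∑ s, G (f s) := fun f => map_sum Ghom f _
    let f : M →ₗ[S] N :=
      { toFun m := ∑ s, x s • G (y s • m)
        map_add' m m' := by
          simp only [smul_add, Gadd, Finset.sum_add_distrib]
        map_smul' a m := by
          have h1 : ∀ s, G (y s • a • m) = ∑ t, ι 1 • y s • a • x t • G (y t • m) := by
            intro s
            conv_lhs => rw [hsum m, Finset.smul_sum, Finset.smul_sum, Gsum]
            refine Finset.sum_congr rfl fun t _ => ?_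
            have := Gmul (y s * a * x t) (y t • m)
            simp only [mul_smul] at this
            exact this
          simp only [h1, RingHom.id_apply]
          simp only [← Finset.smul_sum]
          exact (hsum' _).symm }
    refine ⟨ModuleCat.ofHom f, ?_⟩
    ext m
    apply Subtype.ext
    change ∑ s, x s • G (y s • m.1) = (g' m).1
    have hm : ι 1 • m.1 = m.1 := m.2
    have h1 : ∀ s, G (y s • m.1) = ι 1 • y s • G m.1 := by
      intro s
      conv_lhs => rw [← hm]
      exact Gmul _ _
    simp only [h1]
    rw [← hsum']
    exact congrArg (fun q => (g' q).1) (Subtype.ext hm)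

/-- The `S`-module of additive maps `S → N` which are linear over the corner, with the action of `S`
by right multiplication on the argument. A member satisfies `φ (e * x) = φ x`. -/
def coinduced (ι : C →ₗ[R] S) (N : Type u) [AddCommGroup N] [Module C N] : AddSubgroup
    (S →+ N) where
  carrier := {φ | ∀ c x, φ (ι c * x) = c • φ x}
  zero_mem' c x := (smul_zero c).symm
  add_mem' {a b} ha hb c x := by
    rw [AddMonoidHom.add_apply, AddMonoidHom.add_apply, ha, hb, smul_add]
  neg_mem' {a} ha c x := by
    rw [AddMonoidHom.neg_apply, AddMonoidHom.neg_apply, ha, smul_neg]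

instance (N : Type u) [AddCommGroup N] [Module C N] : Module S (coinduced ι N) where
  smul r φ := ⟨φ.1.comp (AddMonoidHom.mulRight r), fun c x => by
    change φ.1 (ι c * x * r) = c • φ.1 (x * r)
    rw [mul_assoc, φ.2]⟩
  one_smul φ := Subtype.ext (AddMonoidHom.ext fun x => congrArg φ.1 (mul_one x))
  mul_smul a b φ := Subtype.ext (AddMonoidHom.ext fun x => congrArg φ.1 (mul_assoc x a b).symm)
  smul_zero a := rfl
  smul_add a φ ψ := rfl
  add_smul a b φ := Subtype.ext (AddMonoidHom.ext fun x =>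
    (congrArg φ.1 (mul_add x a b)).trans (map_add φ.1 _ _))
  zero_smul φ := Subtype.ext (AddMonoidHom.ext fun x =>
    (congrArg φ.1 (mul_zero x)).trans (map_zero φ.1))

instance (h : IsFullCorner ι) : h.fixedFunctor.EssSurj where
  mem_essImage N := by
    choose κ hκ using h.exists_map_eq
    have κadd : ∀ x y, κ (x + y) = κ x + κ y := by
      intro x y
      apply h.injective
      rw [map_add, hκ, hκ, hκ, mul_add, add_mul]
    have κmul : ∀ c x, κ (ι c * x) = c * κ x := by
      intro c x
      apply h.injective
      rw [h.map_mul, hκ, hκ, ← mul_assoc, ← mul_assoc, ← mul_assoc, h.one_mul_map, h.map_mul_one]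
    have κone : κ (ι 1) = 1 := by
      apply h.injective
      rw [hκ, h.map_mul_one, h.map_mul_one]
    have κmulone : ∀ x, κ (x * ι 1) = κ x := by
      intro x
      apply h.injective
      rw [hκ, hκ, mul_assoc, mul_assoc, h.map_mul_one, mul_assoc]
    let M : ModuleCat.{u} S := ModuleCat.of S (coinduced ι N)
    let := h.fixedModule M
    let Ψ : fixedSubgroup ι M ≃ₗ[C] N :=
      { toFun φ := φ.1.1 (ι 1)
        map_add' φ ψ := rfl
        map_smul' c φ := by
          change φ.1.1 (ι 1 * ι c) = c • φ.1.1 (ι 1)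
          rw [← φ.1.2, h.one_mul_map, h.map_mul_one]
        invFun n := ⟨⟨AddMonoidHom.mk' (fun x => κ x • n) fun x y => by rw [κadd, add_smul],
            fun c x => by
              change κ _ • n = c • κ x • n
              rw [κmul, mul_smul]⟩,
          Subtype.ext (AddMonoidHom.ext fun x => by
              change κ (x * ι 1) • n = κ x • n
              rw [κmulone])⟩
        left_inv φ := by
          refine Subtype.ext (Subtype.ext (AddMonoidHom.ext fun x => ?_))
          change κ x • φ.1.1 (ι 1) = φ.1.1 x
          have h1 : ∀ x, φ.1.1 (x * ι 1) = φ.1.1 x := fun x =>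
            congrArg (fun q => q.1 x) φ.2
          have h2 : φ.1.1 (ι 1 * x) = φ.1.1 x := by rw [φ.1.2, one_smul]
          rw [← φ.1.2, hκ, mul_assoc, h.map_mul_one, h1, h2]
        right_inv n := by
          change κ (ι 1) • n = n
          rw [κone, one_smul] }
    exact ⟨M, ⟨Ψ.toModuleIso⟩⟩

open scoped ModuleCat.Algebra in
/-- An algebra is Morita equivalent to its full corners. The functor `M ↦ e M` is full and faithful
because `S e S = S`, and essentially surjective because `e` times the coinduced module of `N` is
`N`. -/
theorem isMoritaEquivalent (h : IsFullCorner ι) : IsMoritaEquivalent R S C := by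
  have : h.fixedFunctor.IsEquivalence := {}
  refine ⟨⟨⟨h.fixedFunctor.asEquivalence, ?_⟩⟩⟩
  change h.fixedFunctor.Linear R
  refine ⟨fun {M N} f r => ?_⟩
  ext m
  apply Subtype.ext
  change algebraMap R S r • f.hom m.1 = ι (algebraMap R C r) • f.hom m.1
  have hm : ι 1 • f.hom m.1 = f.hom m.1 := by rw [← map_smul, show ι 1 • m.1 = m.1 from m.2]
  rw [Algebra.algebraMap_eq_smul_one, Algebra.algebraMap_eq_smul_one, map_smul, smul_assoc,
      smul_assoc, hm, one_smul]

end IsFullCorner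

/-! ### A full corner from a Morita equivalence -/

section Extraction

open CategoryTheory

/-- The module `E⁻¹ B` is a generator: the functor `E` kills the quotient of `A` by the trace ideal
of `E⁻¹ B`, as every map from `E⁻¹ B` to `A` has its image in the trace ideal. -/
theorem exists_sum_apply_eq_one {A B : Type u} [Ring A] [Ring B]
    (E : ModuleCat.{u} A ≌ ModuleCat.{u} B) :
    ∃ (n : ℕ) (f : Fin n → (E.inverse.obj (ModuleCat.of B B) →ₗ[A] A))
      (p : Fin n → E.inverse.obj (ModuleCat.of B B)),
      ∑ s, f s (p s) = 1 := by
  let T : Submodule A A := Submodule.span A {x | ∃ (f : E.inverse.obj (ModuleCat.of B B) →ₗ[A] A)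
      (p : _), f p = x}
  suffices h : (1 : A) ∈ T by
    obtain ⟨n, a, g, h⟩ := Submodule.mem_span_set'.mp h
    choose f p hfp using fun s => (g s).2
    refine ⟨n, f, fun s => a s • p s, ?_⟩
    rw [← h]
    exact Finset.sum_congr rfl fun s _ => by rw [map_smul, hfp]
  let q : ModuleCat.of A A ⟶ ModuleCat.of A (A ⧸ T) := ModuleCat.ofHom T.mkQ
  have hq : E.functor.map q = 0 := by
    ext x
    let g : ModuleCat.of B B ⟶ E.functor.obj (ModuleCat.of A A) :=
        ModuleCat.ofHom (LinearMap.toSpanSingleton B _ x)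
    have h0 : g ≫ E.functor.map q = 0 := by
      apply E.inverse.map_injective
      rw [Functor.map_comp, E.inv_fun_map, Functor.map_zero]
      have h1 : (E.inverse.map g ≫ E.unitInv.app (ModuleCat.of A A)) ≫ q = 0 := by
        ext y
        change T.mkQ ((E.inverse.map g ≫ E.unitInv.app (ModuleCat.of A A)).hom y) = 0
        rw [Submodule.mkQ_apply, Submodule.Quotient.mk_eq_zero]
        exact Submodule.subset_span ⟨_, y, rfl⟩
      rw [← Category.assoc, ← Category.assoc, h1, Limits.zero_comp]
    have h1 : (g ≫ E.functor.map q).hom (1 : B) = 0 := by rw [h0]; rfl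
    rw [ModuleCat.comp_apply] at h1
    have h2 : g.hom (1 : B) = x := one_smul B x
    rw [h2] at h1
    rw [h1]; rfl
  have hq0 : q = 0 := E.functor.map_injective (by rw [hq, Functor.map_zero])
  have h1 : q.hom (1 : A) = 0 := by rw [hq0]; rfl
  exact (Submodule.Quotient.mk_eq_zero T).mp h1

/-- If `P` is a finitely generated projective generator over `A` with dual basis `H`, `q`, and its
endomorphism ring is opposite to `B` through `α`, then `B` is a full corner of a matrix algebra over
`A`. The entries of the matrix of `b` are `H j (α b (q i))`. -/
theorem exists_isFullCorner_matrix {k A B P : Type*} [CommRing k] [Ring A] [Algebra k A] [Ring B]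
    [Algebra k B]
    [AddCommGroup P] [Module A P] {n m : ℕ} (f : Fin n → P →ₗ[A] A) (p : Fin n → P)
        (hfp : ∑ s, f s (p s) = 1)
    (H : Fin m → P →ₗ[A] A) (q : Fin m → P) (hHq : ∀ x, ∑ j, H j x • q j = x)
    (α : B → P →ₗ[A] P) (hα : Function.Bijective α) (hadd : ∀ b b', α (b + b') = α b + α b')
    (hsmul : ∀ (c : k) b x, α (c • b) x = algebraMap k A c • α b x)
    (hone : α 1 = LinearMap.id) (hmul : ∀ b b', α (b * b') = α b' ∘ₗ α b) :
    ∃ ι : B →ₗ[k] Matrix (Fin m) (Fin m) A, IsFullCorner ι := by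
  let ι : B →ₗ[k] Matrix (Fin m) (Fin m) A :=
    { toFun b := Matrix.of fun i j => H j (α b (q i))
      map_add' b b' := by
        ext i j
        simp [hadd]
      map_smul' c b := by
        ext i j
        change H j (α (c • b) (q i)) = c • H j (α b (q i))
        rw [hsmul, map_smul, Algebra.smul_def, smul_eq_mul] }
  have hι : ∀ b i j, ι b i j = H j (α b (q i)) := fun _ _ _ => rfl
  refine ⟨ι, ⟨?_, ?_, ?_, ?_⟩⟩
  · intro b b'
    ext i j
    rw [Matrix.mul_apply, hι, hmul]
    simp only [hι]
    conv_lhs => rw [LinearMap.comp_apply, ← hHq (α b (q i)), map_sum, map_sum]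
    exact Finset.sum_congr rfl fun l _ => by rw [map_smul, map_smul, smul_eq_mul]
  · intro b b' h
    apply hα.injective
    ext x
    have h1 : ∀ i, α b (q i) = α b' (q i) := by
      intro i
      rw [← hHq (α b (q i)), ← hHq (α b' (q i))]
      exact Finset.sum_congr rfl fun j _ => by rw [← hι, h, hι]
    rw [← hHq x, map_sum, map_sum]
    exact Finset.sum_congr rfl fun j _ => by rw [map_smul, map_smul, h1]
  · intro X
    obtain ⟨b, hb⟩ := hα.surjective
      (∑ i, ∑ j, (LinearMap.toSpanSingleton A P (q j)) ∘ₗ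
        (LinearMap.toSpanSingleton A A (X i j)) ∘ₗ H i)
    refine ⟨b, ?_⟩
    ext s l
    rw [hι, hb]
    simp only [Matrix.mul_apply, hι, hone, LinearMap.sum_apply, LinearMap.comp_apply,
        LinearMap.id_apply,
      LinearMap.toSpanSingleton_apply, map_sum, map_smul, smul_eq_mul, Finset.sum_mul]
    rw [Finset.sum_comm]
  · have h1 : ∑ s, ∑ i, ∑ j, H i (p s) * ι 1 i j * f s (q j) = 1 := by
      rw [← hfp]
      refine Finset.sum_congr rfl fun s _ => ?_
      conv_rhs => rw [← hHq (p s), map_sum]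
      refine Finset.sum_congr rfl fun i _ => ?_
      conv_rhs => rw [map_smul, ← hHq (q i), map_sum, smul_eq_mul, Finset.mul_sum]
      refine Finset.sum_congr rfl fun j _ => ?_
      rw [map_smul, smul_eq_mul, hι, hone, mul_assoc]
      rfl
    let x : Fin n × Fin m → Matrix (Fin m) (Fin m) A := fun t =>
      Matrix.of fun a i => if a = t.2 then H i (p t.1) else 0
    let y : Fin n × Fin m → Matrix (Fin m) (Fin m) A := fun t =>
      Matrix.of fun j a => if a = t.2 then f t.1 (q j) else 0
    refine ⟨_, x ∘ finProdFinEquiv.symm, y ∘ finProdFinEquiv.symm, ?_⟩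
    rw [← finProdFinEquiv.sum_comp]
    simp only [Function.comp_apply, Equiv.symm_apply_apply]
    ext a c
    have h2 : ∀ t, (x t * ι 1 * y t) a c = if a = t.2 then if c = t.2 then
        ∑ i, ∑ j, H i (p t.1) * ι 1 i j * f t.1 (q j) else 0 else 0 := by
      intro t
      simp only [Matrix.mul_apply, x, y, Matrix.of_apply]
      split_ifs with h h'
      · rw [Finset.sum_comm]
        simp only [Finset.sum_mul]
      all_goals simp
    rw [Matrix.sum_apply, Fintype.sum_prod_type, Matrix.one_apply]
    simp only [h2, Finset.sum_ite_eq, Finset.mem_univ, if_true]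
    by_cases hac : a = c
    · subst hac
      simpa using h1
    · simp [hac, Ne.symm hac]

open scoped ModuleCat.Algebra in
/-- An algebra that is Morita equivalent to `A` is a full corner of a matrix algebra over `A`: the
module `E⁻¹ B` is a finitely generated projective generator, since `E A` is a generator as well, and
has the endomorphism ring `B`. -/
theorem IsMoritaEquivalent.exists_isFullCorner {k A B : Type u} [CommRing k] [Ring A] [Algebra k A]
    [Ring B] [Algebra k B]
    (h : IsMoritaEquivalent k A B) : ∃ (m : ℕ) (ι : B →ₗ[k] Matrix (Fin m) (Fin m) A),
        IsFullCorner ι := by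
  obtain ⟨e⟩ := h.cond
  let E : ModuleCat.{u} A ≌ ModuleCat.{u} B := e.eqv
  have : E.inverse.Linear k := e.symm.linear
  have : E.inverse.Additive := inferInstanceAs e.symm.eqv.functor.Additive
  have hlin : ∀ (X Y : ModuleCat.{u} B) (f g : X ⟶ Y) (c : k),
      (∀ x, g.hom x = algebraMap k B c • f.hom x) →
      ∀ x, (E.inverse.map g).hom x = algebraMap k A c • (E.inverse.map f).hom x := by
    intro X Y f g c hfg x
    have h1 : g = c • f := by
      ext x
      exact hfg x
    rw [h1, Functor.map_smul]
    rfl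
  obtain ⟨n, f, p, hfp⟩ := exists_sum_apply_eq_one E
  obtain ⟨m, g, y, hgy⟩ := exists_sum_apply_eq_one E.symm
  let g' : Fin m → (E.functor.obj (ModuleCat.of A A) ⟶ ModuleCat.of B B) := fun j =>
      ModuleCat.ofHom (g j)
  let h' : Fin m → (ModuleCat.of B B ⟶ E.functor.obj (ModuleCat.of A A)) := fun j =>
    ModuleCat.ofHom (LinearMap.toSpanSingleton B _ (y j))
  have hid : ∑ j, h' j ≫ g' j = 𝟙 (ModuleCat.of B B) := by
    ext
    rw [ModuleCat.hom_sum, LinearMap.sum_apply]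
    change ∑ j, g j ((1 : B) • y j) = 1
    refine Eq.trans (Finset.sum_congr rfl fun j _ => ?_) hgy
    rw [one_smul]
  let H : Fin m → (E.inverse.obj (ModuleCat.of B B) ⟶ ModuleCat.of A A) := fun j =>
    E.inverse.map (h' j) ≫ E.unitInv.app _
  let G : Fin m → (ModuleCat.of A A ⟶ E.inverse.obj (ModuleCat.of B B)) := fun j =>
    E.unit.app _ ≫ E.inverse.map (g' j)
  have hHG : ∑ j, H j ≫ G j = 𝟙 _ := by
    rw [← E.inverse.map_id, ← hid, Functor.map_sum]
    refine Finset.sum_congr rfl fun j _ => ?_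
    simp [H, G]
  let α : B → (E.inverse.obj (ModuleCat.of B B) →ₗ[A] E.inverse.obj (ModuleCat.of B B)) := fun b =>
    (E.inverse.map (ModuleCat.ofHom (LinearMap.toSpanSingleton B B b))).hom
  refine ⟨m, exists_isFullCorner_matrix (k := k) f p hfp (fun j => (H j).hom)
      (fun j => (G j).hom (1 : A)) ?_ α ?_ ?_ ?_ ?_ ?_⟩
  · intro x
    have h1 := congrArg (fun q => q.hom x) hHG
    simp only [ModuleCat.hom_sum, LinearMap.sum_apply] at h1
    refine Eq.trans ?_ h1
    refine Finset.sum_congr rfl fun j _ => ?_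
    rw [← map_smul, smul_eq_mul, mul_one]
    rfl
  · constructor
    · intro b b' hb
      have h1 := E.inverse.map_injective (ModuleCat.hom_ext hb)
      have h2 := congrArg (fun q => q.hom (1 : B)) h1
      change (1 : B) • b = (1 : B) • b' at h2
      rwa [one_smul, one_smul] at h2
    · intro φ
      obtain ⟨ψ, hψ⟩ := E.inverse.map_surjective (ModuleCat.ofHom φ)
      refine ⟨ψ.hom (1 : B), ?_⟩
      have h1 : ModuleCat.ofHom (LinearMap.toSpanSingleton B B (ψ.hom (1 : B))) = ψ := by
        ext
        change (1 : B) • (ψ.hom (1 : B) : B) = ψ.hom (1 : B)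
        rw [one_smul]
      change (E.inverse.map _).hom = φ
      rw [h1, hψ]
      rfl
  · intro b b'
    change (E.inverse.map _).hom = (E.inverse.map _).hom + (E.inverse.map _).hom
    rw [← ModuleCat.hom_add, ← Functor.map_add]
    congr 2
    ext
    change (1 : B) • (b + b') = (1 : B) • b + (1 : B) • b'
    rw [smul_add]
  · intro c b x
    refine hlin _ _ _ _ c (fun z : B => ?_) x
    change z • (c • b) = algebraMap k B c • (z • b)
    rw [algebraMap_smul, smul_comm]
  · change (E.inverse.map _).hom = _
    have h1 : ModuleCat.ofHom (LinearMap.toSpanSingleton B B (1 : B)) = 𝟙 (ModuleCat.of B B) := by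
      ext
      change (1 : B) • (1 : B) = 1
      rw [one_smul]
    rw [h1, E.inverse.map_id]
    rfl
  · intro b b'
    change (E.inverse.map _).hom = (E.inverse.map _).hom ∘ₗ (E.inverse.map _).hom
    rw [← ModuleCat.hom_comp, ← Functor.map_comp]
    congr 2
    ext
    change (1 : B) • (b * b') = ((1 : B) • b) • b'
    rw [one_smul, one_smul, smul_eq_mul]

end Extraction

/-! ### Lifting full corners -/

section CornerAlgebra

/-- The corner `e S e` of an algebra, with the unit `e`, is an algebra. -/
noncomputable instance cornerAlgebra {R S : Type*} [CommRing R] [Ring S] [Algebra R S] {e : S}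
    (he : IsIdempotentElem e) :
    Algebra R he.Corner :=
  RingHom.toAlgebra'
    { toFun a := ⟨a • e, (Subsemigroup.mem_corner_iff he).mpr
        ⟨by rw [mul_smul_comm, he.eq], by rw [smul_mul_assoc, he.eq]⟩⟩
      map_one' := Subtype.ext (one_smul R e)
      map_mul' a b := Subtype.ext (by
        change (a * b) • e = (a • e) * (b • e)
        rw [smul_mul_smul_comm, he.eq])
      map_zero' := Subtype.ext (zero_smul R e)
      map_add' a b := Subtype.ext (add_smul a b e) }
    (fun a x => Subtype.ext (by
      change (a • e) * x.1 = x.1 * (a • e)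
      obtain ⟨h1, h2⟩ := (Subsemigroup.mem_corner_iff he).mp x.2
      rw [smul_mul_assoc, mul_smul_comm, h1, h2]))

/-- The linear inclusion of the corner `e S e` into `S`. -/
noncomputable def cornerInclusion (R : Type*) {S : Type*} [CommRing R] [Ring S] [Algebra R S]
    {e : S} (he : IsIdempotentElem e) :
    he.Corner →ₗ[R] S where
  toFun x := x.1
  map_add' _ _ := rfl
  map_smul' a x := by
    change (a • e) * x.1 = a • x.1
    rw [smul_mul_assoc, ((Subsemigroup.mem_corner_iff he).mp x.2).1]

end CornerAlgebra

section Lift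

variable {R k S B : Type*} {S' : Type*} [CommRing R] [Field k] [Algebra R k] {π : R}
  [IsAdicComplete (Ideal.span {π}) R]
  [Ring S] [Algebra R S] [Module.Finite R S]
  [Ring S'] [Algebra R S'] [Algebra k S'] [IsScalarTower R k S']
  [Ring B] [Algebra R B] [Algebra k B] [IsScalarTower R k B]

/-- An idempotent is full if its reduction is full: by Nakayama's lemma, a lift of the equation is
the equation up to a right invertible element. -/
theorem IsReduction.exists_sum_eq_one {ρ : S →ₐ[R] S'} (hρ : IsReduction π ρ) {e : S} {n : ℕ}
    {x y : Fin n → S'}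
    (hxy : ∑ s, x s * ρ e * y s = 1) : ∃ x y : Fin n → S, ∑ s, x s * e * y s = 1 := by
  choose x' hx' using fun s => hρ.surjective (x s)
  choose y' hy' using fun s => hρ.surjective (y s)
  obtain ⟨u, hu⟩ : ∃ u, (∑ s, x' s * e * y' s) - 1 = π • u := by
    apply hρ.ker
    simp only [map_sub, map_sum, map_mul, map_one, hx', hy', hxy, sub_self]
  have hN : (⊤ : Submodule R S) ≤ LinearMap.range (LinearMap.mulLeft R (∑ s, x' s * e * y' s)) := by
    refine Submodule.le_of_le_smul_of_le_jacobson_bot (I := Ideal.span {π}) Module.Finite.fg_top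
      (IsAdicComplete.le_jacobson_bot _) ?_
    intro z _
    have h1 : z = (∑ s, x' s * e * y' s) * z - π • (u * z) := by
      rw [← smul_mul_assoc, ← hu, sub_mul, one_mul, sub_sub_cancel]
    rw [h1]
    refine Submodule.sub_mem _ (Submodule.mem_sup_left ⟨z, rfl⟩) (Submodule.mem_sup_right ?_)
    exact Submodule.smul_mem_smul (Ideal.mem_span_singleton_self π) Submodule.mem_top
  obtain ⟨v, hv⟩ := hN (Submodule.mem_top (x := 1))
  refine ⟨x', fun s => y' s * v, ?_⟩
  rw [← hv, LinearMap.mulLeft_apply, Finset.sum_mul]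
  exact Finset.sum_congr rfl fun s _ => (mul_assoc _ _ _).symm

/-- A full corner of the reduction of `S` is the reduction of a full corner of `S`. -/
theorem IsFullCorner.exists_lift [Module.Free R S] (hπ : algebraMap R k π = 0) {ρ : S →ₐ[R] S'}
    (hρ : IsReduction π ρ) {ι' : B →ₗ[k] S'} (h : IsFullCorner ι') :
    ∃ (e : S) (he : IsIdempotentElem e) (r : he.Corner →ₐ[R] B),
        IsFullCorner (cornerInclusion R he) ∧
      IsReduction π r ∧ ∀ c, ι' (r c) = ρ (cornerInclusion R he c) := by
  obtain ⟨x₀, hx₀⟩ := hρ.surjective (ι' 1)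
  obtain ⟨e, he, y, hy⟩ := exists_isIdempotentElem_sub_eq_smul (π := π) (x := x₀) (hρ.ker _ (by
    rw [map_sub, _root_.map_mul, hx₀, ← h.map_mul, one_mul, sub_self]))
  have hπS : ∀ z : S, ρ (π • z) = 0 := by
    intro z
    rw [map_smul, ← algebraMap_smul k, hπ, zero_smul]
  have hρe : ρ e = ι' 1 := by
    rw [← hx₀, ← sub_eq_zero, ← map_sub, hy, hπS]
  have hinc : ∀ c : he.Corner, e * cornerInclusion R he c * e = cornerInclusion R he c :=
      fun c => by
    obtain ⟨h1, h2⟩ := (Subsemigroup.mem_corner_iff he).mp c.2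
    change e * c.1 * e = c.1
    rw [h1, h2]
  have hmem : ∀ x : S, e * x * e ∈ Subsemigroup.corner e := fun x =>
    (Subsemigroup.mem_corner_iff he).mpr
      ⟨by rw [← mul_assoc, ← mul_assoc, he.eq], by rw [mul_assoc, he.eq]⟩
  choose r hr using fun c : he.Corner => h.exists_map_eq (ρ (cornerInclusion R he c))
  have hr' : ∀ c, ι' (r c) = ρ (cornerInclusion R he c) := fun c => by
    rw [hr, ← hρe, ← _root_.map_mul, ← _root_.map_mul, hinc]
  obtain ⟨n, x, y, hxy⟩ := h.full
  rw [← hρe] at hxy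
  obtain ⟨x', y', hxy'⟩ := hρ.exists_sum_eq_one hxy
  let rhom : he.Corner →ₐ[R] B :=
    { toFun := r
      map_one' := h.injective (by rw [hr']; exact hρe)
      map_mul' a b := h.injective (by rw [h.map_mul, hr', hr', hr', ← _root_.map_mul]; rfl)
      map_zero' := h.injective (by rw [hr', map_zero, map_zero, map_zero])
      map_add' a b := h.injective (by rw [map_add, hr', hr', hr', ← map_add]; rfl)
      commutes' a := h.injective (by
        rw [hr']
        change ρ (a • e) = _
        rw [map_smul, hρe, Algebra.algebraMap_eq_smul_one, ← algebraMap_smul k a (1 : B), map_smul,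
          algebraMap_smul]) }
  refine ⟨e, he, rhom, ⟨fun a b => rfl, Subtype.val_injective, fun x => ⟨⟨_, hmem x⟩, rfl⟩, n, x',
      y', hxy'⟩, ⟨?_, ?_⟩, hr'⟩
  · intro b
    obtain ⟨x, hx⟩ := hρ.surjective (ι' b)
    refine ⟨⟨_, hmem x⟩, h.injective ?_⟩
    refine (hr' _).trans ?_
    change ρ (e * x * e) = _
    rw [_root_.map_mul, _root_.map_mul, hx, hρe, h.one_mul_map, h.map_mul_one]
  · intro c hc
    have h1 : ρ (cornerInclusion R he c) = 0 := by
      rw [← hr', show r c = 0 from hc, map_zero]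
    obtain ⟨z, hz⟩ := hρ.ker _ h1
    refine ⟨⟨_, hmem z⟩, Subtype.ext ?_⟩
    change cornerInclusion R he c = (π • e) * (e * z * e)
    rw [← hinc c, hz, mul_smul_comm, smul_mul_assoc, smul_mul_assoc, ← mul_assoc, ← mul_assoc,
        he.eq]

end Lift

/-! ### Finiteness, matrix algebras, and the center of a full corner -/

/-- The element `z` is determined by the elements `e * y s * z * x t * e` of the corner, if `1` is
the sum of the `x s * e * y s`. -/
theorem IsFullCorner.finite {k B S : Type*} [Field k] [Ring B] [Algebra k B] [Ring S] [Algebra k S]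
    {ι : B →ₗ[k] S} (h : IsFullCorner ι) [Module.Finite k B] : Module.Finite k S := by
  obtain ⟨n, x, y, hxy⟩ := h.full
  let φ : S →ₗ[k] (Fin n × Fin n → LinearMap.range ι) := LinearMap.pi fun t =>
    ((LinearMap.mulLeft k (ι 1 * y t.1)) ∘ₗ (LinearMap.mulRight k
        (x t.2 * ι 1))).codRestrict _ (fun z => by
      obtain ⟨c, hc⟩ := h.exists_map_eq (y t.1 * z * x t.2)
      refine ⟨c, hc.trans ?_⟩
      simp only [LinearMap.comp_apply, LinearMap.mulLeft_apply, LinearMap.mulRight_apply,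
          mul_assoc])
  refine Module.Finite.of_injective φ ?_
  rw [injective_iff_map_eq_zero]
  intro z hz
  have h1 : ∀ s t, ι 1 * y s * (z * (x t * ι 1)) = 0 := fun s t =>
    congrArg Subtype.val (congrFun hz (s, t))
  have h2 : (∑ s, x s * ι 1 * y s) * z * (∑ t, x t * ι 1 * y t) = 0 := by
    rw [Finset.sum_mul, Finset.sum_mul_sum]
    refine Finset.sum_eq_zero fun s _ => Finset.sum_eq_zero fun t _ => ?_
    have : x s * ι 1 * y s * z * (x t * ι 1 * y t) = x s * (ι 1 * y s * (z * (x t * ι 1))) *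
        y t := by
      simp only [mul_assoc]
    rw [this, h1, mul_zero, zero_mul]
  rwa [hxy, one_mul, mul_one] at h2

theorem finite_of_finite_tensorProduct {R k A : Type*} [CommRing R] [Field k] [Algebra R k] [Ring A]
    [Algebra R A] [Module.Free R A] [Module.Finite k (k ⊗[R] A)] : Module.Finite R A := by
  have : Nontrivial R := (algebraMap R k).domain_nontrivial
  let b := Module.Free.chooseBasis R A
  have : Finite (Module.Free.ChooseBasisIndex R A) := Module.Finite.finite_basis (b.baseChange k)
  exact Module.Finite.of_basis b

section Base

variable {R k A : Type*} [CommRing R] [Field k] [Algebra R k] [Ring A] [Algebra R A] {π : R}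

/-- Reduction of the entries of a matrix. -/
noncomputable def matrixReduction (R k A : Type*) [CommRing R] [Field k] [Algebra R k] [Ring A]
    [Algebra R A] (m : ℕ) :
    Matrix (Fin m) (Fin m) A →ₐ[R] Matrix (Fin m) (Fin m) (k ⊗[R] A) :=
  (Algebra.TensorProduct.includeRight : A →ₐ[R] k ⊗[R] A).mapMatrix

theorem exists_eq_smul_of_one_tmul_eq_zero (hπ : ∀ a, algebraMap R k a = 0 ↔ π ∣ a)
    [Module.Free R A] [Module.Finite R A]
    {a : A} (ha : (1 : k) ⊗ₜ[R] a = 0) : ∃ a', a = π • a' := by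
  have : Nontrivial R := (algebraMap R k).domain_nontrivial
  let b := Module.Free.chooseBasis R A
  have h : ∀ i, ∃ c, b.repr a i = π * c := by
    intro i
    have h1 := congrArg (fun z => (b.baseChange k).repr z i) ha
    simp only [Module.Basis.baseChange_repr_tmul, map_zero, Finsupp.zero_apply] at h1
    rw [Algebra.smul_def, mul_one] at h1
    exact (hπ _).mp h1
  choose c hc using h
  refine ⟨∑ i, c i • b i, ?_⟩
  conv_lhs => rw [← b.sum_repr a]
  rw [Finset.smul_sum]
  exact Finset.sum_congr rfl fun i _ => by rw [hc, mul_smul]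

theorem isReduction_matrixReduction (hk : Function.Surjective (algebraMap R k))
    (hπ : ∀ a, algebraMap R k a = 0 ↔ π ∣ a) [Module.Free R A] [Module.Finite R A] (m : ℕ) :
    IsReduction π (matrixReduction R k A m) where
  surjective X := by
    have h : ∀ z : k ⊗[R] A, ∃ a : A, (1 : k) ⊗ₜ[R] a = z := by
      intro z
      induction z using TensorProduct.induction_on with
      | zero => exact ⟨0, TensorProduct.tmul_zero _ _⟩
      | tmul c a =>
        obtain ⟨r, rfl⟩ := hk c
        exact ⟨r • a, by rw [← TensorProduct.smul_tmul, Algebra.smul_def, mul_one]⟩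
      | add x y hx hy =>
        obtain ⟨a, rfl⟩ := hx
        obtain ⟨b, rfl⟩ := hy
        exact ⟨a + b, TensorProduct.tmul_add _ _ _⟩
    choose g hg using fun i j => h (X i j)
    refine ⟨Matrix.of g, ?_⟩
    ext i j
    exact hg i j
  ker X hX := by
    choose g hg using fun i j => exists_eq_smul_of_one_tmul_eq_zero hπ (congrFun (congrFun hX i) j)
    exact ⟨Matrix.of g, by ext i j; exact hg i j⟩

end Base

section CornerCenter

variable {R A B : Type*} [CommRing R] [IsDomain R] [Ring A] [Algebra R A] [Module.Free R A]
  [Ring B] [Algebra R B]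
  {π : R} {m : ℕ} {e : Matrix (Fin m) (Fin m) A}

/-- The map from the center of `A` to the corner of a matrix algebra over `A`, `z ↦ z * e`. -/
noncomputable def centerToCorner (R : Type*) {A : Type*} [CommRing R] [Ring A] [Algebra R A] {m : ℕ}
    {e : Matrix (Fin m) (Fin m) A} (he : IsIdempotentElem e) :
    Subalgebra.center R A →ₐ[R] he.Corner :=
  have hcomm : ∀ (z : Subalgebra.center R A) (X : Matrix (Fin m) (Fin m) A),
      Matrix.scalar (Fin m) (z : A) * X =
      X * Matrix.scalar (Fin m) (z : A) := fun z X =>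
    Matrix.scalar_comm z.1 (fun r => (Subalgebra.mem_center_iff.mp z.2 r).symm) X
  { toFun z := ⟨Matrix.scalar (Fin m) (z : A) * e, (Subsemigroup.mem_corner_iff he).mpr
      ⟨by rw [← mul_assoc, ← hcomm, mul_assoc, he.eq], by rw [mul_assoc, he.eq]⟩⟩
    map_one' := Subtype.ext (by
      change Matrix.scalar (Fin m) (1 : A) * e = e
      rw [map_one, one_mul])
    map_mul' z z' := Subtype.ext (by
      change Matrix.scalar (Fin m) (z * z' : A) * e = Matrix.scalar (Fin m) (z : A) * e *
          (Matrix.scalar (Fin m) (z' : A) * e)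
      rw [mul_assoc, ← mul_assoc e, ← hcomm, mul_assoc _ e, he.eq, ← mul_assoc, map_mul])
    map_zero' := Subtype.ext (by
      change Matrix.scalar (Fin m) (0 : A) * e = 0
      rw [map_zero, zero_mul])
    map_add' z z' := Subtype.ext (by
      change Matrix.scalar (Fin m) (z + z' : A) * e = Matrix.scalar (Fin m) (z : A) * e +
          Matrix.scalar (Fin m) (z' : A) * e
      rw [map_add, add_mul])
    commutes' a := Subtype.ext (by
      change Matrix.scalar (Fin m) (algebraMap R A a) * e = a • e
      rw [Algebra.smul_def]
      rfl) }

/-- An order isomorphic to the center of `A` acts on a full corner of a matrix algebra over `A`.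
Fullness recovers a central element `z` from `z * e`; hence the map to the corner is injective and
has a pure image. -/
theorem isCentralOrder_centerToCorner [NeZero m] (hπ0 : π ≠ 0) {he : IsIdempotentElem e}
    (h : IsFullCorner (cornerInclusion R he))
    {r : he.Corner →ₐ[R] B} (hr : IsReduction π r) (ψ : centerOrder R ≃ₐ[R] Subalgebra.center R A) :
    IsCentralOrder π r ((centerToCorner R he).comp ψ.toAlgHom) := by
  have hcomm : ∀ (z : Subalgebra.center R A) (X : Matrix (Fin m) (Fin m) A),
      Matrix.scalar (Fin m) (z : A) * X =
      X * Matrix.scalar (Fin m) (z : A) := fun z X =>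
    Matrix.scalar_comm z.1 (fun r => (Subalgebra.mem_center_iff.mp z.2 r).symm) X
  obtain ⟨n, x, y, hxy⟩ := h.full
  have hxy' : ∑ s, x s * e * y s = 1 := hxy
  have hz : ∀ z : Subalgebra.center R A, Matrix.scalar (Fin m) (z : A) =
      ∑ s, x s * (cornerInclusion R he (centerToCorner R he z)) * y s := by
    intro z
    change _ = ∑ s, x s * (Matrix.scalar (Fin m) (z : A) * e) * y s
    conv_lhs => rw [← mul_one (Matrix.scalar (Fin m) (z : A)), ← hxy', Finset.mul_sum]
    refine Finset.sum_congr rfl fun s _ => ?_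
    rw [← mul_assoc (x s), ← hcomm]
    simp only [mul_assoc]
  have hentry : ∀ a : A, Matrix.scalar (Fin m) a 0 0 = a := fun a => by simp
  refine ⟨?_, ?_, ?_⟩
  · intro s X
    apply Subtype.ext
    change Matrix.scalar (Fin m) (ψ s : A) * e * X.1 = X.1 * (Matrix.scalar (Fin m) (ψ s : A) * e)
    obtain ⟨h1, h2⟩ := (Subsemigroup.mem_corner_iff he).mp X.2
    rw [mul_assoc, h1, hcomm, ← hcomm, ← mul_assoc, ← hcomm, mul_assoc, h2]
  · rw [injective_iff_map_eq_zero]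
    intro s hs
    have h1 := hz (ψ s)
    rw [show centerToCorner R he (ψ s) = 0 from hs] at h1
    simp only [map_zero, mul_zero, zero_mul, Finset.sum_const_zero] at h1
    have h2 : (ψ s : A) = 0 := by rw [← hentry (ψ s : A), h1]; rfl
    exact (map_eq_zero_iff ψ ψ.injective).mp (Subtype.ext h2)
  · intro s hs
    obtain ⟨c, hc⟩ := hr.ker _ hs
    have h1 := hz (ψ s)
    rw [show centerToCorner R he (ψ s) = π • c from hc, map_smul] at h1
    simp only [mul_smul_comm, smul_mul_assoc, ← Finset.smul_sum] at h1
    set u := ∑ s, x s * cornerInclusion R he c * y s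
    have h2 : (ψ s : A) = π • u 0 0 := by rw [← hentry (ψ s : A), h1]; rfl
    have hu : u 0 0 ∈ Subalgebra.center R A := by
      rw [Subalgebra.mem_center_iff]
      intro a
      have h3 := Subalgebra.mem_center_iff.mp (ψ s).2 a
      rw [h2, mul_smul_comm, smul_mul_assoc] at h3
      exact smul_right_injective A hπ0 h3
    refine ⟨ψ.symm ⟨_, hu⟩, ψ.injective ?_⟩
    rw [map_smul, AlgEquiv.apply_symm_apply]
    exact Subtype.ext h2

end CornerCenter

/-! ### The Morita equivalence over the complete discrete valuation ring -/

theorem finite_free_of_injective {R M N : Type*} [CommRing R] [IsDomain R] [IsPrincipalIdealRing R]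
    [AddCommGroup M] [Module R M]
    [AddCommGroup N] [Module R N] [Module.Finite R N] [Module.Free R N] (f : M →ₗ[R] N)
        (hf : Function.Injective f) :
    Module.Finite R M ∧ Module.Free R M :=
  ⟨Module.Finite.of_injective f hf, Module.Free.of_equiv (LinearEquiv.ofInjective f hf).symm⟩

/-- A primitive cube root of unity of `k` lifts to `R`. -/
theorem exists_cyclotomic_root {R k : Type*} [CommRing R] [Field k] [IsAlgClosed k] [CharP k 2]
    [Algebra R k] {π t : R}
    (hk : Function.Surjective (algebraMap R k))
    (hπ : ∀ a, algebraMap R k a = 0 ↔ π ∣ a) [IsAdicComplete (Ideal.span {π}) R] (ht : 3 * t = 1) :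
    ∃ w : R, w ^ 2 + w + 1 = 0 := by
  open Polynomial in
  obtain ⟨z, hz⟩ := IsAlgClosed.exists_root (X ^ 2 + X + 1 : k[X]) (by
    have : (X ^ 2 + X + 1 : k[X]).degree = 2 := by compute_degree!
    rw [this]; exact two_ne_zero)
  obtain ⟨x, rfl⟩ := hk z
  have hx : π ∣ x ^ 2 + x + 1 := by
    rw [← hπ]
    simpa using hz
  obtain ⟨y, hy⟩ := hx
  have ht' : (3 : R[X]) * C t = 1 := by
    rw [← map_ofNat C, ← map_mul, ht, map_one]
  obtain ⟨w, hw, _⟩ := exists_root_of_newton (R := R) (C := R) (π := π) (p := X ^ 2 + X + 1)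
    (q := - C t * (2 * X + 1)) (v := 4 * C t + (C t * (2 * X + 1)) ^ 2) (by
      simp only [add_comp, pow_comp, X_comp, one_comp]
      linear_combination -(X ^ 2 + X + 1) * ht') (x := x) ⟨y, by simpa using hy⟩
  exact ⟨w, by simpa using hw⟩

theorem theoremB (O K : Type u)
    [CommRing O] [IsDomain O] [IsDiscreteValuationRing O]
    [IsAdicComplete (IsLocalRing.maximalIdeal O) O]
    [IsAlgClosed (IsLocalRing.ResidueField O)] [CharP (IsLocalRing.ResidueField O) 2]
    [Field K] [CharZero K] [Algebra O K] [IsFractionRing O K]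
    (A : Type u) [Ring A] [Algebra O A] [Module.Free O A]
    (hK : IsSplitSemisimple K (K ⊗[O] A))
    (hk : IsMoritaEquivalent (IsLocalRing.ResidueField O) (IsLocalRing.ResidueField O ⊗[O] A)
      (MonoidAlgebra (IsLocalRing.ResidueField O) TildeA4))
    (hΦ : ∃ Φ : ZIrr K (K ⊗[O] A) ≃+ ZIrr K (K ⊗[O] MonoidAlgebra O TildeA4),
      IsCharIsometry Φ ∧
      (∀ f ∈ projSubgroup O K A, Φ f ∈ projSubgroup O K (MonoidAlgebra O TildeA4)) ∧
      InducesCenterIso Φ) :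
    IsMoritaEquivalent O A (MonoidAlgebra O TildeA4) := by
  obtain ⟨Φ, -, -, F, θ, -, -⟩ := hΦ
  obtain ⟨π, hirr⟩ := IsDiscreteValuationRing.exists_irreducible O
  have hmax : IsLocalRing.maximalIdeal O = Ideal.span {π} := hirr.maximalIdeal_eq
  have hπ0 : π ≠ 0 := hirr.ne_zero
  have : IsAdicComplete (Ideal.span {π}) O := hmax ▸ inferInstance
  have : CharZero O := by
    have h := (algebraMap O K).charZero_iff (IsFractionRing.injective O K)
    exact h.mpr inferInstance
  set k := IsLocalRing.ResidueField O
  have hsurj : Function.Surjective (algebraMap O k) := IsLocalRing.residue_surjective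
  have hπ : ∀ a, algebraMap O k a = 0 ↔ π ∣ a := fun a => by
    rw [IsLocalRing.ResidueField.algebraMap_eq, IsLocalRing.residue_eq_zero_iff, hmax,
        Ideal.mem_span_singleton]
  have h2k : (2 : k) = 0 := CharTwo.two_eq_zero
  obtain ⟨d, hd⟩ : π ∣ 2 := by rw [← hπ, map_ofNat, h2k]
  obtain ⟨t, ht⟩ : ∃ t : O, 3 * t = 1 := by
    have h3 : IsUnit (3 : O) := by
      by_contra h3
      have h4 : (3 : O) ∈ IsLocalRing.maximalIdeal O := h3
      rw [hmax, Ideal.mem_span_singleton, ← hπ, map_ofNat] at h4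
      have : (1 : k) = 0 := by linear_combination h4 - h2k
      exact one_ne_zero this
    exact h3.exists_right_inv
  obtain ⟨w, hw⟩ := exists_cyclotomic_root hsurj hπ ht
  have hwk : (algebraMap O k w) ^ 2 + algebraMap O k w + 1 = 0 := by
    rw [← map_pow, ← map_add, ← map_one (algebraMap O k), ← map_add, hw, map_zero]
  have htk : 3 * algebraMap O k t = 1 := by
    rw [← map_ofNat (algebraMap O k), ← map_mul, ht, map_one]
  have hB := isQuiverModel_groupAlgebra hwk htk
  -- the group algebra over `O`
  obtain ⟨ψ⟩ := exists_center_algEquiv hw ht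
  have : Module.Finite O (MonoidAlgebra O TildeA4) :=
    Module.Finite.equiv (MonoidAlgebra.coeffLinearEquiv O).symm
  have : Module.Free O (MonoidAlgebra O TildeA4) :=
    Module.Free.of_equiv (MonoidAlgebra.coeffLinearEquiv O).symm
  have : Module.Finite k (MonoidAlgebra k TildeA4) :=
    Module.Finite.equiv (MonoidAlgebra.coeffLinearEquiv k).symm
  have hrG := isReduction_groupAlgebraReduction (π := π) hsurj hπ
  obtain ⟨j', β', hN'⟩ := exists_isNormalForm hsurj hπ hd hB hrG
    (isCentralOrder_of_center_algEquiv hπ0 hrG ψ.symm)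
    (completeOrthogonalIdempotents_eigenIdempotent hw ht (cyclicGenerator_pow_three O))
    (groupAlgebraReduction_eigenIdempotent w t)
  -- the corner of a matrix algebra over `A`
  obtain ⟨m, ι', hι'⟩ := hk.exists_isFullCorner
  have hfin := hι'.finite
  have : NeZero m := ⟨by
    rintro rfl
    exact one_ne_zero (hι'.injective (Subsingleton.elim (ι' 1) (ι' 0)))⟩
  have : Module.Finite k (k ⊗[O] A) :=
    Module.Finite.of_surjective (Matrix.entryLinearMap k (k ⊗[O] A) (0 : Fin m) (0 : Fin m))
      fun a => ⟨Matrix.of fun _ _ => a, rfl⟩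
  have : Module.Finite O A := finite_of_finite_tensorProduct (k := k)
  obtain ⟨e, he, r, hfull, hr, -⟩ := hι'.exists_lift ((hπ π).mpr dvd_rfl)
    (isReduction_matrixReduction hsurj hπ m)
  obtain ⟨_, _⟩ := finite_free_of_injective (cornerInclusion O he) hfull.injective
  have hj := isCentralOrder_centerToCorner hπ0 hfull hr (ψ.symm.trans θ.symm)
  -- an element of order three of the corner provides the idempotents
  obtain ⟨c₀, hc₀⟩ := hr.surjective (cyclicGenerator k)
  obtain ⟨c, hc, y, hy⟩ := exists_pow_three_eq_one (π := π) ht (x := c₀) (hr.ker _ (by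
    rw [map_sub, map_pow, hc₀, cyclicGenerator_pow_three, map_one, sub_self]))
  have hrc : r c = cyclicGenerator k := by
    rw [← hc₀, ← sub_eq_zero, ← map_sub, hy, map_smul, ← algebraMap_smul k, (hπ π).mpr dvd_rfl,
        zero_smul]
  obtain ⟨j, β, hN⟩ := exists_isNormalForm hsurj hπ hd hB hr hj
    (completeOrthogonalIdempotents_eigenIdempotent hw ht hc) (fun i => by
      simp only [eigenIdempotent, map_smul, map_add, map_one, map_pow, hrc]
      simp only [← map_pow, algebraMap_smul])
  obtain ⟨iso⟩ := hN.nonempty_algEquiv hN'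
  exact ((IsMoritaEquivalent.matrix A O (ι := Fin m)).trans _ hfull.isMoritaEquivalent).trans _
      (.of_algEquiv _ iso)
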